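/- Let $k$ be a field of characteristic zero and $k^a$ an algebraic closure of $k$. A variety over a field is a separated scheme of finite type over it. A cover of curves is a non-constant $k^a$-morphism $\varphi : Y \to C\times_k k^a$, where $C$ is a smooth projective geometrically integral curve over $k$ and $Y$ is a smooth projective integral curve over $k^a$. Let $X$ be a $k^a$-variety or a cover of curves. Definitions. (a) $X$ has $k$ as field of moduli if for every $k$-automorphism $\sigma$ of $k^a$ the morphism $\mathrm{Spec}(\sigma)$ lifts to an automorphism of the scheme $X$ (for a cover $\varphi : Y\to C\times_k k^a$: to an automorphism of the scheme $Y$ compatible with the map $Y \to C$). (b) Let $l$ be an algebraic extension of $k$ and $e : l \to k^a$ a $k$-embedding. A model of $X$ over $l$ along $e$ is an $l$-variety $X_l$ (for covers of $C$: a smooth projective geometrically integral $l$-curve with a non-constant $l$-morphism to $C\times_k l$) whose base change along $e$ is isomorphic to $X$. A subfield $k\subset l\subset k^a$ is a field of definition of $X$ if $X$ has a model over $l$ along the inclusion $l \subset k^a$. There is a "model" of $X$ over $l$ if $X$ has a model over $l$ along some $k$-embedding $l\to k^a$. (c) There is a descent obstruction for $X$ if $X$ has $k$ as field of moduli but $k$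 is not a field of definition of $X$. (d) $\mathcal M_X$ is the category fibered over the site of finite étale $k$-schemes (coverings are the jointly surjective families) whose objects over $\mathrm{Spec}(l)$, $l$ a finite étale $k$-algebra, are the disjoint unions of "models" of $X$ over the connected components of $\mathrm{Spec}(l)$, and whose morphisms are the cartesian squares over $\mathrm{Spec}(k)$ (for covers of $C$: compatible with the maps to $C$). Proposition. Let $X$ and $Y$ be two objects, each of them a $k^a$-variety or a cover of curves, and let $F : \mathcal M_X \to \mathcal M_Y$ be a cartesian functor over the site of finite étale $k$-schemes. (1) If $X$ has $k$ as field of moduli, then so has $Y$. (2) For every field $k\subset l\subset k^a$: if there is a "model" of $X$ over $l$, then there is a "model" of $Y$ over $l$. If moreover $X$ has $k$ as field of moduli, then every field of definition $l$ of $X$ is a field of definition of $Y$. (3) Suppose that $X$ has $k$ as field of moduli, that $F$ is fully faithful, and that $\mathcal M_X$ (if $X$ is a variety) and $\mathcal M_Y$ (if $Y$ is a variety) are stacks. Then a field $k\subset l\subset k^a$ is a field of definition of $X$ if and only if it is a field of definition of $Y$; in particular there is a descent obstruction for $X$ if and only if there is one for $Y$. Lemma. Let $\mathcal X$ and $\mathcal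 Y$ be gerbes over a site and let $F : \mathcal X \to \mathcal Y$ be a cartesian functor over the site. If $F$ is fully faithful, then $F$ is essentially surjective (on every fiber). -/

import Mathlib

open CategoryTheory CategoryTheory.Functor CategoryTheory.Limits AlgebraicGeometry

universe u v₁ u₁ v₂ u₂ v₃ u₃

noncomputable section

/-! ### Stacks and gerbes over a site, as fibered categories -/

namespace FibStack

variable {𝒮 : Type u₁} [Category.{v₁} 𝒮]

/-- A descent datum relative to a sieve `R` on `U`: an object over `V` for every `f : V ⟶ U` in
`R`, and a compatible system of cartesian arrows between them (a cartesian section over `R`).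
When `R` is generated by a covering family `(Uᵢ ⟶ U)`, this is the same as a family of objects over
the `Uᵢ` with isomorphisms over the `Uᵢ ×_U Uⱼ` satisfying the cocycle condition. -/
structure DescentDatum {𝒳 : Type u₂} [Category.{v₂} 𝒳] (p : 𝒳 ⥤ 𝒮) {U : 𝒮} (R : Sieve U) where
  obj {V : 𝒮} (f : V ⟶ U) (hf : R f) : 𝒳
  map {W V : 𝒮} (e : W ⟶ U) (he : R e) (f : V ⟶ U) (hf : R f) (g : W ⟶ V) (w : g ≫ f = e) :
    obj e he ⟶ obj f hf
  isStronglyCartesian_map {W V : 𝒮} (e : W ⟶ U) (he : R e) (f : V ⟶ U) (hf : R f) (g : W ⟶ V)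
    (w : g ≫ f = e) : p.IsStronglyCartesian g (map e he f hf g w)
  map_id {V : 𝒮} (f : V ⟶ U) (hf : R f) : map f hf f hf (𝟙 V) (Category.id_comp f) = 𝟙 _
  map_comp {W' W V : 𝒮} (d : W' ⟶ U) (hd : R d) (e : W ⟶ U) (he : R e) (f : V ⟶ U) (hf : R f)
    (h : W' ⟶ W) (g : W ⟶ V) (w : h ≫ e = d) (w' : g ≫ f = e) :
    map d hd e he h w ≫ map e he f hf g w' =
      map d hd f hf (h ≫ g) (by rw [Category.assoc, w', w])

/-- The descent datum comes from an object over `U`. -/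
def DescentDatum.IsEffective {𝒳 : Type u₂} [Category.{v₂} 𝒳] {p : 𝒳 ⥤ 𝒮} {U : 𝒮} {R : Sieve U}
    (D : DescentDatum p R) : Prop :=
  ∃ (x : 𝒳) (c : ∀ {V : 𝒮} (f : V ⟶ U) (hf : R f), D.obj f hf ⟶ x),
    p.obj x = U ∧
    (∀ {V : 𝒮} (f : V ⟶ U) (hf : R f), p.IsStronglyCartesian f (c f hf)) ∧
    ∀ {W V : 𝒮} (e : W ⟶ U) (he : R e) (f : V ⟶ U) (hf : R f) (g : W ⟶ V) (w : g ≫ f = e),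
      D.map e he f hf g w ≫ c f hf = c e he

/-- A compatible family of morphisms from the restrictions of `a` along the arrows of `R` to the
restrictions of `b`. A morphism `f^*a ⟶ f^*b` in the fiber over `V` is recorded as an arrow
`f^*a ⟶ b` over `f : V ⟶ U`, for every choice `c : a' ⟶ a` of a pullback `f^*a`. -/
structure LocalHom {𝒳 : Type u₂} [Category.{v₂} 𝒳] (p : 𝒳 ⥤ 𝒮) {U : 𝒮} (R : Sieve U)
    (a b : 𝒳) where
  app {V : 𝒮} (f : V ⟶ U) (hf : R f) {a' : 𝒳} (c : a' ⟶ a) (hc : p.IsStronglyCartesian f c) :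
    a' ⟶ b
  isHomLift_app {V : 𝒮} (f : V ⟶ U) (hf : R f) {a' : 𝒳} (c : a' ⟶ a)
    (hc : p.IsStronglyCartesian f c) : p.IsHomLift f (app f hf c hc)
  comp_app {W V : 𝒮} (e : W ⟶ U) (he : R e) (f : V ⟶ U) (hf : R f) (g : W ⟶ V) (w : g ≫ f = e)
    {a'' a' : 𝒳} (c' : a'' ⟶ a) (hc' : p.IsStronglyCartesian e c') (c : a' ⟶ a)
    (hc : p.IsStronglyCartesian f c) (d : a'' ⟶ a') (hd : p.IsHomLift g d) (hdc : d ≫ c = c') :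
    d ≫ app f hf c hc = app e he c' hc'

/-- A stack over the site `(𝒮, J)`: a fibered category such that, for every covering `R` of every
`U`, the functor from the fiber over `U` to the category of descent data relative to `R` is fully
faithful (`existsUnique_glue`) and essentially surjective (`isEffective`). -/
structure IsStack (J : GrothendieckTopology 𝒮) (𝒳 : BasedCategory.{v₂, u₂} 𝒮) : Prop where
  isFibered : 𝒳.p.IsFibered
  existsUnique_glue {U : 𝒮} (R : Sieve U) (hR : R ∈ J U) (a b : 𝒳.obj) (ha : 𝒳.p.obj a = U)
    (hb : 𝒳.p.obj b = U) (ψ : LocalHom 𝒳.p R a b) :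
    ∃! χ : a ⟶ b, 𝒳.p.IsHomLift (𝟙 U) χ ∧
      ∀ {V : 𝒮} (f : V ⟶ U) (hf : R f) {a' : 𝒳.obj} (c : a' ⟶ a)
        (hc : 𝒳.p.IsStronglyCartesian f c), c ≫ χ = ψ.app f hf c hc
  isEffective {U : 𝒮} (R : Sieve U) (hR : R ∈ J U) (D : DescentDatum 𝒳.p R) : D.IsEffective

/-- A gerbe over the site `(𝒮, J)`: a stack in groupoids that is locally non-empty and locally
connected. In `locally_connected`, the arrows `z ⟶ x` and `z ⟶ y` exhibit `z` as a common pullback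
of `x` and `y` along `f`. -/
structure IsGerbe (J : GrothendieckTopology 𝒮) (𝒳 : BasedCategory.{v₂, u₂} 𝒮) : Prop where
  isStack : IsStack J 𝒳
  locally_nonempty (U : 𝒮) : ∃ R ∈ J U, ∀ {V : 𝒮} (f : V ⟶ U), R f → Nonempty (𝒳.p.Fiber V)
  locally_connected {U : 𝒮} (x y : 𝒳.obj) (hx : 𝒳.p.obj x = U) (hy : 𝒳.p.obj y = U) :
    ∃ R ∈ J U, ∀ {V : 𝒮} (f : V ⟶ U), R f →
      ∃ (z : 𝒳.obj) (a : z ⟶ x) (b : z ⟶ y),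
        𝒳.p.IsStronglyCartesian f a ∧ 𝒳.p.IsStronglyCartesian f b
  isGroupoid_fiber (U : 𝒮) : IsGroupoid (𝒳.p.Fiber U)

/-- A cartesian functor: a functor over `𝒮` that preserves cartesian arrows. -/
def IsCartesianFunctor {𝒳 : BasedCategory.{v₂, u₂} 𝒮} {𝒴 : BasedCategory.{v₃, u₃} 𝒮}
    (F : BasedFunctor 𝒳 𝒴) : Prop :=
  ∀ {V U : 𝒮} (f : V ⟶ U) {a b : 𝒳.obj} (c : a ⟶ b),
    𝒳.p.IsStronglyCartesian f c → 𝒴.p.IsStronglyCartesian f (F.map c)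

/-- Essential surjectivity, fiber by fiber: every object over `U` is isomorphic, by an isomorphism
over `𝟙 U`, to the image of an object over `U`. -/
def IsFiberwiseEssSurj {𝒳 : BasedCategory.{v₂, u₂} 𝒮} {𝒴 : BasedCategory.{v₃, u₃} 𝒮}
    (F : BasedFunctor 𝒳 𝒴) : Prop :=
  ∀ (U : 𝒮) (y : 𝒴.obj), 𝒴.p.obj y = U →
    ∃ (x : 𝒳.obj) (i : F.obj x ≅ y), 𝒳.p.obj x = U ∧ 𝒴.p.IsHomLift (𝟙 U) i.hom

end FibStack

/-! ### The finite étale site of a field -/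

/-- The finite étale schemes over `Spec k`: the spectra of the finite étale `k`-algebras. -/
structure FEt (k : Type u) [Field k] : Type (u + 1) where
  toOver : Over (Spec (.of k))
  isFinite : IsFinite toOver.hom
  etale : Etale toOver.hom

/-- Morphisms of finite étale `k`-schemes are the morphisms of `k`-schemes. -/
instance (k : Type u) [Field k] : Category.{u} (FEt k) where
  Hom U V := U.toOver ⟶ V.toOver
  id U := 𝟙 U.toOver
  comp f g := CategoryStruct.comp (obj := Over (Spec (.of k))) f g

/-- A morphism of `FEt k` as a morphism of `k`-schemes. -/
def FEt.homToOver {k : Type u} [Field k] {U V : FEt k} (f : U ⟶ V) : U.toOver ⟶ V.toOver := f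

@[simp] lemma FEt.homToOver_id {k : Type u} [Field k] (U : FEt k) :
    FEt.homToOver (𝟙 U) = 𝟙 U.toOver := rfl

@[simp] lemma FEt.homToOver_comp {k : Type u} [Field k] {U V W : FEt k} (f : U ⟶ V) (g : V ⟶ W) :
    FEt.homToOver (f ≫ g) = FEt.homToOver f ≫ FEt.homToOver g := rfl

/-- The topology on `FEt k` whose coverings are the jointly surjective families. -/
def FEt.topology (k : Type u) [Field k] : GrothendieckTopology (FEt k) where
  sieves U := {R | ∀ x : U.toOver.left, ∃ (V : FEt k) (f : V ⟶ U) (y : V.toOver.left),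
    R f ∧ (FEt.homToOver f).left y = x}
  top_mem' U x := ⟨U, 𝟙 U, x, trivial, rfl⟩
  pullback_stable' := by
    intro U W R g hR x
    obtain ⟨V, f, y, hf, hy⟩ := hR ((FEt.homToOver g).left x)
    obtain ⟨z, -, hz⟩ := Scheme.Pullback.exists_preimage_pullback
      (f := (FEt.homToOver f).left) (g := (FEt.homToOver g).left) y x hy
    have w : (FEt.homToOver f).left ≫ U.toOver.hom = V.toOver.hom := Over.w (FEt.homToOver f)
    have := U.isFinite
    have := U.etale
    have := W.isFinite
    have := W.etale
    have : IsFinite ((FEt.homToOver f).left ≫ U.toOver.hom) := w ▸ V.isFinite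
    have : Etale ((FEt.homToOver f).left ≫ U.toOver.hom) := w ▸ V.etale
    have : IsFinite (FEt.homToOver f).left := IsFinite.of_comp _ U.toOver.hom
    have : Etale (FEt.homToOver f).left := Etale.of_comp _ U.toOver.hom
    let P : FEt k :=
      ⟨Over.mk (pullback.snd (FEt.homToOver f).left (FEt.homToOver g).left ≫ W.toOver.hom),
        inferInstanceAs (IsFinite (_ ≫ _)), inferInstanceAs (Etale (_ ≫ _))⟩
    let q : P ⟶ W := Over.homMk (U := P.toOver) (V := W.toOver) (pullback.snd _ _) rfl
    let r : P ⟶ V := Over.homMk (U := P.toOver) (V := V.toOver) (pullback.fst _ _) (by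
      simp only [P, Over.mk_hom, ← w, ← Over.w (FEt.homToOver g)]
      exact pullback.condition_assoc _)
    have hqr : q ≫ g = r ≫ f := by
      apply Over.OverMorphism.ext
      exact pullback.condition.symm
    refine ⟨P, q, z, ?_, hz⟩
    change R (q ≫ g)
    rw [hqr]
    exact R.downward_closed hf r
  transitive' := by
    intro U R hR R' h x
    obtain ⟨V, f, y, hf, rfl⟩ := hR x
    obtain ⟨W, g, z, hg, rfl⟩ := h hf y
    exact ⟨W, g ≫ f, z, hg, rfl⟩

/-! ### Varieties, covers of curves, and families of them -/

/-- Smooth projective curves `T ⟶ S` with geometrically integral fibers. Over a field, a curve is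
projective if and only if it is proper. If `S` is the spectrum of an algebraically closed field,
geometrically integral means integral. -/
structure IsSmoothProjectiveCurve {T S : Scheme.{u}} (π : T ⟶ S) : Prop where
  smooth : Smooth π
  proper : IsProper π
  geometricallyIntegral : GeometricallyIntegral π
  dimension_one (s : S) : topologicalKrullDim (π ⁻¹' {s} : Set T) = 1

/-- A variety over a field is a separated scheme of finite type. -/
structure IsVariety {T S : Scheme.{u}} (π : T ⟶ S) : Prop where
  separated : IsSeparated π
  locallyOfFiniteType : LocallyOfFiniteType π
  quasiCompact : QuasiCompact π

/-- The two kinds of objects: varieties, and covers of a smooth projective geometrically integral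
curve `C` over `k`. -/
inductive Kind (k : Type u) [Field k] : Type (u + 1)
  | variety : Kind k
  | cover (C : Over (Spec (.of k))) (hC : IsSmoothProjectiveCurve C.hom) : Kind k

/-- The `k`-scheme to which everything maps: `Spec k` for varieties, the curve `C` for covers
of `C`. -/
def Kind.base {k : Type u} [Field k] : Kind k → Over (Spec (.of k))
  | .variety => Over.mk (𝟙 _)
  | .cover C _ => C

/-- A scheme `T ⟶ S` together with an `S`-morphism `T ⟶ B ×_k S`, where `B` is the base of the
kind; the latter is given by its component `φ : T ⟶ B`. For varieties `B = Spec k`, and `φ` is no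
additional datum. -/
structure Family {k : Type u} [Field k] (κ : Kind k) (S : Over (Spec (.of k))) where
  T : Scheme.{u}
  π : T ⟶ S.left
  φ : T ⟶ κ.base.left
  w : φ ≫ κ.base.hom = π ≫ S.hom

/-- The `S`-morphism `T ⟶ B ×_k S`. -/
def Family.toProd {k : Type u} [Field k] {κ : Kind k} {S : Over (Spec (.of k))}
    (T : Family κ S) : T.T ⟶ pullback κ.base.hom S.hom :=
  pullback.lift T.φ T.π T.w

/-- `T ⟶ S` is a variety, respectively `T ⟶ C ×_k S` is a cover of curves: `T ⟶ S` is a smooth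
projective geometrically integral curve, and `T ⟶ C ×_k S` is not constant. This is used when `S` is
the spectrum of a field or a finite disjoint union of such spectra, where it is meant for each
component (the conditions are local on `S`). -/
def Family.IsAdmissible {k : Type u} [Field k] {κ : Kind k} {S : Over (Spec (.of k))}
    (T : Family κ S) : Prop :=
  match κ with
  | .variety => IsVariety T.π
  | .cover _ _ => IsSmoothProjectiveCurve T.π ∧
      ∀ s : S.left, ¬ (T.toProd '' (T.π ⁻¹' {s} : Set T.T)).Subsingleton

/-- Cartesian squares
```
  T ----> T'
  |       |
  S --f-> S'
```
compatible with the morphisms to the base of the kind. -/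
@[ext]
structure Family.CartHom {k : Type u} [Field k] {κ : Kind k} {S S' : Over (Spec (.of k))}
    (T : Family κ S) (T' : Family κ S') (f : S ⟶ S') where
  top : T.T ⟶ T'.T
  isPullback : IsPullback top T.π T'.π f.left
  top_φ : top ≫ T'.φ = T.φ

/-- The spectrum of a `k`-algebra, as a `k`-scheme. -/
def specOver (k : Type u) [Field k] (A : Type u) [CommRing A] [Algebra k A] :
    Over (Spec (.of k)) :=
  Over.mk (Spec.map (CommRingCat.ofHom (algebraMap k A)))

/-- `Spec (e) : Spec B ⟶ Spec A`, for a morphism `e : A → B` of `k`-algebras. -/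
def specOverMap {k : Type u} [Field k] {A B : Type u} [CommRing A] [Algebra k A] [CommRing B]
    [Algebra k B] (e : A →ₐ[k] B) : specOver k B ⟶ specOver k A :=
  Over.homMk (Spec.map (CommRingCat.ofHom e.toRingHom)) (by
    simp only [specOver, Over.mk_hom, ← Spec.map_comp, ← CommRingCat.ofHom_comp]
    congr 2
    exact e.comp_algebraMap)

/-- A variety over `K`, or a cover of curves `Y ⟶ C ×_k K`. -/
structure DescentObject (k K : Type u) [Field k] [Field K] [Algebra k K] where
  kind : Kind k
  toFamily : Family kind (specOver k K)
  isAdmissible : toFamily.IsAdmissible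

namespace DescentObject

variable {k K : Type u} [Field k] [Field K] [Algebra k K]

/-- `k` is the field of moduli of `X`: every `Spec σ`, for `σ` a `k`-automorphism of `K`, lifts to
an automorphism of the `k`-scheme `X` (compatible with `X ⟶ C`, for covers of `C`); that is, `X` is
isomorphic to all its conjugates. -/
def HasFieldOfModuli (X : DescentObject k K) : Prop :=
  ∀ σ : K ≃ₐ[k] K,
    Nonempty (X.toFamily.CartHom X.toFamily (specOverMap (σ : K →ₐ[k] K)))

/-- `X` has a model over `l`, for the embedding `e` of `l` in `K`. -/
def HasModelAlong (X : DescentObject k K) {l : Type u} [Field l] [Algebra k l]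
    (e : l →ₐ[k] K) : Prop :=
  ∃ T : Family X.kind (specOver k l),
    T.IsAdmissible ∧ Nonempty (X.toFamily.CartHom T (specOverMap e))

/-- The subfield `l` of `K` is a field of definition of `X`: there is a model of `X` over `l`, for
the inclusion of `l` in `K`. -/
def IsFieldOfDefinition (X : DescentObject k K) (l : IntermediateField k K) : Prop :=
  X.HasModelAlong l.val

/-- There is a "model" of `X` over `l`: a model for some `k`-embedding of `l` in `K`. -/
def HasModelOver (X : DescentObject k K) (l : IntermediateField k K) : Prop :=
  ∃ e : l →ₐ[k] K, X.HasModelAlong e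

/-- There is a descent obstruction: `k` is the field of moduli, but not a field of definition. -/
def HasDescentObstruction (X : DescentObject k K) : Prop :=
  X.HasFieldOfModuli ∧ ¬ X.IsFieldOfDefinition ⊥

/-- The "models" of `X` over finite étale `k`-schemes `U`: families over `U` which over every
connected component of `U`, that is, at every point `u` of `U`, become isomorphic to `X` after
pullback along some `k`-morphism `Spec K ⟶ U` with image `u`. -/
structure Model (X : DescentObject k K) where
  U : FEt k
  family : Family X.kind U.toOver
  isAdmissible : family.IsAdmissible
  exists_geometricPoint (u : U.toOver.left) :
    ∃ g : specOver k K ⟶ U.toOver, u ∈ Set.range g.left ∧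
      Nonempty (X.toFamily.CartHom family g)

/-- Morphisms of "models": cartesian squares over `Spec k`. -/
@[ext]
structure Model.Hom {X : DescentObject k K} (M N : X.Model) where
  base : M.U ⟶ N.U
  top : M.family.T ⟶ N.family.T
  isPullback : IsPullback top M.family.π N.family.π (FEt.homToOver base).left
  top_φ : top ≫ N.family.φ = M.family.φ

instance (X : DescentObject k K) : Category.{u} X.Model where
  Hom M N := Model.Hom M N
  id M := ⟨𝟙 _, 𝟙 _, IsPullback.id_horiz _, by simp⟩
  comp f g := ⟨f.base ≫ g.base, f.top ≫ g.top, f.isPullback.paste_horiz g.isPullback,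
    by simp [f.top_φ, g.top_φ]⟩
  id_comp f := by apply Model.Hom.ext <;> simp
  comp_id f := by apply Model.Hom.ext <;> simp
  assoc f g h := by apply Model.Hom.ext <;> simp

/-- The functor that sends a "model" over `U` to `U`. -/
def proj (X : DescentObject k K) : X.Model ⥤ FEt k where
  obj M := M.U
  map f := Model.Hom.base f

/-- The category of "models" of `X`, over the category of finite étale `k`-schemes. -/
abbrev models (X : DescentObject k K) : BasedCategory.{u, u + 1} (FEt k) where
  obj := X.Model
  p := X.proj

end DescentObject

end

/-! Two facts carry the proposition. A variety or a cover over the algebraic closure `K` is defined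
over a finite extension of `k`, and two models of it become isomorphic over a finite extension
(`hasFiniteModel`, `exists_common_model`). Two embeddings of a field into `K` differ by an
automorphism of `K` (`exists_algEquiv_comp_eq`).

The categories of models only see finite extensions of `k`. A model over an arbitrary algebraic `l`
is therefore brought down to a finite `E ⊆ l`, moved by `F`, and base changed back to `l`. The
functor does not control the embedding into `K` along which `F M` is a model of `Y`, which is why
quotation marks around "model" are needed; they disappear once `k` is the field of moduli, because
automorphisms of `K` then lift.

For the field of moduli, let `M` be a model of `X` over a finite `E`, and let `F M` be a model of
`Y` along `g = ρ|_E`. To lift `σ` to `Y`, lift its conjugate `ρ⁻¹σρ` to `X`. This makes `M` a model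
of `X` in two ways, and a single model `N` over a finite extension maps to `M` in both. The two
squares `F N ⟶ F M` then compare `Y` with its conjugate by `σ`.

For the converse with `F` fully faithful, a model `y` of `Y` over a finite `E` becomes isomorphic to
some `F T` over a finite normal `L`. The descent datum of `y` on `F T` is carried back to `T`. It is
effective if the models of `X` form a stack. If `X` is a cover, the datum is a semilinear action of
the Galois group of `L / E` on `T`, compatible with the map to `C ×_k Spec E`. Since `T` is finite
over `C ×_k Spec L` (`Family.IsAdmissible.isFinite_toProd`), it is affine over `C ×_k Spec E`, and
the quotient is glued from the spectra of invariants; it is a model by Galois descent for algebras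
(`isPushout_invariantSubring`).

The lemma on gerbes has the same shape. Every object of the target is locally in the essential
image, full faithfulness turns the local lifts into a descent datum, and the comparison arrow that
results from gluing is invertible because the fibers are groupoids. -/

noncomputable section

/-! ### Descent along fully faithful cartesian functors -/

namespace FibStack

variable {𝒮 : Type u₁} [Category.{v₁} 𝒮] {𝒳 : BasedCategory.{v₂, u₂} 𝒮}
  {𝒴 : BasedCategory.{v₃, u₃} 𝒮}

/-- A fully faithful functor over `𝒮` reflects cartesian arrows. -/
lemma isStronglyCartesian_of_map (F : BasedFunctor 𝒳 𝒴) (hF : F.toFunctor.Full)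
    (hF' : F.toFunctor.Faithful) {V U : 𝒮} (f : V ⟶ U) {a b : 𝒳.obj} (c : a ⟶ b)
    (hc : 𝒴.p.IsStronglyCartesian f (F.map c)) : 𝒳.p.IsStronglyCartesian f c := by
  have : 𝒳.p.IsHomLift f c := F.isHomLift_map f c
  refine ⟨fun {a'} g φ' hφ' ↦ ?_⟩
  have h₁ : 𝒴.p.IsHomLift (g ≫ f) (F.map φ') := inferInstance
  obtain ⟨χ, ⟨hχ, e⟩, hu⟩ := IsStronglyCartesian.universal_property 𝒴.p f (F.map c) g (g ≫ f) rfl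
    (F.map φ')
  refine ⟨F.toFunctor.preimage χ, ⟨?_, ?_⟩, ?_⟩
  · have : 𝒴.p.IsHomLift g (F.map (F.toFunctor.preimage χ)) := by
      rwa [F.toFunctor.map_preimage]
    exact F.isHomLift_map g _
  · apply F.toFunctor.map_injective
    rw [F.toFunctor.map_comp, F.toFunctor.map_preimage, e]
  · rintro χ' ⟨hχ', e'⟩
    apply F.toFunctor.map_injective
    rw [F.toFunctor.map_preimage]
    refine hu _ ⟨inferInstance, ?_⟩
    rw [← F.toFunctor.map_comp, e']

/-- A system of objects `x_f` with cartesian arrows `F (x_f) ⟶ y` over the arrows `f` of a sieve,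
for `F` fully faithful, is a descent datum. -/
def descentDatumOfLifts (F : BasedFunctor 𝒳 𝒴) [F.toFunctor.Full] [F.toFunctor.Faithful] {U : 𝒮}
    (R : Sieve U) (y : 𝒴.obj) (x : ∀ {V : 𝒮} (f : V ⟶ U), R f → 𝒳.obj)
    (j : ∀ {V : 𝒮} (f : V ⟶ U) (hf : R f), F.obj (x f hf) ⟶ y)
    (hj : ∀ {V : 𝒮} (f : V ⟶ U) (hf : R f), 𝒴.p.IsStronglyCartesian f (j f hf)) :
    DescentDatum 𝒳.p R where
  obj f hf := x f hf
  map e he f hf g w :=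
    have := hj e he
    have := hj f hf
    -- The transition arrow lifts the unique arrow over `g` that is compatible with the arrows to
    -- `y`. Uniqueness gives the identity and cocycle conditions.
    F.toFunctor.preimage (IsStronglyCartesian.map 𝒴.p f (j f hf) w.symm (j e he))
  isStronglyCartesian_map e he f hf g w := by
    have h₁ := hj e he
    have := hj f hf
    apply isStronglyCartesian_of_map F inferInstance inferInstance
    rw [F.toFunctor.map_preimage]
    -- The composite with `j f hf` is `j e he`; if a composite and its second factor are cartesian,
    -- so is the first factor.
    have h₂ : 𝒴.p.IsStronglyCartesian (g ≫ f)
        (IsStronglyCartesian.map 𝒴.p f (j f hf) w.symm (j e he) ≫ j f hf) := by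
      rwa [IsStronglyCartesian.fac, w]
    exact IsStronglyCartesian.of_comp 𝒴.p (g := f) (ψ := j f hf)
  map_id f hf := by
    have := hj f hf
    apply F.toFunctor.map_injective
    rw [F.toFunctor.map_preimage, F.toFunctor.map_id]
    exact IsStronglyCartesian.map_self 𝒴.p f (j f hf)
  map_comp d hd e he f hf h g w w' := by
    have := hj d hd
    have := hj e he
    have := hj f hf
    apply F.toFunctor.map_injective
    rw [F.toFunctor.map_comp, F.toFunctor.map_preimage, F.toFunctor.map_preimage,
      F.toFunctor.map_preimage]
    exact IsStronglyCartesian.map_comp_map ..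

/-- If `y` is locally in the essential image of the fully faithful functor `F`, then the
restrictions of `y` come from a descent datum. -/
lemma exists_descentDatum (F : BasedFunctor 𝒳 𝒴) [F.toFunctor.Full]
    [F.toFunctor.Faithful] {U : 𝒮} (R : Sieve U) (y : 𝒴.obj)
    (h : ∀ {V : 𝒮} (f : V ⟶ U), R f →
      ∃ (x : 𝒳.obj) (j : F.obj x ⟶ y), 𝒴.p.IsStronglyCartesian f j) :
    ∃ (D : DescentDatum 𝒳.p R) (j : ∀ {V : 𝒮} (f : V ⟶ U) (hf : R f), F.obj (D.obj f hf) ⟶ y),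
      (∀ {V : 𝒮} (f : V ⟶ U) (hf : R f), 𝒴.p.IsStronglyCartesian f (j f hf)) ∧
      ∀ {W V : 𝒮} (e : W ⟶ U) (he : R e) (f : V ⟶ U) (hf : R f) (g : W ⟶ V) (w : g ≫ f = e),
        F.map (D.map e he f hf g w) ≫ j f hf = j e he := by
  choose x j hj using @h
  refine ⟨descentDatumOfLifts F R y x j hj, j, hj, ?_⟩
  intro W V e he f hf g w
  have := hj e he
  have := hj f hf
  refine (congrArg (· ≫ j f hf) (F.toFunctor.map_preimage
    (IsStronglyCartesian.map 𝒴.p f (j f hf) w.symm (j e he)))).trans ?_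
  exact IsStronglyCartesian.fac ..

/-- The sieve of the arrows `f : V ⟶ U` such that the restriction of `y` to `V` is in the
essential image of `F`. -/
def liftSieve (F : BasedFunctor 𝒳 𝒴) (hF : IsCartesianFunctor F) (h𝒳 : 𝒳.p.IsFibered)
    (U : 𝒮) (y : 𝒴.obj) : Sieve U where
  arrows V f := ∃ (x : 𝒳.obj) (j : F.obj x ⟶ y), 𝒴.p.IsStronglyCartesian f j
  downward_closed := by
    rintro V W f ⟨x, j, hj⟩ g
    have hx : 𝒳.p.obj x = V := (F.w_obj x).symm.trans (IsHomLift.domain_eq 𝒴.p f j)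
    obtain ⟨x', c, hc⟩ := IsPreFibered.exists_isCartesian 𝒳.p hx g
    have := hF g c inferInstance
    exact ⟨x', F.map c ≫ j, inferInstance⟩

/-- Refine twice: on a first covering there is an object `x` of `𝒳`, and on a second one `F x`
becomes isomorphic to the restriction of `y`. The restriction of `F x` is again in the image because
`F` is cartesian. -/
lemma liftSieve_mem (J : GrothendieckTopology 𝒮) (F : BasedFunctor 𝒳 𝒴) (h𝒳 : IsGerbe J 𝒳)
    (h𝒴 : IsGerbe J 𝒴) (hF : IsCartesianFunctor F) (U : 𝒮) (y : 𝒴.obj) (hy : 𝒴.p.obj y = U) :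
    liftSieve F hF h𝒳.isStack.isFibered U y ∈ J U := by
  have := h𝒳.isStack.isFibered
  have := h𝒴.isStack.isFibered
  obtain ⟨R, hR, hne⟩ := h𝒳.locally_nonempty U
  refine J.transitive hR _ fun V f hf ↦ ?_
  obtain ⟨x, hx⟩ := hne f hf
  obtain ⟨y', c, hc⟩ := IsPreFibered.exists_isCartesian 𝒴.p hy f
  obtain ⟨R', hR', h⟩ := h𝒴.locally_connected (F.obj x) y' ((F.w_obj x).trans hx)
    (IsHomLift.domain_eq 𝒴.p f c)
  refine J.superset_covering ?_ hR'
  intro W g hg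
  obtain ⟨z, a, b, ha, hb⟩ := h g hg
  obtain ⟨x', d, hd⟩ := IsPreFibered.exists_isCartesian 𝒳.p hx g
  have hFd := hF g d inferInstance
  -- Both `a` and `F.map d` are pullbacks of `F x` along `g`.
  let i := IsCartesian.domainUniqueUpToIso 𝒴.p g a (F.map d)
  have hi : 𝒴.p.IsStronglyCartesian (𝟙 W) i.hom := inferInstance
  refine ⟨x', i.hom ≫ b ≫ c, ?_⟩
  have : 𝒴.p.IsStronglyCartesian (𝟙 W ≫ g ≫ f) (i.hom ≫ b ≫ c) := inferInstance
  rwa [Category.id_comp] at this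

/-- A fully faithful cartesian functor between gerbes is essentially surjective. -/
theorem isFiberwiseEssSurj_of_isGerbe (J : GrothendieckTopology 𝒮) (F : BasedFunctor 𝒳 𝒴)
    (h𝒳 : IsGerbe J 𝒳) (h𝒴 : IsGerbe J 𝒴) (hF : IsCartesianFunctor F)
    (hfull : F.toFunctor.Full) (hfaith : F.toFunctor.Faithful) : IsFiberwiseEssSurj F := by
  intro U y hy
  have := h𝒴.isStack.isFibered
  let R := liftSieve F hF h𝒳.isStack.isFibered U y
  have hR : R ∈ J U := liftSieve_mem J F h𝒳 h𝒴 hF U y hy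
  obtain ⟨D, j, hj, hDj⟩ := exists_descentDatum F R y (fun f hf ↦ hf)
  obtain ⟨x₀, c, hx₀, hc, hDc⟩ := h𝒳.isStack.isEffective R hR D
  have hFc {V : 𝒮} (f : V ⟶ U) (hf : R f) : 𝒴.p.IsStronglyCartesian f (F.map (c f hf)) :=
    hF f _ (hc f hf)
  -- A pullback `a'` of `F x₀` along `f` is identified with `F (D.obj f)`, and then mapped to `y` by
  -- `j f`.
  let ψ : LocalHom 𝒴.p R (F.obj x₀) y :=
    { app := fun f hf a' d hd ↦
        letI := hFc f hf
        IsCartesian.map 𝒴.p f (F.map (c f hf)) d ≫ j f hf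
      isHomLift_app := fun f hf a' d hd ↦ by
        have := hFc f hf
        have := hj f hf
        exact inferInstanceAs (𝒴.p.IsHomLift f (IsCartesian.map 𝒴.p f (F.map (c f hf)) d ≫ j f hf))
      comp_app := by
        intro W V e he f hf g w a'' a' d' hd' d hd t ht htd
        have := hFc f hf
        have := hFc e he
        have := hj f hf
        have h₁ := hDj e he f hf g w
        have h₂ : F.map (D.map e he f hf g w) ≫ F.map (c f hf) = F.map (c e he) := by
          rw [← F.toFunctor.map_comp, hDc]
        have h₃ : 𝒴.p.IsHomLift g (F.map (D.map e he f hf g w)) :=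
          have := D.isStronglyCartesian_map e he f hf g w
          inferInstance
        change t ≫ IsCartesian.map 𝒴.p f (F.map (c f hf)) d ≫ j f hf =
          IsCartesian.map 𝒴.p e (F.map (c e he)) d' ≫ j e he
        rw [← h₁, ← Category.assoc, ← Category.assoc]
        congr 1
        refine IsStronglyCartesian.ext 𝒴.p f (F.map (c f hf)) g ?_
        rw [Category.assoc, Category.assoc, IsCartesian.fac, h₂, IsCartesian.fac, htd] }
  obtain ⟨χ, ⟨hχ, -⟩, -⟩ := h𝒴.isStack.existsUnique_glue R hR (F.obj x₀) y
    ((F.w_obj x₀).trans hx₀) hy ψ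
  have hiso : IsIso χ := by
    have hg := h𝒴.isGroupoid_fiber U
    let a : 𝒴.p.Fiber U := ⟨F.obj x₀, (F.w_obj x₀).trans hx₀⟩
    let b : 𝒴.p.Fiber U := ⟨y, hy⟩
    let χ' : a ⟶ b := ⟨χ, hχ⟩
    have : IsIso χ' := hg.all_isIso χ'
    exact inferInstanceAs (IsIso (Fiber.fiberInclusion.map χ'))
  exact ⟨x₀, asIso χ, hx₀, hχ⟩

end FibStack

/-! ### Cartesian squares of families -/

namespace Family

variable {k : Type u} [Field k] {κ : Kind k} {S S' S'' : Over (Spec (.of k))}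

/-- Composition of cartesian squares. -/
def CartHom.comp {T : Family κ S} {T' : Family κ S'} {T'' : Family κ S''} {f : S ⟶ S'}
    {g : S' ⟶ S''} (a : T.CartHom T' f) (b : T'.CartHom T'' g) : T.CartHom T'' (f ≫ g) where
  top := a.top ≫ b.top
  isPullback := by simpa using a.isPullback.paste_horiz b.isPullback
  top_φ := by rw [Category.assoc, b.top_φ, a.top_φ]

/-- A cartesian square over `f ≫ g` factors through a cartesian square over `g`. -/
def CartHom.lift {T : Family κ S} {T' : Family κ S'} {T'' : Family κ S''} {f : S ⟶ S'}
    {g : S' ⟶ S''} {h : S ⟶ S''} (a : T.CartHom T'' h) (b : T'.CartHom T'' g) (w : f ≫ g = h) :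
    T.CartHom T' f where
  top := b.isPullback.lift a.top (T.π ≫ f.left) (by
    rw [a.isPullback.w, ← w, Category.assoc, Over.comp_left])
  isPullback := by
    refine IsPullback.of_right ?_ (b.isPullback.lift_snd ..) b.isPullback
    rw [b.isPullback.lift_fst]
    simpa [← w] using a.isPullback
  top_φ := by rw [← b.top_φ, b.isPullback.lift_fst_assoc, a.top_φ]

@[simp] lemma CartHom.lift_top_comp_top {T : Family κ S} {T' : Family κ S'} {T'' : Family κ S''}
    {f : S ⟶ S'} {g : S' ⟶ S''} {h : S ⟶ S''} (a : T.CartHom T'' h) (b : T'.CartHom T'' g)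
    (w : f ≫ g = h) : (a.lift b w).top ≫ b.top = a.top :=
  b.isPullback.lift_fst ..

/-- The same square, over an equal morphism. -/
def CartHom.cast {T : Family κ S} {T' : Family κ S'} {f g : S ⟶ S'} (a : T.CartHom T' f)
    (h : f = g) : T.CartHom T' g :=
  h ▸ a

/-- The base change of a family. -/
def baseChange (T : Family κ S') (f : S ⟶ S') : Family κ S where
  T := pullback T.π f.left
  π := pullback.snd _ _
  φ := pullback.fst _ _ ≫ T.φ
  w := by rw [Category.assoc, T.w, pullback.condition_assoc, Over.w f]

/-- The square that exhibits a base change. -/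
def baseChangeHom (T : Family κ S') (f : S ⟶ S') : (T.baseChange f).CartHom T f where
  top := pullback.fst _ _
  isPullback := IsPullback.of_hasPullback _ _
  top_φ := rfl

end Family

/-! ### Integral morphisms and curves -/

namespace AlgebraicGeometry

/-- There are no proper specializations in the fibers of an integral morphism. -/
lemma eq_of_specializes_of_isIntegralHom {X Y : Scheme.{u}} (g : X ⟶ Y) [IsIntegralHom g] {x x' : X}
    (h : x ⤳ x') (e : g x = g x') : x = x' := by
  let y := g x'
  let Z := g.fiber y
  have : IsIntegralHom (g.fiberToSpecResidueField y) :=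
    inferInstanceAs (IsIntegralHom (pullback.snd _ _))
  have : IsAffine Z := isAffine_of_isAffineHom (g.fiberToSpecResidueField y)
  obtain ⟨φ, hφ⟩ := Spec.map_surjective (Z.isoSpec.inv ≫ g.fiberToSpecResidueField y)
  have hφint : IsIntegralHom (Spec.map φ) := by rw [hφ]; infer_instance
  rw [IsIntegralHom.SpecMap_iff] at hφint
  let a : g ⁻¹' {y} := ⟨x, e⟩
  let a' : g ⁻¹' {y} := ⟨x', rfl⟩
  have haa : a ⤳ a' := by
    rwa [Topology.IsInducing.subtypeVal.specializes_iff.symm]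
  let ε : (g ⁻¹' {y}) ≃ₜ Spec Γ(Z, ⊤) := (g.fiberHomeo y).symm.trans Z.isoSpec.hom.homeomorph
  have hle : ε a ⤳ ε a' := haa.map ε.continuous
  suffices ε a = ε a' from congrArg Subtype.val (ε.injective this)
  let p : PrimeSpectrum Γ(Z, ⊤) := ε a
  let p' : PrimeSpectrum Γ(Z, ⊤) := ε a'
  have hle' : p.asIdeal ≤ p'.asIdeal := (PrimeSpectrum.le_iff_specializes p p').mpr hle
  -- The fiber is the spectrum of an integral algebra over a field, so its primes are maximal and an
  -- inclusion between them is an equality.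
  have hmax : p.asIdeal.IsMaximal := by
    refine Ideal.isMaximal_of_isIntegral_of_isMaximal_comap' φ.hom hφint _ ?_
    have h₁ : (p.asIdeal.comap φ.hom).IsPrime := Ideal.comap_isPrime _ _
    rcases Ideal.eq_bot_or_top (p.asIdeal.comap φ.hom) with h | h
    · rw [h]; exact Ideal.bot_isMaximal
    · exact absurd h h₁.ne_top
  exact PrimeSpectrum.ext (hmax.eq_of_le p'.isPrime.ne_top hle')

/-- Irreducible schemes of dimension one: there is a point other than the generic point, and all
such points are closed. -/
lemma topologicalKrullDim_eq_one_iff (X : Scheme.{u}) [IrreducibleSpace X] :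
    topologicalKrullDim X = 1 ↔ (∃ x : X, x ≠ genericPoint X) ∧
      ∀ x y : X, x ⤳ y → x = genericPoint X ∨ x = y := by
  -- Points correspond to irreducible closed subsets. In this order the generic point is the
  -- greatest element, so dimension at most one says that every other point is minimal.
  let : PartialOrder X := specializationOrder X
  have hdim : topologicalKrullDim X = Order.krullDim X :=
    Order.krullDim_eq_of_orderIso irreducibleSetEquivPoints
  have hle (x y : X) : x ≤ y ↔ y ⤳ x := Iff.rfl
  rw [hdim, le_antisymm_iff, Order.krullDim_le_one_iff, Order.one_le_krullDim_iff, and_comm]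
  refine and_congr ⟨?_, ?_⟩ ⟨?_, ?_⟩
  · rintro ⟨x, y, hxy⟩
    refine ⟨x, ?_⟩
    rintro rfl
    exact hxy.not_ge (genericPoint_specializes y)
  · rintro ⟨x, hx⟩
    exact ⟨x, genericPoint X, lt_of_le_of_ne (genericPoint_specializes x) hx⟩
  · intro h x y hxy
    rcases h x with h | h
    · exact .inr (((hle y x).mpr hxy).antisymm (h hxy)).symm
    · exact .inl (le_antisymm (genericPoint_specializes x) (h (genericPoint_specializes x)))
  · intro h x
    rw [or_iff_not_imp_right]
    intro hx y hy
    rcases h x y hy with rfl | rfl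
    · refine absurd ?_ hx
      intro y _
      exact genericPoint_specializes y
    · exact le_rfl

/-- Specializations lift along a closed map, and an integral morphism has none inside its fibers. In
particular the generic point is the only point over the generic point, so the pointwise criterion
for dimension one passes in both directions. -/
lemma topologicalKrullDim_eq_one_iff_of_isIntegralHom {X Y : Scheme.{u}} (g : X ⟶ Y)
    [IsIntegralHom g] [Surjective g] [IrreducibleSpace X] [IrreducibleSpace Y] :
    topologicalKrullDim X = 1 ↔ topologicalKrullDim Y = 1 := by
  have hη : g (genericPoint X) = genericPoint Y := by
    refine ((genericPoint_spec X).image g.continuous).eq ?_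
    rw [Set.image_univ, g.surjective.range_eq, closure_univ]
    exact genericPoint_spec Y
  rw [topologicalKrullDim_eq_one_iff, topologicalKrullDim_eq_one_iff]
  have hgen {x : X} (hx : g x = genericPoint Y) : x = genericPoint X :=
    (eq_of_specializes_of_isIntegralHom g (genericPoint_specializes x) (hη.trans hx.symm)).symm
  refine and_congr ⟨?_, ?_⟩ ⟨?_, ?_⟩
  · rintro ⟨x, hx⟩
    exact ⟨g x, fun h ↦ hx (hgen h)⟩
  · rintro ⟨y, hy⟩
    obtain ⟨x, rfl⟩ := g.surjective y
    exact ⟨x, fun h ↦ hy (h ▸ hη)⟩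
  · intro h y y' hy
    obtain ⟨x, rfl⟩ := g.surjective y
    obtain ⟨x', hx', rfl⟩ := g.isClosedMap.specializingMap hy
    rcases h x x' hx' with rfl | rfl
    · exact .inl hη
    · exact .inr rfl
  · intro h x x' hx
    rcases h _ _ (hx.map g.continuous) with h | h
    · exact .inl (hgen h)
    · exact .inr (eq_of_specializes_of_isIntegralHom g hx h)

/-! ### Descent of properties along faithfully flat morphisms -/

/-- Being reduced descends along faithfully flat morphisms. -/
lemma isReduced_of_flat_of_surjective {X Y : Scheme.{u}} (f : X ⟶ Y) [Flat f] [Surjective f]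
    [IsReduced X] : IsReduced Y := by
  have (y : Y) : _root_.IsReduced (Y.presheaf.stalk y) := by
    obtain ⟨x, rfl⟩ := f.surjective y
    -- A flat local homomorphism of local rings is faithfully flat, hence injective.
    refine isReduced_of_injective (f.stalkMap x).hom ?_
    algebraize [(f.stalkMap x).hom]
    have : Module.Flat (Y.presheaf.stalk (f x)) (X.presheaf.stalk x) := Flat.stalkMap f x
    have : IsLocalHom (algebraMap (Y.presheaf.stalk (f x)) (X.presheaf.stalk x)) :=
      f.toLRSHom.prop x
    have : Module.FaithfullyFlat (Y.presheaf.stalk (f x)) (X.presheaf.stalk x) :=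
      Module.FaithfullyFlat.of_flat_of_isLocalHom
    exact FaithfulSMul.algebraMap_injective _ _
  exact isReduced_of_isReduced_stalk Y

lemma irreducibleSpace_of_surjective {X Y : Type*} [TopologicalSpace X] [TopologicalSpace Y]
    [IrreducibleSpace X] {f : X → Y} (hf : Continuous f) (hs : Function.Surjective f) :
    IrreducibleSpace Y := by
  rw [irreducibleSpace_def]
  change IsIrreducible (Set.univ : Set Y)
  rw [← hs.range_eq, ← Set.image_univ]
  exact (IrreducibleSpace.isIrreducible_univ X).image f hf.continuousOn

/-- Being integral descends along faithfully flat morphisms. -/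
lemma isIntegral_of_flat_of_surjective {X Y : Scheme.{u}} (f : X ⟶ Y) [Flat f] [Surjective f]
    [IsIntegral X] : IsIntegral Y := by
  rw [isIntegral_iff_irreducibleSpace_and_isReduced]
  exact ⟨irreducibleSpace_of_surjective f.continuous f.surjective,
    isReduced_of_flat_of_surjective f⟩

/-- Faithfully flat quasi-compact morphisms. -/
abbrev fpqc : MorphismProperty Scheme.{u} := @Surjective ⊓ @Flat ⊓ @QuasiCompact

instance : fpqc.{u}.IsStableUnderBaseChange where
  of_isPullback h hf :=
    ⟨⟨MorphismProperty.of_isPullback (P := @Surjective) h hf.1.1,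
      MorphismProperty.of_isPullback (P := @Flat) h hf.1.2⟩,
      MorphismProperty.of_isPullback (P := @QuasiCompact) h hf.2⟩

lemma fpqc.mk {X Y : Scheme.{u}} (f : X ⟶ Y) [hs : Surjective f] [hf : Flat f]
    [hq : QuasiCompact f] : fpqc f :=
  ⟨⟨hs, hf⟩, hq⟩

/-- Morphisms of spectra of fields are faithfully flat. -/
lemma flat_and_surjective_of_field {E F : Type u} [Field E] [Field F]
    (r : Spec (.of F) ⟶ Spec (.of E)) : Flat r ∧ Surjective r := by
  obtain ⟨φ, rfl⟩ := Spec.map_surjective r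
  rw [flat_and_surjective_SpecMap_iff]
  algebraize [φ.hom]
  exact inferInstanceAs (Module.FaithfullyFlat E F)

section descent

variable {T' T V U : Scheme.{u}} {g : T' ⟶ T} {π' : T' ⟶ V} {π : T ⟶ U} {v : V ⟶ U}

/-- A diagonal is always an immersion, so it is a closed immersion as soon as it is universally
closed, and universal closedness of the diagonal descends. -/
lemma IsSeparated.of_isPullback_of_fpqc (h : IsPullback g π' π v) (hv : fpqc v)
    [IsSeparated π'] : IsSeparated π := by
  have h₁ : (MorphismProperty.diagonal @UniversallyClosed) π' :=
    inferInstanceAs (UniversallyClosed (pullback.diagonal π'))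
  have : MorphismProperty.RespectsIso @UniversallyClosed :=
    MorphismProperty.IsStableUnderBaseChange.respectsIso
  have : MorphismProperty.DescendsAlong (.diagonal @UniversallyClosed) fpqc.{u} :=
    MorphismProperty.instDescendsAlongDiagonalOfRespectsIsoOfIsStableUnderBaseChange _ _
  have h₂ : (MorphismProperty.diagonal @UniversallyClosed) π :=
    MorphismProperty.of_isPullback_of_descendsAlong (Q := fpqc) h.flip hv h₁
  have h₃ : UniversallyClosed (pullback.diagonal π) := h₂
  exact ⟨.of_isPreimmersion _ (pullback.diagonal π).isClosedMap.isClosed_range⟩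

/-- Over an affine base quasi-compactness is compactness of the total space, and `T` is the image of
`T'`. -/
lemma QuasiCompact.of_isPullback_of_surjective [IsAffine U] [IsAffine V] (h : IsPullback g π' π v)
    [Surjective v] [QuasiCompact π'] : QuasiCompact π := by
  have : Surjective g := MorphismProperty.of_isPullback h.flip ‹_›
  have : CompactSpace T' := (quasiCompact_iff_compactSpace π').mp ‹_›
  refine (quasiCompact_iff_compactSpace π).mpr ?_
  exact ⟨by rw [← g.surjective.range_eq]; exact isCompact_range g.continuous⟩

/-- A point `Spec E ⟶ U` lifts to `V` after an extension of `E`, namely the residue field of a point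
of the non-empty scheme `V ×_U Spec E`. Over that extension the fiber of `π` is a fiber of `π'`,
hence integral, and integrality descends along the faithfully flat projection. -/
lemma GeometricallyIntegral.of_isPullback_of_surjective (h : IsPullback g π' π v) [Surjective v]
    [GeometricallyIntegral π'] : GeometricallyIntegral π := by
  refine ⟨fun E _ y Z fst snd hZ ↦ ?_⟩
  obtain ⟨p⟩ : Nonempty (pullback v y : Scheme.{u}) := by
    have := (pullback.snd v y).surjective
    exact ⟨(this (Classical.arbitrary _)).choose⟩
  let P : Scheme.{u} := pullback v y
  let q : Spec (P.residueField p) ⟶ P := P.fromSpecResidueField p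
  let r : Spec (P.residueField p) ⟶ Spec (.of E) := q ≫ pullback.snd v y
  obtain ⟨_, _⟩ := flat_and_surjective_of_field r
  have : IsIntegral (pullback snd r) := by
    let m : pullback snd r ⟶ T' :=
      h.lift (pullback.fst _ _ ≫ fst) (pullback.snd _ _ ≫ q ≫ pullback.fst v y) (by
        simp only [Category.assoc]
        rw [hZ.w, pullback.condition (f := v), pullback.condition_assoc]
        simp [r])
    refine GeometricallyIntegral.geometrically_isIntegral (f := π') (K := P.residueField p)
      (q ≫ pullback.fst v y) m (pullback.snd _ _) ?_
    have h₁ : IsPullback (m ≫ g) (pullback.snd snd r) π ((q ≫ pullback.fst v y) ≫ v) := by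
      rw [h.lift_fst, Category.assoc, pullback.condition (f := v), ← Category.assoc]
      exact (IsPullback.of_hasPullback snd r).paste_horiz hZ
    exact IsPullback.of_right h₁ (h.lift_snd ..) h
  exact isIntegral_of_flat_of_surjective (pullback.fst snd r)

end descent

end AlgebraicGeometry

/-! ### Admissible families and algebraic extensions of the base field -/

namespace AlgebraicGeometry

section

variable {l L : Type u} [Field l] [Field L] {T' T : Scheme.{u}} {g : T' ⟶ T}
  {π' : T' ⟶ Spec (.of L)} {π : T ⟶ Spec (.of l)} {v : Spec (.of L) ⟶ Spec (.of l)}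

lemma topologicalKrullDim_preimage_singleton (s : Spec (.of l)) :
    topologicalKrullDim (π ⁻¹' {s} : Set T) = topologicalKrullDim T := by
  have h : (π ⁻¹' {s} : Set T) = Set.univ := by
    ext x
    simp only [Set.mem_preimage, Set.mem_singleton_iff, Set.mem_univ, iff_true]
    exact Subsingleton.elim (α := PrimeSpectrum l) _ _
  rw [h]
  exact (Homeomorph.Set.univ T).isHomeomorph.topologicalKrullDim_eq

lemma forall_not_subsingleton_image_iff {P : Scheme.{u}} (F : T ⟶ P) :
    (∀ s : Spec (.of l), ¬ (F '' (π ⁻¹' {s} : Set T)).Subsingleton) ↔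
      ¬ (Set.range F).Subsingleton := by
  have h (s : Spec (.of l)) : (π ⁻¹' {s} : Set T) = Set.univ := by
    ext x
    simp only [Set.mem_preimage, Set.mem_singleton_iff, Set.mem_univ, iff_true]
    exact Subsingleton.elim (α := PrimeSpectrum l) _ _
  simp only [h, Set.image_univ]
  exact ⟨fun H ↦ H (Classical.arbitrary (PrimeSpectrum l)), fun H _ ↦ H⟩

lemma IsSmoothProjectiveCurve.iff_topologicalKrullDim :
    IsSmoothProjectiveCurve π ↔ Smooth π ∧ IsProper π ∧ GeometricallyIntegral π ∧
      topologicalKrullDim T = 1 := by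
  refine ⟨fun ⟨h₁, h₂, h₃, h₄⟩ ↦ ⟨h₁, h₂, h₃, ?_⟩, fun ⟨h₁, h₂, h₃, h₄⟩ ↦ ⟨h₁, h₂, h₃, fun s ↦ ?_⟩⟩
  · rw [← topologicalKrullDim_preimage_singleton (Classical.arbitrary (PrimeSpectrum l))]
    exact h₄ _
  · rwa [topologicalKrullDim_preimage_singleton]

lemma irreducibleSpace_of_geometricallyIntegral (π : T ⟶ Spec (.of l))
    (_ : GeometricallyIntegral π) : IrreducibleSpace T :=
  have : Subsingleton (Spec (.of l)) := inferInstanceAs (Subsingleton (PrimeSpectrum l))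
  have : Nonempty (Spec (.of l)) := inferInstanceAs (Nonempty (PrimeSpectrum l))
  GeometricallyIrreducible.irreducibleSpace_of_subsingleton π

/-- Smooth projective curves and algebraic extensions of the base field. -/
lemma isSmoothProjectiveCurve_iff_of_isPullback (h : IsPullback g π' π v) [IsIntegralHom v] :
    IsSmoothProjectiveCurve π' ↔ IsSmoothProjectiveCurve π := by
  obtain ⟨_, _⟩ := flat_and_surjective_of_field v
  have hv : fpqc v := fpqc.mk v
  have hg : fpqc g := MorphismProperty.of_isPullback h.flip hv
  have : Surjective g := hg.1.1
  have : IsIntegralHom g := MorphismProperty.of_isPullback h.flip ‹IsIntegralHom v›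
  rw [IsSmoothProjectiveCurve.iff_topologicalKrullDim,
    IsSmoothProjectiveCurve.iff_topologicalKrullDim]
  constructor
  · rintro ⟨h₁, h₂, h₃, h₄⟩
    have h₃' : GeometricallyIntegral π := .of_isPullback_of_surjective h
    have := irreducibleSpace_of_geometricallyIntegral π' ‹_›
    have := irreducibleSpace_of_geometricallyIntegral π ‹_›
    -- Properness is assembled from separatedness, universal closedness and local finiteness of
    -- type, each of which descends.
    have : IsSeparated π := .of_isPullback_of_fpqc h hv
    have : UniversallyClosed π :=
      MorphismProperty.of_isPullback_of_descendsAlong (Q := fpqc) h.flip hv inferInstance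
    have : LocallyOfFiniteType π :=
      MorphismProperty.of_isPullback_of_descendsAlong (Q := fpqc) h.flip hv inferInstance
    exact ⟨MorphismProperty.of_isPullback_of_descendsAlong (Q := fpqc) h.flip hv h₁, ⟨⟩, h₃',
      (topologicalKrullDim_eq_one_iff_of_isIntegralHom g).mp h₄⟩
  · rintro ⟨h₁, h₂, h₃, h₄⟩
    have h₃' : GeometricallyIntegral π' := MorphismProperty.of_isPullback h h₃
    have := irreducibleSpace_of_geometricallyIntegral π' ‹_›
    have := irreducibleSpace_of_geometricallyIntegral π ‹_›
    exact ⟨MorphismProperty.of_isPullback h h₁, MorphismProperty.of_isPullback h h₂, h₃',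
      (topologicalKrullDim_eq_one_iff_of_isIntegralHom g).mpr h₄⟩

/-- Varieties and extensions of the base field. -/
lemma isVariety_iff_of_isPullback (h : IsPullback g π' π v) : IsVariety π' ↔ IsVariety π := by
  obtain ⟨_, _⟩ := flat_and_surjective_of_field v
  have hv : fpqc v := fpqc.mk v
  constructor
  · rintro ⟨h₁, h₂, h₃⟩
    exact ⟨.of_isPullback_of_fpqc h hv,
      MorphismProperty.of_isPullback_of_descendsAlong (Q := fpqc) h.flip hv h₂,
      .of_isPullback_of_surjective h⟩
  · rintro ⟨h₁, h₂, h₃⟩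
    exact ⟨MorphismProperty.of_isPullback h h₁, MorphismProperty.of_isPullback h h₂,
      MorphismProperty.of_isPullback h h₃⟩

end

end AlgebraicGeometry

lemma Family.toProd_fst {k : Type u} [Field k] {κ : Kind k} {S : Over (Spec (.of k))}
    (T : Family κ S) : T.toProd ≫ pullback.fst _ _ = T.φ :=
  pullback.lift_fst _ _ _

lemma Family.toProd_snd {k : Type u} [Field k] {κ : Kind k} {S : Over (Spec (.of k))}
    (T : Family κ S) : T.toProd ≫ pullback.snd _ _ = T.π :=
  pullback.lift_snd _ _ _

/-- The comparison `m : B ×_k S' ⟶ B ×_k S` is integral. If `T` has a single image point, then `T'`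
maps into one fiber of `m`, where the image of the generic point specializes to all other image
points. There are no proper specializations in such a fiber. -/
lemma Family.CartHom.subsingleton_range_toProd_iff {k : Type u} [Field k] {κ : Kind k}
    {S S' : Over (Spec (.of k))} {T' : Family κ S'} {T : Family κ S} {f : S' ⟶ S}
    (a : T'.CartHom T f) [hf : IsIntegralHom f.left] [Surjective a.top] [IrreducibleSpace T'.T] :
    (Set.range T'.toProd).Subsingleton ↔ (Set.range T.toProd).Subsingleton := by
  let m : pullback κ.base.hom S'.hom ⟶ pullback κ.base.hom S.hom :=
    pullback.lift (pullback.fst _ _) (pullback.snd _ _ ≫ f.left)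
      (by rw [Category.assoc, Over.w f, pullback.condition])
  have hm : IsPullback m (pullback.snd κ.base.hom S'.hom)
      (pullback.snd κ.base.hom S.hom) f.left := by
    refine IsPullback.of_right (h₁₂ := pullback.fst _ _) ?_ ?_
      (IsPullback.of_hasPullback κ.base.hom S.hom)
    · rw [pullback.lift_fst, Over.w f]
      exact IsPullback.of_hasPullback κ.base.hom S'.hom
    · rw [pullback.lift_snd]
  have : IsIntegralHom m := MorphismProperty.of_isPullback hm.flip hf
  have hw : T'.toProd ≫ m = a.top ≫ T.toProd := by
    apply pullback.hom_ext
    · rw [Category.assoc, Category.assoc, T.toProd_fst, a.top_φ]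
      exact (congrArg (T'.toProd ≫ ·) (pullback.lift_fst _ _ _)).trans T'.toProd_fst
    · rw [Category.assoc, Category.assoc, T.toProd_snd, a.isPullback.w, ← T'.toProd_snd,
        Category.assoc]
      exact congrArg (T'.toProd ≫ ·) (pullback.lift_snd _ _ _)
  have hw' (x : T'.T) : m (T'.toProd x) = T.toProd (a.top x) := by
    rw [← Scheme.Hom.comp_apply, hw, Scheme.Hom.comp_apply]
  constructor
  · rintro H _ ⟨x, rfl⟩ _ ⟨y, rfl⟩
    obtain ⟨x, rfl⟩ := a.top.surjective x
    obtain ⟨y, rfl⟩ := a.top.surjective y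
    rw [← hw', ← hw', H ⟨x, rfl⟩ ⟨y, rfl⟩]
  · intro H
    have hgen (x : T'.T) : T'.toProd (genericPoint T'.T) = T'.toProd x := by
      refine eq_of_specializes_of_isIntegralHom m
        ((genericPoint_specializes x).map T'.toProd.continuous) ?_
      rw [hw', hw']
      exact H ⟨_, rfl⟩ ⟨_, rfl⟩
    rintro _ ⟨x, rfl⟩ _ ⟨y, rfl⟩
    rw [← hgen x, ← hgen y]

/-- Admissibility can be checked after an algebraic extension of the base field. -/
lemma Family.CartHom.isAdmissible_iff {k l L : Type u} [Field k] [Field l] [Field L] [Algebra k l]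
    [Algebra k L] {κ : Kind k} {T' : Family κ (specOver k L)} {T : Family κ (specOver k l)}
    {f : specOver k L ⟶ specOver k l} (a : T'.CartHom T f) [hf : IsIntegralHom f.left] :
    T'.IsAdmissible ↔ T.IsAdmissible := by
  let v : Spec (.of L) ⟶ Spec (.of l) := f.left
  have hv' : IsIntegralHom v := hf
  have h : IsPullback (X := T.T) (Y := Spec (.of L)) (Z := Spec (.of l)) a.top T'.π T.π v :=
    a.isPullback
  obtain ⟨_, _⟩ := flat_and_surjective_of_field v
  have hv : fpqc v := fpqc.mk v
  have hg : fpqc a.top := MorphismProperty.of_isPullback h.flip hv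
  have : Surjective a.top := hg.1.1
  cases κ with
  | variety => exact isVariety_iff_of_isPullback h
  | cover C hC =>
    have hcurve := isSmoothProjectiveCurve_iff_of_isPullback h
    suffices key : IsSmoothProjectiveCurve T'.π →
        ((Set.range T'.toProd).Subsingleton ↔ (Set.range T.toProd).Subsingleton) by
      have e₁ := forall_not_subsingleton_image_iff (π := T'.π) T'.toProd
      have e₂ := forall_not_subsingleton_image_iff (π := T.π) T.toProd
      exact ⟨fun ⟨p, q⟩ ↦ ⟨hcurve.mp p, e₂.mpr fun H ↦ e₁.mp q ((key p).mpr H)⟩,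
        fun ⟨p, q⟩ ↦ ⟨hcurve.mpr p, e₁.mpr fun H ↦ e₂.mp q ((key (hcurve.mpr p)).mp H)⟩⟩
    intro hc
    have := irreducibleSpace_of_geometricallyIntegral (l := L) T'.π hc.geometricallyIntegral
    exact a.subsingleton_range_toProd_iff

/-! ### The spectrum of an algebraic extension as a limit -/

section limit

variable (k L : Type u) [Field k] [Field L] [Algebra k L]

/-- The finite subextensions of an extension of fields. -/
abbrev FinSub : Type u := {E : IntermediateField k L // FiniteDimensional k E}

instance : IsDirectedOrder (FinSub k L) where
  directed E F := by
    have := E.2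
    have := F.2
    exact ⟨⟨E.1 ⊔ F.1, inferInstance⟩, le_sup_left (a := E.1), le_sup_right (a := E.1)⟩

instance : Nonempty (FinSub k L) := ⟨⟨⊥, inferInstance⟩⟩

/-- The finite subextensions, as a diagram of rings. -/
def FinSub.ringFunctor : FinSub k L ⥤ CommRingCat.{u} where
  obj E := .of E.1
  map h := CommRingCat.ofHom (IntermediateField.inclusion (leOfHom h)).toRingHom
  map_id _ := rfl
  map_comp _ _ := rfl

/-- The cocone on the finite subextensions of `L` with point `L`. -/
def FinSub.ringCocone : Cocone (FinSub.ringFunctor k L) where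
  pt := .of L
  ι := { app := fun E ↦ CommRingCat.ofHom (algebraMap E.1 L) }

/-- An algebraic extension is the colimit of its finite subextensions. -/
lemma FinSub.nonempty_isColimit_ringCocone [Algebra.IsAlgebraic k L] :
    Nonempty (IsColimit (FinSub.ringCocone k L)) := by
  -- The colimit can be checked on underlying sets, where it says that every element of `L` lies in
  -- a finite subextension.
  have : ReflectsFilteredColimits (forget CommRingCat.{u}) :=
    ⟨fun _ ↦ reflectsColimitsOfShape_of_reflectsIsomorphisms⟩
  refine ReflectsColimit.reflects (F := forget _) (Types.FilteredColimit.isColimitOf' _ _ ?_ ?_)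
  · intro x
    let x' : L := x
    have hx : _root_.IsIntegral k x' := Algebra.IsIntegral.isIntegral x'
    have : FiniteDimensional k (IntermediateField.adjoin k {x'}) :=
      IntermediateField.adjoin.finiteDimensional hx
    exact ⟨⟨_, this⟩, ⟨x', IntermediateField.mem_adjoin_simple_self k x'⟩, rfl⟩
  · intro E x y h
    exact ⟨E, 𝟙 _, congrArg _ (Subtype.ext h)⟩

/-- The spectra of the finite subextensions. -/
def FinSub.specFunctor : (FinSub k L)ᵒᵖ ⥤ Scheme.{u} := (FinSub.ringFunctor k L).op ⋙ Scheme.Spec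

/-- The cone with point `Spec L` on the spectra of the finite subextensions. -/
def FinSub.specCone : Cone (FinSub.specFunctor k L) :=
  Scheme.Spec.mapCone (FinSub.ringCocone k L).op

lemma FinSub.nonempty_isLimit_specCone [Algebra.IsAlgebraic k L] :
    Nonempty (IsLimit (FinSub.specCone k L)) :=
  ⟨isLimitOfPreserves Scheme.Spec (FinSub.nonempty_isColimit_ringCocone k L).some.op⟩

variable {k L}

/-- `Spec F ⟶ Spec E` for an extension of fields `F` of `E`. -/
abbrev specExt (E F : Type u) [Field E] [Field F] [Algebra E F] : Spec (.of F) ⟶ Spec (.of E) :=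
  Spec.map (CommRingCat.ofHom (algebraMap E F))

lemma specExt_comp (E F G : Type u) [Field E] [Field F] [Algebra E F] [Field G] [Algebra E G]
    [Algebra F G] [IsScalarTower E F G] : specExt F G ≫ specExt E F = specExt E G := by
  rw [← Spec.map_comp, ← CommRingCat.ofHom_comp, ← IsScalarTower.algebraMap_eq]

/-- `Spec F ⟶ Spec E` for subextensions `E ≤ F`. -/
abbrev specIncl {E F : IntermediateField k L} (h : E ≤ F) : Spec (.of F) ⟶ Spec (.of E) :=
  Spec.map (CommRingCat.ofHom (IntermediateField.inclusion h).toRingHom)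

lemma specIncl_comp_specExt {E F : IntermediateField k L} (h : E ≤ F) :
    specIncl h ≫ specExt k E = specExt k F := by
  rw [← Spec.map_comp, ← CommRingCat.ofHom_comp]
  rfl

lemma specExt_comp_specIncl {E F : IntermediateField k L} (h : E ≤ F) :
    specExt F L ≫ specIncl h = specExt E L := by
  rw [← Spec.map_comp, ← CommRingCat.ofHom_comp]
  rfl

/-! ### Base changes to finite subextensions and their limit -/

variable {T : Scheme.{u}} (π : T ⟶ Spec (.of k))

/-- The transition maps between the base changes of `T` to subextensions. -/
def pullbackIncl {E F : IntermediateField k L} (h : E ≤ F) :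
    pullback π (specExt k F) ⟶ pullback π (specExt k E) :=
  pullback.lift (pullback.fst _ _) (pullback.snd _ _ ≫ specIncl h) (by
    rw [pullback.condition, Category.assoc, specIncl_comp_specExt])

lemma pullbackIncl_fst {E F : IntermediateField k L} (h : E ≤ F) :
    pullbackIncl π h ≫ pullback.fst _ _ = pullback.fst _ _ :=
  pullback.lift_fst _ _ _

lemma pullbackIncl_snd {E F : IntermediateField k L} (h : E ≤ F) :
    pullbackIncl π h ≫ pullback.snd _ _ = pullback.snd _ _ ≫ specIncl h :=
  pullback.lift_snd _ _ _

lemma pullbackIncl_fst_assoc {E F : IntermediateField k L} (h : E ≤ F) {Z : Scheme.{u}}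
    (z : T ⟶ Z) : pullbackIncl π h ≫ pullback.fst _ _ ≫ z = pullback.fst _ _ ≫ z :=
  pullback.lift_fst_assoc _ _ _ z

lemma pullbackIncl_snd_assoc {E F : IntermediateField k L} (h : E ≤ F) {Z : Scheme.{u}}
    (z : Spec (.of E) ⟶ Z) :
    pullbackIncl π h ≫ pullback.snd _ _ ≫ z = pullback.snd _ _ ≫ specIncl h ≫ z :=
  (pullback.lift_snd_assoc _ _ _ z).trans (Category.assoc _ _ _)

/-- The base changes of `T` to the finite subextensions. -/
def FinSub.schemeFunctor : (FinSub k L)ᵒᵖ ⥤ Scheme.{u} where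
  obj E := pullback π (specExt k E.unop.1)
  map h := pullbackIncl π (leOfHom h.unop)
  map_id E := by
    apply pullback.hom_ext
    · rw [pullbackIncl_fst, Category.id_comp]
    · rw [pullbackIncl_snd, Category.id_comp]
      have : specIncl (le_refl E.unop.1) = 𝟙 _ := Spec.map_id _
      exact (congrArg (pullback.snd π (specExt k E.unop.1) ≫ ·) this).trans (Category.comp_id _)
  map_comp f g := by
    apply pullback.hom_ext
    · rw [Category.assoc, pullbackIncl_fst, pullbackIncl_fst, pullbackIncl_fst]
    · rw [Category.assoc, pullbackIncl_snd, pullbackIncl_snd, pullbackIncl_snd_assoc,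
        ← Spec.map_comp, ← CommRingCat.ofHom_comp]
      rfl

variable {π} {TL : Scheme.{u}} {g : TL ⟶ T} {q : TL ⟶ Spec (.of L)}

/-- The map from the base change to `L` to the base change to a subextension. -/
def pullbackProj (h : IsPullback g q π (specExt k L)) (E : IntermediateField k L) :
    TL ⟶ pullback π (specExt k E) :=
  pullback.lift g (q ≫ specExt E L) (by rw [h.w, Category.assoc, specExt_comp])

lemma pullbackProj_fst (h : IsPullback g q π (specExt k L)) (E : IntermediateField k L) :
    pullbackProj h E ≫ pullback.fst _ _ = g :=
  pullback.lift_fst _ _ _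

lemma pullbackProj_fst_assoc (h : IsPullback g q π (specExt k L)) (E : IntermediateField k L)
    {Z : Scheme.{u}} (z : T ⟶ Z) : pullbackProj h E ≫ pullback.fst _ _ ≫ z = g ≫ z :=
  pullback.lift_fst_assoc _ _ _ z

lemma pullbackProj_snd (h : IsPullback g q π (specExt k L)) (E : IntermediateField k L) :
    pullbackProj h E ≫ pullback.snd _ _ = q ≫ specExt E L :=
  pullback.lift_snd _ _ _

lemma isPullback_pullbackProj (h : IsPullback g q π (specExt k L)) (E : IntermediateField k L) :
    IsPullback (pullbackProj h E) q (pullback.snd π (specExt k E)) (specExt E L) := by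
  refine IsPullback.of_right ?_ (pullbackProj_snd h E) (IsPullback.of_hasPullback _ _)
  rwa [pullbackProj_fst, specExt_comp]

lemma pullbackProj_pullbackIncl (h : IsPullback g q π (specExt k L)) {E F : IntermediateField k L}
    (hEF : E ≤ F) : pullbackProj h F ≫ pullbackIncl π hEF = pullbackProj h E := by
  apply pullback.hom_ext
  · rw [Category.assoc, pullbackIncl_fst, pullbackProj_fst, pullbackProj_fst]
  · rw [Category.assoc, pullbackIncl_snd, ← Category.assoc, pullbackProj_snd, pullbackProj_snd,
      Category.assoc, specExt_comp_specIncl]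

/-- The base change to `L`, as a cone on the base changes to the finite subextensions. -/
def FinSub.schemeCone (h : IsPullback g q π (specExt k L)) :
    Cone (FinSub.schemeFunctor (L := L) π) where
  pt := TL
  π :=
    { app := fun E ↦ pullbackProj h E.unop.1
      naturality := fun _ _ f ↦
        (Category.id_comp _).trans (pullbackProj_pullbackIncl h (leOfHom f.unop)).symm }

/-- The base change to an algebraic extension is the limit of the base changes to the finite
subextensions. -/
lemma FinSub.nonempty_isLimit_schemeCone [Algebra.IsAlgebraic k L]
    (h : IsPullback g q π (specExt k L)) : Nonempty (IsLimit (FinSub.schemeCone h)) := by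
  have : IsConnected (FinSub k L)ᵒᵖ := IsCofiltered.isConnected _
  let α : FinSub.schemeFunctor (L := L) π ⟶ FinSub.specFunctor k L :=
    { app := fun E ↦ pullback.snd π (specExt k E.unop.1)
      naturality := fun _ _ f ↦ pullbackIncl_snd π (leOfHom f.unop) }
  -- Over a connected index category, the pullback of a limit cone is a limit cone; here the cone of
  -- spectra is pulled back along the structure morphisms.
  exact ⟨isLimitOfIsPullbackOfIsConnected α (FinSub.schemeCone h) (FinSub.specCone k L)
    { hom := q, w := fun E ↦ (pullbackProj_snd h E.unop.1).symm }
    (fun E ↦ (isPullback_pullbackProj h E.unop.1)) (nonempty_isLimit_specCone k L).some⟩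

lemma isPullback_pullbackIncl {E F : IntermediateField k L} (h : E ≤ F) :
    IsPullback (pullbackIncl π h) (pullback.snd π (specExt k F)) (pullback.snd π (specExt k E))
      (specIncl h) := by
  refine IsPullback.of_right ?_ (pullbackIncl_snd π h) (IsPullback.of_hasPullback _ _)
  rw [pullbackIncl_fst, specIncl_comp_specExt]
  exact IsPullback.of_hasPullback _ _

/-- The theorems on limits of schemes need affine transition maps; these are base changes of
morphisms between affine schemes. -/
instance isAffineHom_schemeFunctor_map {E F : (FinSub k L)ᵒᵖ} (f : E ⟶ F) :
    IsAffineHom ((FinSub.schemeFunctor π).map f) :=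
  MorphismProperty.of_isPullback (P := @IsAffineHom)
    (isPullback_pullbackIncl (π := π) (leOfHom f.unop)).flip inferInstance

/-! ### Morphisms, open subsets and isomorphisms defined at a finite level -/

lemma quasiSeparatedSpace_of_locallyOfFiniteType (π : T ⟶ Spec (.of k)) [LocallyOfFiniteType π] :
    QuasiSeparatedSpace T := by
  have : IsLocallyNoetherian (Spec (.of k)) := inferInstance
  have : IsLocallyNoetherian T := LocallyOfFiniteType.isLocallyNoetherian π
  infer_instance

/-- A field is noetherian, so the two notions agree. Finite presentation of the target is what
allows a morphism out of a limit to be defined at a finite stage. -/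
lemma locallyOfFinitePresentation_of_locallyOfFiniteType (π : T ⟶ Spec (.of k))
    [LocallyOfFiniteType π] : LocallyOfFinitePresentation π := by
  rw [HasRingHomProperty.iff_of_source_openCover (P := @LocallyOfFinitePresentation) T.affineCover]
  intro i
  have h := (HasRingHomProperty.iff_of_source_openCover (P := @LocallyOfFiniteType)
    T.affineCover).mp ‹LocallyOfFiniteType π› i
  have : IsNoetherianRing Γ(Spec (.of k), ⊤) :=
    isNoetherianRing_of_ringEquiv k (Scheme.ΓSpecIso (.of k)).commRingCatIsoToRingEquiv.symm
  exact RingHom.FinitePresentation.of_finiteType.mp h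

lemma locallyOfFiniteType_pullback_snd (π : T ⟶ Spec (.of k)) [LocallyOfFiniteType π]
    (F : Type u) [Field F] [Algebra k F] : LocallyOfFiniteType (pullback.snd π (specExt k F)) :=
  MorphismProperty.of_isPullback (IsPullback.of_hasPullback π (specExt k F)) ‹_›

lemma quasiSeparatedSpace_pullback (π : T ⟶ Spec (.of k)) [LocallyOfFiniteType π]
    (F : Type u) [Field F] [Algebra k F] : QuasiSeparatedSpace (pullback π (specExt k F) :) :=
  have := locallyOfFiniteType_pullback_snd π F
  quasiSeparatedSpace_of_locallyOfFiniteType (pullback.snd π (specExt k F))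

instance compactSpace_schemeFunctor_obj [QuasiCompact π] (E : (FinSub k L)ᵒᵖ) :
    CompactSpace ((FinSub.schemeFunctor π).obj E) :=
  (quasiCompact_iff_compactSpace (f := pullback.snd π (specExt k E.unop.1))).mp
    (inferInstanceAs (QuasiCompact (pullback.snd π (specExt k E.unop.1))))

instance quasiSeparatedSpace_schemeFunctor_obj [LocallyOfFiniteType π] (E : (FinSub k L)ᵒᵖ) :
    QuasiSeparatedSpace ((FinSub.schemeFunctor π).obj E) :=
  quasiSeparatedSpace_pullback π E.unop.1

/-- A `k`-morphism from the base change to `L` to a `k`-scheme locally of finite presentation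
is defined over a finite subextension. -/
lemma exists_pullbackProj_comp_eq [Algebra.IsAlgebraic k L] [QuasiCompact π]
    [LocallyOfFiniteType π] (h : IsPullback g q π (specExt k L)) {B : Scheme.{u}}
    (πB : B ⟶ Spec (.of k)) [LocallyOfFinitePresentation πB] (a : TL ⟶ B)
    (ha : a ≫ πB = g ≫ π) :
    ∃ (E : FinSub k L) (b : pullback π (specExt k E.1) ⟶ B), pullbackProj h E.1 ≫ b = a ∧
      b ≫ πB = pullback.fst _ _ ≫ π := by
  let t : FinSub.schemeFunctor (L := L) π ⟶ (Functor.const _).obj (Spec (.of k)) :=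
    { app := fun E ↦ pullback.fst π (specExt k E.unop.1) ≫ π
      naturality := fun _ _ f ↦ by
        refine Eq.trans ?_ (Category.comp_id _).symm
        exact pullbackIncl_fst_assoc π (leOfHom f.unop) π }
  obtain ⟨E, b, hb, hb'⟩ := Scheme.exists_π_app_comp_eq_of_locallyOfFinitePresentation
    (FinSub.schemeFunctor (L := L) π) t πB (FinSub.schemeCone h)
    (FinSub.nonempty_isLimit_schemeCone h).some a (by
      ext E : 2
      exact (pullbackProj_fst_assoc h E.unop.1 π).trans ha.symm)
  exact ⟨E.unop, b, hb, hb'⟩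

/-- A compact open subset of the base change to `L` is defined over a finite subextension. -/
lemma exists_pullbackProj_preimage_eq [Algebra.IsAlgebraic k L]
    (h : IsPullback g q π (specExt k L)) (U : TL.Opens) (hU : IsCompact (U : Set TL)) :
    ∃ (E : FinSub k L) (V : (pullback π (specExt k E.1)).Opens),
      IsCompact (V : Set (pullback π (specExt k E.1) :)) ∧ pullbackProj h E.1 ⁻¹ᵁ V = U := by
  obtain ⟨E, V, hV, hV'⟩ := exists_preimage_eq (FinSub.schemeFunctor (L := L) π)
    (FinSub.schemeCone h) (FinSub.nonempty_isLimit_schemeCone h).some U hU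
  exact ⟨E.unop, V, hV, hV'⟩

/-- If two `k`-schemes of finite type become isomorphic over `L`, then they become isomorphic over a
finite subextension. -/
lemma exists_isPullback_of_isPullback [Algebra.IsAlgebraic k L] [QuasiCompact π]
    [LocallyOfFiniteType π] (h : IsPullback g q π (specExt k L)) {B : Scheme.{u}}
    {πB : B ⟶ Spec (.of k)} [LocallyOfFiniteType πB] {gB : TL ⟶ B}
    (hB : IsPullback gB q πB (specExt k L)) :
    ∃ (E : FinSub k L) (b : pullback π (specExt k E.1) ⟶ B), pullbackProj h E.1 ≫ b = gB ∧
      IsPullback b (pullback.snd _ _) πB (specExt k E.1) := by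
  have : LocallyOfFinitePresentation πB :=
    locallyOfFinitePresentation_of_locallyOfFiniteType πB
  obtain ⟨E, b, hb, hb'⟩ := exists_pullbackProj_comp_eq h πB gB (hB.w.trans h.w.symm)
  refine ⟨E, b, hb, ?_⟩
  rw [pullback.condition] at hb'
  let m := pullback.lift b (pullback.snd _ _) hb'
  have hm : pullbackProj h E.1 ≫ m = pullbackProj hB E.1 := by
    apply pullback.hom_ext
    · rw [Category.assoc, pullback.lift_fst, hb, pullbackProj_fst]
    · rw [Category.assoc, pullback.lift_snd, pullbackProj_snd, pullbackProj_snd]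
  have hm' : m ≫ pullback.snd _ _ = pullback.snd _ _ := pullback.lift_snd _ _ _
  -- The base change of `m` along the faithfully flat projection from `TL` is an identity, so `m` is
  -- already an isomorphism over `E` and no further extension is needed.
  have : IsIso m := by
    have h₁ : IsPullback (pullbackProj h E.1) (𝟙 _) m (pullbackProj hB E.1) := by
      refine IsPullback.of_bot ?_ (by rw [hm, Category.id_comp]) (isPullback_pullbackProj hB E.1)
      rw [hm', Category.id_comp]
      exact isPullback_pullbackProj h E.1
    have h₂ : fpqc (pullbackProj hB E.1) :=
      MorphismProperty.of_isPullback (isPullback_pullbackProj hB E.1).flip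
        (have ⟨_, _⟩ := flat_and_surjective_of_field (specExt E.1 L); fpqc.mk _)
    exact MorphismProperty.of_isPullback_of_descendsAlong (P := .isomorphisms _) (Q := fpqc)
      h₁.flip h₂
      (inferInstanceAs (IsIso (𝟙 _)))
  refine (IsPullback.of_iso_pullback ⟨hb'⟩ (asIso m) ?_ ?_)
  · exact pullback.lift_fst _ _ _
  · exact hm'

end limit

/-! ### Gluing models -/

namespace AlgebraicGeometry

/-- A square of schemes is cartesian if it is so over the members of an open cover of the upper
right corner. -/
lemma isPullback_of_openCover_of_isPullback {T V T₀ U : Scheme.{u}} {g : T ⟶ T₀} {q : T ⟶ V}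
    {π : T₀ ⟶ U} {v : V ⟶ U} (𝒰 : T₀.OpenCover) {S : 𝒰.I₀ → Scheme.{u}} (j : ∀ i, S i ⟶ T)
    (s : ∀ i, S i ⟶ 𝒰.X i) (h : ∀ i, IsPullback (j i) (s i) g (𝒰.f i))
    (h' : ∀ i, IsPullback (s i) (j i ≫ q) (𝒰.f i ≫ π) v) : IsPullback g q π v := by
  refine Scheme.isPullback_of_openCover _ _ _ _ 𝒰 fun i ↦ (h' i).of_iso (h i).isoPullback
    (Iso.refl _) (Iso.refl _) (Iso.refl _) ?_ ?_ ?_ ?_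
  · exact ((h i).isoPullback_hom_snd.trans (Category.comp_id _).symm).symm
  · rw [Iso.refl_hom, Category.comp_id]
    exact ((h i).isoPullback_hom_fst_assoc q).symm
  · simp
  · simp

/-- The open cover given by two open immersions. -/
def openCoverOfPair {T S O : Scheme.{u}} (jS : S ⟶ T) (jO : O ⟶ T) [IsOpenImmersion jS]
    [IsOpenImmersion jO] (h : ∀ x : T, x ∈ Set.range jS ∨ x ∈ Set.range jO) : T.OpenCover :=
  Scheme.Cover.mkOfCovers (ULift.{u} Bool) (fun i ↦ bif i.down then S else O)
    (fun | ⟨true⟩ => jS | ⟨false⟩ => jO)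
    (fun x ↦ (h x).elim (fun ⟨y, hy⟩ ↦ ⟨⟨true⟩, y, hy⟩) (fun ⟨y, hy⟩ ↦ ⟨⟨false⟩, y, hy⟩))
    (fun | ⟨true⟩ => ‹_› | ⟨false⟩ => ‹_›)

/-- Gluing two morphisms along an intersection. -/
lemma exists_glue_pair {T S O W Z : Scheme.{u}} (jS : S ⟶ T) (jO : O ⟶ T) [IsOpenImmersion jS]
    [IsOpenImmersion jO] (h : ∀ x : T, x ∈ Set.range jS ∨ x ∈ Set.range jO) {wS : W ⟶ S}
    {wO : W ⟶ O} (hW : IsPullback wS wO jS jO) (s : S ⟶ Z) (o : O ⟶ Z) (hso : wS ≫ s = wO ≫ o) :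
    ∃ g : T ⟶ Z, jS ≫ g = s ∧ jO ≫ g = o := by
  have key : pullback.fst jS jO ≫ s = pullback.snd jS jO ≫ o := by
    rw [← cancel_epi hW.isoPullback.hom, hW.isoPullback_hom_fst_assoc,
      hW.isoPullback_hom_snd_assoc, hso]
  have key' : pullback.fst jO jS ≫ o = pullback.snd jO jS ≫ s := by
    rw [← cancel_epi (pullbackSymmetry jS jO).hom, pullbackSymmetry_hom_comp_fst_assoc,
      pullbackSymmetry_hom_comp_snd_assoc, key]
  let X : ULift.{u} Bool → Scheme.{u} := fun i ↦ bif i.down then S else O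
  let f : ∀ i, X i ⟶ Z := fun | ⟨true⟩ => s | ⟨false⟩ => o
  let 𝒯 := openCoverOfPair jS jO h
  have H : ∀ x y : ULift.{u} Bool, pullback.fst (𝒯.f x) (𝒯.f y) ≫ f x =
      pullback.snd (𝒯.f x) (𝒯.f y) ≫ f y := by
    rintro ⟨_ | _⟩ ⟨_ | _⟩
    · exact congr($(fst_eq_snd_of_mono_eq jO) ≫ o)
    · exact key'
    · exact key
    · exact congr($(fst_eq_snd_of_mono_eq jS) ≫ s)
  exact ⟨𝒯.glueMorphisms f H, 𝒯.ι_glueMorphisms f H ⟨true⟩, 𝒯.ι_glueMorphisms f H ⟨false⟩⟩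

lemma isPullback_of_pair {T V T₀ U S O S₀ O₀ : Scheme.{u}} {g : T ⟶ T₀} {q : T ⟶ V}
    {π : T₀ ⟶ U} {v : V ⟶ U} (jS : S₀ ⟶ T₀) (jO : O₀ ⟶ T₀) [IsOpenImmersion jS]
    [IsOpenImmersion jO] (h : ∀ x : T₀, x ∈ Set.range jS ∨ x ∈ Set.range jO) {iS : S ⟶ T}
    {iO : O ⟶ T} {s : S ⟶ S₀} {o : O ⟶ O₀} (hS : IsPullback iS s g jS) (hO : IsPullback iO o g jO)
    (hS' : IsPullback s (iS ≫ q) (jS ≫ π) v) (hO' : IsPullback o (iO ≫ q) (jO ≫ π) v) :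
    IsPullback g q π v := by
  let X : ULift.{u} Bool → Scheme.{u} := fun i ↦ bif i.down then S else O
  let X₀ : ULift.{u} Bool → Scheme.{u} := fun i ↦ bif i.down then S₀ else O₀
  let j : ∀ i, X i ⟶ T := fun | ⟨true⟩ => iS | ⟨false⟩ => iO
  let t : ∀ i, X i ⟶ X₀ i := fun | ⟨true⟩ => s | ⟨false⟩ => o
  exact isPullback_of_openCover_of_isPullback (openCoverOfPair jS jO h) j t
    (fun | ⟨true⟩ => hS | ⟨false⟩ => hO) (fun | ⟨true⟩ => hS' | ⟨false⟩ => hO')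

lemma pushout_inl_eq_inr {A S O : Scheme.{u}} (a : A ⟶ S) (b : A ⟶ O) [IsOpenImmersion a]
    [IsOpenImmersion b] {x : S} {y : O}
    (h : pushout.inl a b x = pushout.inr a b y) : ∃ z : A, a z = x ∧ b z = y := by
  obtain ⟨k, f, f', z, hz, hz'⟩ := (Scheme.IsLocallyDirected.ι_eq_ι_iff (span a b)
    (i := WalkingSpan.left) (j := WalkingSpan.right) (xi := x) (xj := y)).mp h
  -- The only index with arrows to both feet of the span is its apex.
  match k, f, f' with
  | _, .init _, .init _ => exact ⟨z, hz, hz'⟩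

lemma exists_pushout_eq {A S O : Scheme.{u}} (a : A ⟶ S) (b : A ⟶ O) [IsOpenImmersion a]
    [IsOpenImmersion b] (x : (pushout a b :)) :
    x ∈ Set.range (pushout.inl a b) ∨ x ∈ Set.range (pushout.inr a b) := by
  obtain ⟨i, y, hy⟩ := Scheme.IsLocallyDirected.ι_jointly_surjective (span a b) x
  match i with
  | none =>
    exact .inl ⟨a y, (congr($(colimit.w (span a b) WalkingSpan.Hom.fst) y)).trans hy⟩
  | some .left => exact .inl ⟨y, hy⟩
  | some .right => exact .inr ⟨y, hy⟩

/-- Let `T` be the union of the open subschemes `S` and `O`, with intersection `W`, and let `S₀`,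
`O₀` and `A` be models of `S`, `O` and `W`. If `A` is an open subscheme of `S₀` and `O₀`, then these
models glue to a model of `T`. -/
theorem exists_isPullback_of_glue {T V U S O W S₀ O₀ A : Scheme.{u}} (q : T ⟶ V) (v : V ⟶ U)
    (jS : S ⟶ T) (jO : O ⟶ T) [IsOpenImmersion jS] [IsOpenImmersion jO]
    (hT : ∀ x : T, x ∈ Set.range jS ∨ x ∈ Set.range jO) {wS : W ⟶ S} {wO : W ⟶ O}
    (hW : IsPullback wS wO jS jO) (a : A ⟶ S₀) (b : A ⟶ O₀) [IsOpenImmersion a] [IsOpenImmersion b]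
    {πS : S₀ ⟶ U} {πO : O₀ ⟶ U} (hab : a ≫ πS = b ≫ πO) {gS : S ⟶ S₀} {gO : O ⟶ O₀} {gA : W ⟶ A}
    (hS : IsPullback gS (jS ≫ q) πS v) (hO : IsPullback gO (jO ≫ q) πO v)
    (hA : IsPullback wS gA gS a) (hB : IsPullback wO gA gO b) :
    ∃ (T₀ : Scheme.{u}) (π : T₀ ⟶ U) (g : T ⟶ T₀), IsPullback g q π v := by
  have : IsOpenImmersion (pushout.inl a b) :=
    inferInstanceAs (IsOpenImmersion (colimit.ι (span a b) WalkingSpan.left))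
  have : IsOpenImmersion (pushout.inr a b) :=
    inferInstanceAs (IsOpenImmersion (colimit.ι (span a b) WalkingSpan.right))
  obtain ⟨g, hgS, hgO⟩ := exists_glue_pair jS jO hT hW (gS ≫ pushout.inl a b)
    (gO ≫ pushout.inr a b) (by rw [reassoc_of% hA.w, reassoc_of% hB.w, pushout.condition])
  have hgS' (x : S) : g (jS x) = pushout.inl a b (gS x) := congr($hgS x)
  have hgO' (x : O) : g (jO x) = pushout.inr a b (gO x) := congr($hgO x)
  refine ⟨pushout a b, pushout.desc πS πO hab, g, isPullback_of_pair (pushout.inl a b)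
    (pushout.inr a b) (exists_pushout_eq a b) (iS := jS) (iO := jO) (s := gS) (o := gO) ?_ ?_
    (by rwa [pushout.inl_desc]) (by rwa [pushout.inr_desc])⟩
  -- It remains to see that the preimage of `S₀` is exactly `S`. A point of `O` that lands in `S₀`
  -- lands in `A` by `pushout_inl_eq_inr`, and `W` is the preimage of `A` in `O`, so the point comes
  -- from `W`.
  · refine (IsOpenImmersion.isPullback gS jS (pushout.inl a b) g hgS ?_).flip
    ext x
    refine ⟨?_, ?_⟩
    · rintro ⟨y, hy⟩
      obtain ⟨x, rfl⟩ | ⟨x, rfl⟩ := hT x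
      · exact ⟨x, rfl⟩
      · obtain ⟨z, hz, hz'⟩ := pushout_inl_eq_inr a b (hy.trans (hgO' x))
        obtain ⟨w, hw, -⟩ := Scheme.exists_preimage_of_isPullback hB x z hz'.symm
        exact ⟨wS w, by rw [← hw]; exact congr($(hW.w) w)⟩
    · rintro ⟨x, rfl⟩
      exact ⟨gS x, (hgS' x).symm⟩
  · refine (IsOpenImmersion.isPullback gO jO (pushout.inr a b) g hgO ?_).flip
    ext x
    refine ⟨?_, ?_⟩
    · rintro ⟨y, hy⟩
      obtain ⟨x, rfl⟩ | ⟨x, rfl⟩ := hT x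
      · obtain ⟨z, hz, hz'⟩ := pushout_inl_eq_inr a b ((hgS' x).symm.trans hy.symm)
        obtain ⟨w, hw, -⟩ := Scheme.exists_preimage_of_isPullback hA x z hz.symm
        exact ⟨wO w, by rw [← hw]; exact congr($(hW.w.symm) w)⟩
      · exact ⟨x, rfl⟩
    · rintro ⟨x, rfl⟩
      exact ⟨gO x, (hgO' x).symm⟩

end AlgebraicGeometry

/-! ### Models over finite subextensions -/

section spread

variable {k L : Type u} [Field k] [Field L] [Algebra k L]

/-- An `L`-scheme has a model over a finite subextension of `L/k`. -/
def HasFiniteModel (k : Type u) [Field k] [Algebra k L] {T : Scheme.{u}} (q : T ⟶ Spec (.of L)) :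
    Prop :=
  ∃ (E : FinSub k L) (T₀ : Scheme.{u}) (π : T₀ ⟶ Spec (.of E.1)) (g : T ⟶ T₀),
    IsPullback g q π (specExt E.1 L)

/-- This allows the base field to be replaced by a finite subextension, so that the pieces to be
glued have models over the base field itself. -/
lemma HasFiniteModel.of_finSub (F : FinSub k L) {T : Scheme.{u}} {q : T ⟶ Spec (.of L)}
    (h : HasFiniteModel F.1 q) : HasFiniteModel k q := by
  obtain ⟨E, T₀, π, g, hg⟩ := h
  have := F.2
  have := E.2
  have : FiniteDimensional k E.1 := FiniteDimensional.trans k F.1 E.1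
  exact ⟨⟨E.1.restrictScalars k, this⟩, T₀, π, g, hg⟩

lemma exists_isPullback_of_le {E F : IntermediateField k L} (h : E ≤ F) {T T₀ : Scheme.{u}}
    {q : T ⟶ Spec (.of L)} {π : T₀ ⟶ Spec (.of E)} {g : T ⟶ T₀}
    (hg : IsPullback g q π (specExt E L)) :
    ∃ (T₁ : Scheme.{u}) (π₁ : T₁ ⟶ Spec (.of F)) (g₁ : T ⟶ T₁),
      IsPullback g₁ q π₁ (specExt F L) :=
  ⟨pullback π (specIncl h), pullback.snd _ _, pullback.lift g (q ≫ specExt F L) (by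
    rw [hg.w, Category.assoc, specExt_comp_specIncl]), by
    refine IsPullback.of_right ?_ (pullback.lift_snd _ _ _) (IsPullback.of_hasPullback _ _)
    rwa [pullback.lift_fst, specExt_comp_specIncl]⟩

lemma LocallyOfFiniteType.of_isPullback_specExt {T T₀ : Scheme.{u}} {q : T ⟶ Spec (.of L)}
    {π : T₀ ⟶ Spec (.of k)} {g : T ⟶ T₀} (h : IsPullback g q π (specExt k L))
    [LocallyOfFiniteType q] : LocallyOfFiniteType π :=
  have ⟨_, _⟩ := flat_and_surjective_of_field (specExt k L)
  MorphismProperty.of_isPullback_of_descendsAlong (Q := fpqc) h.flip (fpqc.mk _) ‹_›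

lemma QuasiCompact.of_isPullback_specExt {T T₀ : Scheme.{u}} {q : T ⟶ Spec (.of L)}
    {π : T₀ ⟶ Spec (.of k)} {g : T ⟶ T₀} (h : IsPullback g q π (specExt k L))
    [CompactSpace T] : QuasiCompact π :=
  have ⟨_, _⟩ := flat_and_surjective_of_field (specExt k L)
  have : QuasiCompact q := (quasiCompact_iff_compactSpace q).mpr ‹_›
  QuasiCompact.of_isPullback_of_surjective h

section glue

variable {T S O : Scheme.{u}} {q : T ⟶ Spec (.of L)} [LocallyOfFiniteType q] (jS : S ⟶ T)
  (jO : O ⟶ T) [IsOpenImmersion jS] [IsOpenImmersion jO]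
  [Algebra.IsAlgebraic k L] [CompactSpace (pullback jS jO :)]

/-- Both `A` and `B` become the intersection of `S` and `O` over `L`. As two models of the same
scheme they become isomorphic over a finite `E`, and over `E` the models of `S` and `O` are glued
along this isomorphism. -/
lemma hasFiniteModel_of_glue_of_opens (hT : ∀ x : T, x ∈ Set.range jS ∨ x ∈ Set.range jO)
    {S₀ O₀ : Scheme.{u}} {πS : S₀ ⟶ Spec (.of k)}
    {πO : O₀ ⟶ Spec (.of k)} {gS : S ⟶ S₀} {gO : O ⟶ O₀}
    (hS : IsPullback gS (jS ≫ q) πS (specExt k L)) (hO : IsPullback gO (jO ≫ q) πO (specExt k L))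
    (A : S₀.Opens) (hA : gS ⁻¹ᵁ A = (pullback.fst jS jO).opensRange) (B : O₀.Opens)
    (hB : gO ⁻¹ᵁ B = (pullback.snd jS jO).opensRange) : HasFiniteModel k q := by
  have mA (x : (pullback jS jO :)) : gS (pullback.fst jS jO x) ∈ A :=
    hA.ge (⟨x, rfl⟩ : _ ∈ (pullback.fst jS jO).opensRange)
  have mB (x : (pullback jS jO :)) : gO (pullback.snd jS jO x) ∈ B :=
    hB.ge (⟨x, rfl⟩ : _ ∈ (pullback.snd jS jO).opensRange)
  let gA : pullback jS jO ⟶ A := IsOpenImmersion.lift A.ι (pullback.fst jS jO ≫ gS) (by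
    rintro _ ⟨x, rfl⟩; simpa using mA x)
  let gB : pullback jS jO ⟶ B := IsOpenImmersion.lift B.ι (pullback.snd jS jO ≫ gO) (by
    rintro _ ⟨x, rfl⟩; simpa using mB x)
  have sA : IsPullback (pullback.fst jS jO) gA gS A.ι :=
    (IsOpenImmersion.isPullback gA (pullback.fst jS jO) A.ι gS
      (IsOpenImmersion.lift_fac _ _ _).symm (by rw [Scheme.Opens.opensRange_ι, hA])).flip
  have sB : IsPullback (pullback.snd jS jO) gB gO B.ι :=
    (IsOpenImmersion.isPullback gB (pullback.snd jS jO) B.ι gO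
      (IsOpenImmersion.lift_fac _ _ _).symm (by rw [Scheme.Opens.opensRange_ι, hB])).flip
  have tA : IsPullback gA (pullback.fst jS jO ≫ jS ≫ q) (A.ι ≫ πS) (specExt k L) :=
    sA.flip.paste_vert hS
  have tB : IsPullback gB (pullback.fst jS jO ≫ jS ≫ q) (B.ι ≫ πO) (specExt k L) := by
    rw [pullback.condition_assoc]
    exact sB.flip.paste_vert hO
  have : LocallyOfFiniteType (pullback.fst jS jO ≫ jS ≫ q) := inferInstance
  have := QuasiCompact.of_isPullback_specExt tA
  have := LocallyOfFiniteType.of_isPullback_specExt tA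
  have := LocallyOfFiniteType.of_isPullback_specExt tB
  obtain ⟨E, b, hb, hb'⟩ := exists_isPullback_of_isPullback tA tB
  let a : pullback (A.ι ≫ πS) (specExt k E.1) ⟶ pullback πS (specExt k E.1) :=
    pullback.lift (pullback.fst _ _ ≫ A.ι) (pullback.snd _ _)
      (by rw [Category.assoc, pullback.condition])
  -- The base change of `A` to `E` is embedded in the model of `O` through its identification with
  -- the base change of `B`.
  let c : pullback (A.ι ≫ πS) (specExt k E.1) ⟶ pullback πO (specExt k E.1) :=
    pullback.lift (b ≫ B.ι) (pullback.snd _ _) (by rw [Category.assoc, hb'.w])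
  have ha₁ : a ≫ pullback.fst _ _ = pullback.fst _ _ ≫ A.ι := pullback.lift_fst _ _ _
  have ha₂ : a ≫ pullback.snd _ _ = pullback.snd _ _ := pullback.lift_snd _ _ _
  have hc₁ : c ≫ pullback.fst _ _ = b ≫ B.ι := pullback.lift_fst _ _ _
  have hc₂ : c ≫ pullback.snd _ _ = pullback.snd _ _ := pullback.lift_snd _ _ _
  have pa : IsPullback (pullback.fst (A.ι ≫ πS) (specExt k E.1)) a A.ι (pullback.fst _ _) := by
    refine IsPullback.of_bot ?_ ha₁.symm (IsPullback.of_hasPullback πS (specExt k E.1))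
    rw [ha₂]
    exact IsPullback.of_hasPullback _ _
  have pc : IsPullback b c B.ι (pullback.fst _ _) := by
    refine IsPullback.of_bot ?_ hc₁.symm (IsPullback.of_hasPullback πO (specExt k E.1))
    rwa [hc₂]
  have : IsOpenImmersion a := MorphismProperty.of_isPullback pa inferInstance
  have : IsOpenImmersion c := MorphismProperty.of_isPullback pc inferInstance
  refine ⟨E, exists_isPullback_of_glue q (specExt E.1 L) jS jO hT (IsPullback.of_hasPullback _ _) a c
    (ha₂.trans hc₂.symm) (isPullback_pullbackProj hS E.1) (isPullback_pullbackProj hO E.1)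
    (gA := pullbackProj tA E.1) ?_ ?_⟩
  · refine (IsPullback.of_right (h₁₂ := pullback.fst _ _) (h₂₂ := pullback.fst _ _) ?_ ?_ pa).flip
    · rw [pullbackProj_fst, pullbackProj_fst]
      exact sA.flip
    · apply pullback.hom_ext
      · rw [Category.assoc, Category.assoc, ha₁, pullbackProj_fst_assoc, pullbackProj_fst, sA.w]
      · rw [Category.assoc, Category.assoc, ha₂, pullbackProj_snd, pullbackProj_snd,
          Category.assoc, Category.assoc]
  · refine (IsPullback.of_right (h₁₂ := b) (h₂₂ := pullback.fst _ _) ?_ ?_ pc).flip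
    · rw [hb, pullbackProj_fst]
      exact sB.flip
    · apply pullback.hom_ext
      · rw [Category.assoc, Category.assoc, hc₁, reassoc_of% hb, pullbackProj_fst, sB.w]
      · rw [Category.assoc, Category.assoc, hc₂, pullbackProj_snd, pullbackProj_snd,
          pullback.condition_assoc, Category.assoc, Category.assoc]

/-- The intersection is compact and open in both pieces, so it is cut out by open subsets of their
models over a common finite subextension. -/
lemma hasFiniteModel_of_glue (hT : ∀ x : T, x ∈ Set.range jS ∨ x ∈ Set.range jO)
    {S₀ O₀ : Scheme.{u}} {πS : S₀ ⟶ Spec (.of k)}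
    {πO : O₀ ⟶ Spec (.of k)} {gS : S ⟶ S₀} {gO : O ⟶ O₀}
    (hS : IsPullback gS (jS ≫ q) πS (specExt k L))
    (hO : IsPullback gO (jO ≫ q) πO (specExt k L)) : HasFiniteModel k q := by
  obtain ⟨E, A, -, hA⟩ := exists_pullbackProj_preimage_eq hS (pullback.fst jS jO).opensRange
    (isCompact_range (pullback.fst jS jO).continuous)
  obtain ⟨F, B, -, hB⟩ := exists_pullbackProj_preimage_eq hO (pullback.snd jS jO).opensRange
    (isCompact_range (pullback.snd jS jO).continuous)
  obtain ⟨G, hEG, hFG⟩ := exists_ge_ge E F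
  refine .of_finSub G (hasFiniteModel_of_glue_of_opens (k := G.1) jS jO hT
    (isPullback_pullbackProj hS G.1) (isPullback_pullbackProj hO G.1)
    (pullbackIncl πS hEG ⁻¹ᵁ A) ?_ (pullbackIncl πO hFG ⁻¹ᵁ B) ?_)
  · rw [← Scheme.Hom.comp_preimage, pullbackProj_pullbackIncl, hA]
  · rw [← Scheme.Hom.comp_preimage, pullbackProj_pullbackIncl, hB]

lemma HasFiniteModel.glue (hT : ∀ x : T, x ∈ Set.range jS ∨ x ∈ Set.range jO)
    (hS : HasFiniteModel k (jS ≫ q)) (hO : HasFiniteModel k (jO ≫ q)) :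
    HasFiniteModel k q := by
  obtain ⟨E, _, _, _, hE⟩ := hS
  obtain ⟨F, _, _, _, hF⟩ := hO
  obtain ⟨G, hEG, hFG⟩ := exists_ge_ge E F
  obtain ⟨_, _, _, hE'⟩ := exists_isPullback_of_le (show E.1 ≤ G.1 from hEG) hE
  obtain ⟨_, _, _, hF'⟩ := exists_isPullback_of_le (show F.1 ≤ G.1 from hFG) hF
  exact .of_finSub G (hasFiniteModel_of_glue (k := G.1) jS jO hT hE' hF')

end glue

lemma HasFiniteModel.of_iso {T T' : Scheme.{u}} (e : T' ≅ T) {q : T ⟶ Spec (.of L)}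
    (h : HasFiniteModel k (e.hom ≫ q)) : HasFiniteModel k q := by
  obtain ⟨E, T₀, π, g, hg⟩ := h
  exact ⟨E, T₀, π, e.inv ≫ g, hg.of_iso e (Iso.refl _) (Iso.refl _) (Iso.refl _)
    (by simp) (by simp) (by simp) (by simp)⟩

/-- A finite presentation involves finitely many coefficients, and these generate a finite
subextension. -/
lemma hasFiniteModel_specMap [Algebra.IsAlgebraic k L] (A : Type u) [CommRing A] [Algebra L A]
    [Algebra.FinitePresentation L A] :
    HasFiniteModel k (Spec.map (CommRingCat.ofHom (algebraMap L A))) := by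
  let P := Algebra.Presentation.ofFinitePresentation L A
  let E : IntermediateField k L := IntermediateField.adjoin k P.coeffs
  have hE : FiniteDimensional k E := by
    have := P.finite_coeffs.to_subtype
    exact IntermediateField.finiteDimensional_adjoin fun x _ ↦ Algebra.IsIntegral.isIntegral x
  have : P.HasCoeffs E := ⟨fun x hx ↦ ⟨⟨x, IntermediateField.subset_adjoin k _ hx⟩, rfl⟩⟩
  let A₀ := P.ModelOfHasCoeffs E
  let e := P.tensorModelOfHasCoeffsEquiv E
  let f : A₀ →+* A := e.toRingHom.comp Algebra.TensorProduct.includeRight.toRingHom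
  have h : IsPushout (CommRingCat.ofHom (algebraMap E A₀)) (CommRingCat.ofHom (algebraMap E L))
      (CommRingCat.ofHom f) (CommRingCat.ofHom (algebraMap L A)) := by
    refine ((CommRingCat.isPushout_tensorProduct E L A₀).of_iso (Iso.refl _) (Iso.refl _)
      (Iso.refl _) e.toRingEquiv.toCommRingCatIso ?_ ?_ ?_ ?_).flip
    · simp
    · simp
    · ext x
      exact e.commutes x
    · rfl
  exact ⟨⟨E, hE⟩, Spec (.of A₀), Spec.map (CommRingCat.ofHom (algebraMap E A₀)),
    Spec.map (CommRingCat.ofHom f), isPullback_SpecMap_of_isPushout _ _ _ _ h⟩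

lemma hasFiniteModel_of_isAffine [Algebra.IsAlgebraic k L] {T : Scheme.{u}} [IsAffine T]
    (q : T ⟶ Spec (.of L)) [LocallyOfFiniteType q] : HasFiniteModel k q := by
  refine .of_iso T.isoSpec.symm ?_
  obtain ⟨φ, hφ⟩ := Spec.map_surjective (T.isoSpec.symm.hom ≫ q)
  have : LocallyOfFiniteType (Spec.map φ) := hφ ▸ inferInstance
  have h := HasRingHomProperty.Spec_iff.mp this
  have h : φ.hom.FinitePresentation := RingHom.FinitePresentation.of_finiteType.mp h
  rw [← hφ]
  algebraize [φ.hom]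
  exact hasFiniteModel_specMap Γ(T, ⊤)

/-- Schemes of finite type over an algebraic extension are defined over finite subextensions. -/
theorem hasFiniteModel [Algebra.IsAlgebraic k L] {T : Scheme.{u}} (q : T ⟶ Spec (.of L))
    [LocallyOfFiniteType q] [QuasiCompact q] : HasFiniteModel k q := by
  have : CompactSpace T := (quasiCompact_iff_compactSpace q).mp ‹_›
  have : IsLocallyNoetherian T := LocallyOfFiniteType.isLocallyNoetherian q
  -- Compact open subsets arise from the empty one by adjoining affine open subsets one at a time.
  refine .of_iso (Scheme.topIso T) (compact_open_induction_on
    (P := fun U : T.Opens ↦ HasFiniteModel k (U.ι ≫ q)) ⊤ isCompact_univ ?_ ?_)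
  · have : IsAffine (⊥ : T.Opens) := isAffineOpen_bot T
    exact hasFiniteModel_of_isAffine _
  · intro S hS U h
    have : IsAffine U := U.2
    -- Local noetherianity makes the intersection of the two pieces compact.
    have : IsLocallyNoetherian (S ⊔ U.1 : T.Opens) := inferInstance
    refine HasFiniteModel.glue (T.homOfLE le_sup_left) (T.homOfLE le_sup_right)
      ?_ (by rwa [Scheme.homOfLE_ι_assoc])
      (by rw [Scheme.homOfLE_ι_assoc]; exact hasFiniteModel_of_isAffine _)
    rintro ⟨x, hx⟩
    exact hx.imp (fun h ↦ ⟨⟨x, h⟩, Subtype.ext (by simp)⟩) (fun h ↦ ⟨⟨x, h⟩, Subtype.ext (by simp)⟩)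

end spread

/-! ### Families over finite subextensions -/

namespace Family

variable {k L : Type u} [Field k] [Field L] [Algebra k L] {κ : Kind k}

lemma IsAdmissible.locallyOfFiniteType {S : Over (Spec (.of k))} {T : Family κ S}
    (h : T.IsAdmissible) : LocallyOfFiniteType T.π := by
  cases κ with
  | variety => exact IsVariety.locallyOfFiniteType h
  | cover C hC =>
    have := IsSmoothProjectiveCurve.proper h.1
    infer_instance

lemma IsAdmissible.quasiCompact {S : Over (Spec (.of k))} {T : Family κ S}
    (h : T.IsAdmissible) : QuasiCompact T.π := by
  cases κ with
  | variety => exact IsVariety.quasiCompact h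
  | cover C hC =>
    have := IsSmoothProjectiveCurve.proper h.1
    infer_instance

end Family

lemma Kind.locallyOfFiniteType_base_hom {k : Type u} [Field k] (κ : Kind k) :
    LocallyOfFiniteType κ.base.hom := by
  cases κ with
  | variety => exact inferInstanceAs (LocallyOfFiniteType (𝟙 _))
  | cover C hC =>
    have := hC.proper
    exact inferInstanceAs (LocallyOfFiniteType C.hom)

lemma isIntegralHom_specOverMap {k l L : Type u} [Field k] [Field l] [Field L] [Algebra k l]
    [Algebra k L] [Algebra.IsAlgebraic k L] (e : l →ₐ[k] L) :
    IsIntegralHom (specOverMap e).left := by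
  refine (IsIntegralHom.SpecMap_iff (φ := CommRingCat.ofHom e.toRingHom)).mpr ?_
  exact RingHom.IsIntegral.tower_top (algebraMap k l) e.toRingHom (by
    have : e.toRingHom.comp (algebraMap k l) = algebraMap k L := e.comp_algebraMap
    rw [this]
    exact Algebra.IsIntegral.isIntegral)

section

variable {k E K : Type u} [Field k] [Field E] [Field K] [Algebra k E] [Algebra k K] [Algebra E K]
  [IsScalarTower k E K] [Algebra.IsAlgebraic E K] {κ : Kind k}

/-- The map of `k`-schemes `Spec K ⟶ Spec E`. -/
abbrev specOverExt (k E K : Type u) [Field k] [Field E] [Field K] [Algebra k E] [Algebra k K]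
    [Algebra E K] [IsScalarTower k E K] : specOver k K ⟶ specOver k E :=
  specOverMap (IsScalarTower.toAlgHom k E K)

instance (F : IntermediateField E K) : IsScalarTower k F K :=
  .of_algebraMap_eq fun _ ↦ rfl

/-- Families over `E` which become isomorphic over an algebraic extension become isomorphic over a
finite subextension. -/
lemma Family.exists_cartHom_finSub {X : Family κ (specOver k K)} {M M' : Family κ (specOver k E)}
    [hM : LocallyOfFiniteType M.π] [hM₂ : QuasiCompact M.π] [hM' : LocallyOfFiniteType M'.π]
    (a : X.CartHom M (specOverExt k E K)) (a' : X.CartHom M' (specOverExt k E K)) :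
    ∃ (F : FinSub E K) (N : Family κ (specOver k F.1)),
      Nonempty (X.CartHom N (specOverExt k F.1 K)) ∧ Nonempty (N.CartHom M (specOverExt k E F.1)) ∧
        Nonempty (N.CartHom M' (specOverExt k E F.1)) := by
  let π : M.T ⟶ Spec (.of E) := M.π
  let π' : M'.T ⟶ Spec (.of E) := M'.π
  have : LocallyOfFiniteType π := hM
  have : QuasiCompact π := hM₂
  have : LocallyOfFiniteType π' := hM'
  have ha : IsPullback (Y := Spec (.of K)) a.top X.π π (specExt E K) := a.isPullback
  have ha' : IsPullback (Y := Spec (.of K)) a'.top X.π π' (specExt E K) := a'.isPullback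
  obtain ⟨F, b, hb, hb'⟩ := exists_isPullback_of_isPullback ha ha'
  refine ⟨F, M.baseChange (specOverExt k E F.1), ⟨a.lift (M.baseChangeHom _) ?_⟩,
    ⟨M.baseChangeHom _⟩, ⟨⟨b, hb', ?_⟩⟩⟩
  · apply Over.OverMorphism.ext
    exact specExt_comp E F.1 K
  -- Compatibility with the maps to the base of the kind holds over `K`, and it descends because the
  -- projection, being faithfully flat, is an epimorphism.
  · have hp := isPullback_pullbackProj ha F.1
    obtain ⟨_, _⟩ := flat_and_surjective_of_field (specExt F.1 K)
    have : Flat (pullbackProj ha F.1) := MorphismProperty.of_isPullback hp.flip ‹_›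
    have : Surjective (pullbackProj ha F.1) := MorphismProperty.of_isPullback hp.flip ‹_›
    have : Epi (pullbackProj ha F.1) := Flat.epi_of_flat_of_surjective _
    change (b ≫ M'.φ : pullback π (specExt E F.1) ⟶ _) = pullback.fst _ _ ≫ M.φ
    rw [← cancel_epi (pullbackProj ha F.1), reassoc_of% hb, a'.top_φ, ← a.top_φ]
    exact (pullbackProj_fst_assoc ha F.1 M.φ).symm

/-- A family over an algebraic extension is defined over a finite subextension. -/
lemma Family.exists_cartHom_of_quasiCompact {k L : Type u} [Field k] [Field L] [Algebra k L]
    [Algebra.IsAlgebraic k L] {κ : Kind k} (X : Family κ (specOver k L))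
    [hX : LocallyOfFiniteType X.π] [hX' : QuasiCompact X.π] :
    ∃ (F : FinSub k L) (M : Family κ (specOver k F.1)),
      Nonempty (X.CartHom M (specOverMap F.1.val)) := by
  let q : X.T ⟶ Spec (.of L) := X.π
  have : LocallyOfFiniteType q := hX
  have : QuasiCompact q := hX'
  obtain ⟨E, T₀, π, g, hg⟩ := hasFiniteModel (k := k) q
  have := LocallyOfFiniteType.of_isPullback_specExt hg
  have : CompactSpace X.T := (quasiCompact_iff_compactSpace q).mp ‹_›
  have := QuasiCompact.of_isPullback_specExt hg
  have := κ.locallyOfFiniteType_base_hom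
  let B := pullback κ.base.hom (specExt k E.1)
  let πB : B ⟶ Spec (.of E.1) := pullback.snd _ _
  have : LocallyOfFiniteType πB := locallyOfFiniteType_pullback_snd κ.base.hom E.1
  have := locallyOfFinitePresentation_of_locallyOfFiniteType πB
  -- The scheme is now defined over `E`. Its map to the base of the kind, seen as an `E`-morphism to
  -- the base changed to `E`, is defined over a further finite extension `F`.
  obtain ⟨F, b, hb, hb'⟩ := exists_pullbackProj_comp_eq hg πB
    (pullback.lift X.φ (g ≫ π) (by
      rw [X.w, hg.w, Category.assoc, specExt_comp]
      rfl)) (pullback.lift_snd _ _ _)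
  have := E.2
  have := F.2
  have hF : FiniteDimensional k F.1 := FiniteDimensional.trans k E.1 F.1
  refine ⟨⟨F.1.restrictScalars k, hF⟩, ⟨pullback π (specExt E.1 F.1), pullback.snd _ _,
    b ≫ pullback.fst _ _, ?_⟩, ⟨⟨pullbackProj hg F.1, isPullback_pullbackProj hg F.1, ?_⟩⟩⟩
  · rw [Category.assoc, pullback.condition]
    rw [reassoc_of% hb', pullback.condition_assoc, specExt_comp]
    rfl
  · rw [reassoc_of% hb, pullback.lift_fst]

end

/-! ### Embeddings of fields and morphisms of spectra -/

section embeddings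

variable {k l l' K : Type u} [Field k] [Field l] [Field l'] [Field K] [Algebra k l] [Algebra k l']
  [Algebra k K]

lemma specOverMap_comp (e : l →ₐ[k] l') (e' : l' →ₐ[k] K) :
    specOverMap e' ≫ specOverMap e = specOverMap (e'.comp e) := by
  apply Over.OverMorphism.ext
  change Spec.map _ ≫ Spec.map _ = Spec.map _
  rw [← Spec.map_comp]
  rfl

lemma exists_eq_specOverMap (f : specOver k l' ⟶ specOver k l) :
    ∃ e : l →ₐ[k] l', f = specOverMap e := by
  let g : Spec (.of l') ⟶ Spec (.of l) := f.left
  obtain ⟨φ, hφ⟩ := Spec.map_surjective g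
  have h : CommRingCat.ofHom (algebraMap k l) ≫ φ = CommRingCat.ofHom (algebraMap k l') := by
    apply Spec.map_injective
    rw [Spec.map_comp, hφ]
    exact Over.w f
  refine ⟨⟨φ.hom, fun x ↦ congr($h x)⟩, ?_⟩
  apply Over.OverMorphism.ext
  exact hφ.symm

lemma exists_algHom_comp_eq [IsAlgClosed K] [Algebra.IsAlgebraic k l'] (i : l →ₐ[k] l')
    (j : l →ₐ[k] K) : ∃ f : l' →ₐ[k] K, f.comp i = j := by
  algebraize [i.toRingHom, j.toRingHom]
  have : IsScalarTower k l l' := .of_algebraMap_eq fun x ↦ (i.commutes x).symm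
  have : IsScalarTower k l K := .of_algebraMap_eq fun x ↦ (j.commutes x).symm
  have : Algebra.IsAlgebraic l l' := Algebra.IsAlgebraic.tower_top (K := k) l
  let f : l' →ₐ[l] K := IsAlgClosed.lift
  exact ⟨f.restrictScalars k, AlgHom.ext f.commutes⟩

/-- An extension of `j` along `i` is an endomorphism of an algebraic extension, hence bijective. -/
lemma exists_algEquiv_comp_eq [IsAlgClosure k K] (i j : l →ₐ[k] K) :
    ∃ ρ : K ≃ₐ[k] K, (ρ : K →ₐ[k] K).comp i = j := by
  have := IsAlgClosure.isAlgClosed k (K := K)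
  have := IsAlgClosure.isAlgebraic (R := k) (K := K)
  obtain ⟨f, hf⟩ := exists_algHom_comp_eq i j
  exact ⟨AlgEquiv.ofBijective f (Algebra.IsAlgebraic.algHom_bijective f), hf⟩

end embeddings

/-- The spectrum of a finite extension of a field of characteristic zero. -/
def FEt.ofField (k l : Type u) [Field k] [CharZero k] [Field l] [Algebra k l]
    [FiniteDimensional k l] : FEt k where
  toOver := specOver k l
  isFinite := (IsFinite.SpecMap_iff (CommRingCat.ofHom (algebraMap k l))).mpr
    (RingHom.finite_algebraMap.mpr ‹_›)
  etale := by
    have : Algebra.Etale k l :=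
      ⟨Algebra.FormallyEtale.of_isSeparable k l,
        Algebra.FinitePresentation.of_finiteType.mp inferInstance⟩
    refine (HasRingHomProperty.Spec_iff (P := @Etale)).mpr ?_
    exact RingHom.etale_algebraMap.mpr this

namespace DescentObject

variable {k K : Type u} [Field k] [Field K] [Algebra k K]

/-- The family of a "model", considered over an equal base. -/
def Model.familyOn {X : DescentObject k K} (M : X.Model) {U : FEt k} (h : M.U = U) :
    Family X.kind U.toOver :=
  h ▸ M.family

lemma Model.exists_cartHom_familyOn {X : DescentObject k K} (M : X.Model) {U : FEt k}
    (h : M.U = U) (u : U.toOver.left) :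
    ∃ g : specOver k K ⟶ U.toOver, Nonempty (X.toFamily.CartHom (M.familyOn h) g) := by
  subst h
  obtain ⟨g, -, hg⟩ := M.exists_geometricPoint u
  exact ⟨g, hg⟩

/-- The cartesian square underlying a morphism of "models". -/
lemma Model.nonempty_cartHom_familyOn {X : DescentObject k K} {M N : X.Model} (f : M ⟶ N)
    {U V : FEt k} (hM : M.U = U) (hN : N.U = V) (g : U ⟶ V) [h : X.proj.IsHomLift g f] :
    Nonempty ((M.familyOn hM).CartHom (N.familyOn hN) (FEt.homToOver g)) := by
  subst hM hN
  obtain rfl : g = X.proj.map f :=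
    @CategoryTheory.IsHomLift.eq_of_isHomLift _ _ _ _ X.proj M N g f h
  exact ⟨f.top, f.isPullback, f.top_φ⟩

section

variable [CharZero k] [IsAlgClosure k K] (X : DescentObject k K)

/-- The "model" over `Spec l` given by a family over a finite extension `l` of `k`. -/
def modelOfFamily {l : Type u} [Field l] [Algebra k l] [FiniteDimensional k l]
    (T : Family X.kind (specOver k l))
    (h : ∃ e : l →ₐ[k] K, Nonempty (X.toFamily.CartHom T (specOverMap e))) : X.Model where
  U := FEt.ofField k l
  family := T
  isAdmissible := by
    obtain ⟨e, ⟨a⟩⟩ := h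
    have := IsAlgClosure.isAlgebraic (R := k) (K := K)
    have := isIntegralHom_specOverMap e
    exact a.isAdmissible_iff.mp X.isAdmissible
  exists_geometricPoint u := by
    obtain ⟨e, h⟩ := h
    exact ⟨specOverMap e, ⟨Classical.arbitrary (PrimeSpectrum K),
      Subsingleton.elim (α := PrimeSpectrum l) _ _⟩, h⟩

variable {X} {Y : DescentObject k K} (F : BasedFunctor X.models Y.models)

variable {l l' : Type u} [Field l] [Algebra k l] [FiniteDimensional k l] [Field l'] [Algebra k l']
  [FiniteDimensional k l']

/-- The family over `Spec l` that a functor between categories of "models" assigns to a family over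
`Spec l`. -/
def mapFamily (T : Family X.kind (specOver k l))
    (h : ∃ e : l →ₐ[k] K, Nonempty (X.toFamily.CartHom T (specOverMap e))) :
    Family Y.kind (specOver k l) :=
  (F.obj (X.modelOfFamily T h)).familyOn (U := FEt.ofField k l) (F.w_obj (X.modelOfFamily T h))

/-- The embedding obtained for `Y` need not be the one given for `X`; the functor only knows that
its value is a "model". -/
lemma exists_cartHom_mapFamily (T : Family X.kind (specOver k l))
    (h : ∃ e : l →ₐ[k] K, Nonempty (X.toFamily.CartHom T (specOverMap e))) :
    ∃ e : l →ₐ[k] K, Nonempty (Y.toFamily.CartHom (mapFamily F T h) (specOverMap e)) := by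
  obtain ⟨g, hg⟩ := Model.exists_cartHom_familyOn (F.obj (X.modelOfFamily T h))
    (U := FEt.ofField k l) (F.w_obj (X.modelOfFamily T h)) (Classical.arbitrary (PrimeSpectrum l))
  obtain ⟨e, rfl⟩ := exists_eq_specOverMap g
  exact ⟨e, hg⟩

lemma nonempty_cartHom_mapFamily {T : Family X.kind (specOver k l)}
    {T' : Family X.kind (specOver k l')} {f : specOver k l ⟶ specOver k l'} (a : T.CartHom T' f)
    (h : ∃ e : l →ₐ[k] K, Nonempty (X.toFamily.CartHom T (specOverMap e)))
    (h' : ∃ e : l' →ₐ[k] K, Nonempty (X.toFamily.CartHom T' (specOverMap e))) :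
    Nonempty ((mapFamily F T h).CartHom (mapFamily F T' h') f) := by
  let g : FEt.ofField k l ⟶ FEt.ofField k l' := f
  let m : X.modelOfFamily T h ⟶ X.modelOfFamily T' h' := ⟨g, a.top, a.isPullback, a.top_φ⟩
  have : X.proj.IsHomLift g m := Functor.IsHomLift.map m
  have : Y.proj.IsHomLift g (F.map m) := F.preserves_isHomLift g m
  exact Model.nonempty_cartHom_familyOn (F.map m) _ _ g

end

end DescentObject

/-! ### Fields of moduli and fields of definition under functors -/

namespace DescentObject

variable {k K : Type u} [Field k] [Field K] [Algebra k K] [IsAlgClosure k K]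

/-- `X` is defined over a finite subextension. -/
lemma exists_cartHom_finSub (X : DescentObject k K) :
    ∃ (E : FinSub k K) (M : Family X.kind (specOver k E.1)),
      Nonempty (X.toFamily.CartHom M (specOverMap E.1.val)) :=
  have := IsAlgClosure.isAlgebraic (R := k) (K := K)
  have := X.isAdmissible.locallyOfFiniteType
  have := X.isAdmissible.quasiCompact
  X.toFamily.exists_cartHom_of_quasiCompact

/-- Two models of `X` over finite extensions of `k` become isomorphic over a common extension. -/
lemma exists_common_model (X : DescentObject k K) {l l' : Type u} [Field l] [Algebra k l]
    [FiniteDimensional k l] [Field l'] [Algebra k l'] [FiniteDimensional k l']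
    {M : Family X.kind (specOver k l)} {M' : Family X.kind (specOver k l')} {e : l →ₐ[k] K}
    {e' : l' →ₐ[k] K} (a : X.toFamily.CartHom M (specOverMap e))
    (a' : X.toFamily.CartHom M' (specOverMap e')) :
    ∃ (F : FinSub k K) (N : Family X.kind (specOver k F.1)) (f : l →ₐ[k] F.1) (f' : l' →ₐ[k] F.1),
      F.1.val.comp f = e ∧ F.1.val.comp f' = e' ∧
      Nonempty (X.toFamily.CartHom N (specOverMap F.1.val)) ∧
      Nonempty (N.CartHom M (specOverMap f)) ∧ Nonempty (N.CartHom M' (specOverMap f')) := by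
  have := IsAlgClosure.isAlgebraic (R := k) (K := K)
  -- Over the compositum of the two images, both models are models of `X` along the same inclusion
  -- into `K`.
  let E : IntermediateField k K := e.fieldRange ⊔ e'.fieldRange
  have : FiniteDimensional k e.fieldRange :=
    inferInstanceAs (FiniteDimensional k e.toLinearMap.range)
  have : FiniteDimensional k e'.fieldRange :=
    inferInstanceAs (FiniteDimensional k e'.toLinearMap.range)
  have hE : FiniteDimensional k E := inferInstance
  let i : l →ₐ[k] E := e.codRestrict E.toSubalgebra
    fun x ↦ (le_sup_left : e.fieldRange ≤ E) ⟨x, rfl⟩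
  let i' : l' →ₐ[k] E := e'.codRestrict E.toSubalgebra
    fun x ↦ (le_sup_right : e'.fieldRange ≤ E) ⟨x, rfl⟩
  let b : X.toFamily.CartHom (M.baseChange (specOverMap i)) (specOverExt k E K) :=
    a.lift (M.baseChangeHom _) (specOverMap_comp i _)
  let b' : X.toFamily.CartHom (M'.baseChange (specOverMap i')) (specOverExt k E K) :=
    a'.lift (M'.baseChangeHom _) (specOverMap_comp i' _)
  have := isIntegralHom_specOverMap (IsScalarTower.toAlgHom k E K)
  have h := b.isAdmissible_iff.mp X.isAdmissible
  have h' := b'.isAdmissible_iff.mp X.isAdmissible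
  have := h.locallyOfFiniteType
  have := h.quasiCompact
  have := h'.locallyOfFiniteType
  obtain ⟨F, N, ⟨c⟩, ⟨d⟩, ⟨d'⟩⟩ := Family.exists_cartHom_finSub b b'
  have := F.2
  have hF : FiniteDimensional k F.1 := FiniteDimensional.trans k E F.1
  refine ⟨⟨F.1.restrictScalars k, hF⟩, N, (IsScalarTower.toAlgHom k E F.1).comp i,
    (IsScalarTower.toAlgHom k E F.1).comp i', rfl, rfl, ⟨c⟩, ⟨?_⟩, ⟨?_⟩⟩
  · exact (d.comp (M.baseChangeHom _)).cast (specOverMap_comp i _)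
  · exact (d'.comp (M'.baseChangeHom _)).cast (specOverMap_comp i' _)

/-- An automorphism of `K` carries the given embedding of `l` to the inclusion, and it lifts to `X`,
so the same family is a model along the inclusion. -/
lemma HasFieldOfModuli.isFieldOfDefinition {X : DescentObject k K} (hX : X.HasFieldOfModuli)
    {l : IntermediateField k K} (h : X.HasModelOver l) : X.IsFieldOfDefinition l := by
  obtain ⟨e, T, hT, ⟨a⟩⟩ := h
  obtain ⟨ρ, hρ⟩ := exists_algEquiv_comp_eq e l.val
  obtain ⟨b⟩ := hX ρ
  exact ⟨T, hT, ⟨(b.comp a).cast ((specOverMap_comp e _).trans (congrArg _ hρ))⟩⟩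

variable {X Y : DescentObject k K}

/-- The field `l` may be infinite over `k`, whereas the functors only see finite extensions. This
lemma and its converse `exists_finSub` pass between the two: an embedding of `E` extends to `l`, and
the model is base changed. -/
lemma HasModelOver.of_finSub {l : IntermediateField k K} {E : FinSub k l}
    {T : Family X.kind (specOver k E.1)} {e : E.1 →ₐ[k] K}
    (a : X.toFamily.CartHom T (specOverMap e)) : X.HasModelOver l := by
  have := IsAlgClosure.isAlgClosed k (K := K)
  have := IsAlgClosure.isAlgebraic (R := k) (K := K)
  obtain ⟨g, hg⟩ := exists_algHom_comp_eq E.1.val e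
  let b : X.toFamily.CartHom (T.baseChange (specOverMap E.1.val)) (specOverMap g) :=
    a.lift (T.baseChangeHom _) ((specOverMap_comp _ _).trans (congrArg _ hg))
  have := isIntegralHom_specOverMap g
  exact ⟨g, _, b.isAdmissible_iff.mp X.isAdmissible, ⟨b⟩⟩

lemma HasModelOver.exists_finSub {l : IntermediateField k K} (h : X.HasModelOver l) :
    ∃ (E : FinSub k l) (T : Family X.kind (specOver k E.1)) (e : E.1 →ₐ[k] K),
      Nonempty (X.toFamily.CartHom T (specOverMap e)) := by
  have := IsAlgClosure.isAlgebraic (R := k) (K := K)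
  obtain ⟨e, T, hT, ⟨a⟩⟩ := h
  have := hT.locallyOfFiniteType
  have := hT.quasiCompact
  obtain ⟨E, T₀, ⟨b⟩⟩ := T.exists_cartHom_of_quasiCompact
  exact ⟨E, T₀, e.comp E.1.val, ⟨(a.comp b).cast (specOverMap_comp _ _)⟩⟩

variable [CharZero k]

/-- A functor between categories of "models" transports "models". -/
lemma HasModelOver.map (F : BasedFunctor X.models Y.models) {l : IntermediateField k K}
    (h : X.HasModelOver l) : Y.HasModelOver l := by
  obtain ⟨E, T, e, ⟨a⟩⟩ := h.exists_finSub
  have := E.2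
  obtain ⟨g, ⟨b⟩⟩ := exists_cartHom_mapFamily F T ⟨e, ⟨a⟩⟩
  exact .of_finSub b

/-- A functor between categories of "models" transports the field of moduli. -/
lemma HasFieldOfModuli.map (F : BasedFunctor X.models Y.models) (hX : X.HasFieldOfModuli) :
    Y.HasFieldOfModuli := by
  intro σ
  obtain ⟨E, M, ⟨a⟩⟩ := X.exists_cartHom_finSub
  have := E.2
  have hM : ∃ e : E.1 →ₐ[k] K, Nonempty (X.toFamily.CartHom M (specOverMap e)) := ⟨_, ⟨a⟩⟩
  obtain ⟨g, ⟨b⟩⟩ := exists_cartHom_mapFamily F M hM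
  obtain ⟨ρ, hρ⟩ := exists_algEquiv_comp_eq E.1.val g
  -- As a map, `τ` is `ρ⁻¹ ∘ σ ∘ ρ`; the conjugation makes up for `F M` being a model along `g = ρ ∘
  -- E.val` instead of the inclusion.
  let τ : K ≃ₐ[k] K := (ρ.trans σ).trans ρ.symm
  obtain ⟨c⟩ := hX τ
  obtain ⟨G, N, f, f', hf, hf', ⟨aN⟩, ⟨n⟩, ⟨n'⟩⟩ := X.exists_common_model a
    ((c.comp a).cast (specOverMap_comp _ _))
  have := G.2
  have hN : ∃ e : G.1 →ₐ[k] K, Nonempty (X.toFamily.CartHom N (specOverMap e)) := ⟨_, ⟨aN⟩⟩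
  obtain ⟨m⟩ := nonempty_cartHom_mapFamily F n hN hM
  obtain ⟨m'⟩ := nonempty_cartHom_mapFamily F n' hN hM
  -- The square from `Y` to `F M` over `g` factors through `F N` by way of `f`. Continuing along
  -- `f'` instead gives a square over `σ ∘ g`, and comparing it with `b` lifts `σ` to `Y`.
  let d : Y.toFamily.CartHom (mapFamily F N hN) (specOverMap ((ρ : K →ₐ[k] K).comp G.1.val)) :=
    b.lift m (by rw [specOverMap_comp, AlgHom.comp_assoc, hf, hρ])
  have h : ((ρ : K →ₐ[k] K).comp G.1.val).comp f' = (σ : K →ₐ[k] K).comp g := by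
    rw [AlgHom.comp_assoc, hf', ← hρ]
    ext x
    simp [τ]
  exact ⟨((d.comp m').cast (specOverMap_comp _ _)).lift b (by rw [specOverMap_comp, h])⟩

end DescentObject

/-! ### Galois descent of rings -/

section galoisRing

variable {G A : Type*} [Group G] [CommRing A]

/-- The subring of the invariants of a group acting by endomorphisms of a ring. -/
def invariantSubring (ρ : G →* (A →+* A)) : Subring A where
  carrier := {a | ∀ σ, ρ σ a = a}
  mul_mem' ha hb σ := by rw [map_mul, ha σ, hb σ]
  one_mem' σ := map_one _
  add_mem' ha hb σ := by rw [_root_.map_add, ha σ, hb σ]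
  zero_mem' σ := map_zero _
  neg_mem' ha σ := by rw [_root_.map_neg, ha σ]

variable [Fintype G]

/-- The sum of the conjugates of an element. -/
def invariantSum (ρ : G →* (A →+* A)) (a : A) : invariantSubring ρ :=
  ⟨∑ σ, ρ σ a, fun τ ↦ by
    rw [_root_.map_sum]
    refine Fintype.sum_bijective (τ * ·) (Group.mulLeft_bijective τ) _ _ fun σ ↦ ?_
    rw [map_mul]
    rfl⟩

lemma coe_invariantSum (ρ : G →* (A →+* A)) (a : A) : (invariantSum ρ a : A) = ∑ σ, ρ σ a := rfl

lemma coe_invariantSum_mul (ρ : G →* (A →+* A)) (a : A) (b : invariantSubring ρ) :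
    (invariantSum ρ (a * b) : A) = invariantSum ρ a * b := by
  simp_rw [coe_invariantSum, Finset.sum_mul, map_mul]
  exact Finset.sum_congr rfl fun σ _ ↦ by rw [b.2 σ]

/-- Invariants commute with localization at an invariant element, if there is an element of
trace one. -/
lemma IsLocalization.Away.invariantSubring {A' : Type*} [CommRing A'] [Algebra A A']
    (ρ : G →* (A →+* A)) (ρ' : G →* (A' →+* A'))
    (hρ : ∀ σ a, ρ' σ (algebraMap A A' a) = algebraMap A A' (ρ σ a)) (r : invariantSubring ρ)
    [IsLocalization.Away (r : A) A'] (c : A) (hc : ∑ σ, ρ σ c = 1)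
    [Algebra (invariantSubring ρ) (invariantSubring ρ')]
    (h : ∀ a, (algebraMap (invariantSubring ρ) (invariantSubring ρ') a : A') =
      algebraMap A A' a) :
    IsLocalization.Away r (_root_.invariantSubring ρ') := by
  have hr : IsUnit (algebraMap A A' r) := IsLocalization.Away.algebraMap_isUnit (r : A)
  refine ⟨?_, ?_, ?_⟩
  · rintro ⟨-, n, rfl⟩
    rw [map_pow]
    refine IsUnit.pow n ?_
    obtain ⟨u, hu⟩ := hr
    refine IsUnit.of_mul_eq_one ⟨((u⁻¹ : A'ˣ) : A'), fun σ ↦ ?_⟩ (Subtype.ext ?_)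
    · have h₁ : ρ' σ u = u := by rw [hu, hρ, r.2 σ]
      have h₂ : ρ' σ ((u⁻¹ : A'ˣ) : A') * u = 1 := by
        rw [← h₁, ← map_mul, Units.inv_mul, map_one]
      exact Units.eq_inv_of_mul_eq_one_right h₂
    · have h₁ : (algebraMap _ (_root_.invariantSubring ρ') r : A') * ((u⁻¹ : A'ˣ) : A') = 1 := by
        rw [h, ← hu, Units.mul_inv]
      exact h₁
  · intro z
    obtain ⟨n, a, ha⟩ := IsLocalization.Away.surj (r : A) (z : A')
    -- The numerator `a` is invariant only after localization. The trace of `c * a` is invariant in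
    -- `A` and has the same image as `a`, because `c` has trace one.
    refine ⟨(invariantSum ρ (c * a), ⟨r ^ n, n, rfl⟩), Subtype.ext ?_⟩
    change (z : A') * (algebraMap _ (_root_.invariantSubring ρ') (r ^ n) : A') =
      (algebraMap _ (_root_.invariantSubring ρ') _ : A')
    rw [h, h, Subring.coe_pow, map_pow, ha, coe_invariantSum, _root_.map_sum]
    have hz (σ : G) : ρ' σ (algebraMap A A' a) = algebraMap A A' a := by
      have h₁ : ρ' σ z = z := z.2 σ
      have h₂ : ρ σ r = r := r.2 σ
      rw [← ha, map_mul, map_pow, hρ, h₁, h₂]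
    simp_rw [map_mul, ← hρ _ a, hz, ← Finset.sum_mul, ← _root_.map_sum, hc, map_one, one_mul]
  · intro a b hab
    have hab' : algebraMap A A' a = algebraMap A A' b := by rw [← h, ← h, hab]
    obtain ⟨⟨-, n, rfl⟩, hn⟩ := IsLocalization.exists_of_eq (M := .powers (r : A)) hab'
    exact ⟨⟨r ^ n, n, rfl⟩, Subtype.ext hn⟩

end galoisRing

section galoisField

variable (l L : Type*) [Field l] [Field L] [Algebra l L] [FiniteDimensional l L] [IsGalois l L]

open scoped Classical in
-- Trace duality says that the matrix of conjugates of the basis times that of the dual basis is the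
-- identity. The degree equals the order of the Galois group, so the matrices are square and
-- commute; the sum is an entry of the product in the other order.
lemma sum_mul_traceDual {ι : Type*} [Fintype ι] [DecidableEq ι] (b : Module.Basis ι l L)
    (σ : L ≃ₐ[l] L) : ∑ i, b i * σ (b.traceDual i) = if σ = 1 then 1 else 0 := by
  let B : Matrix ι (L ≃ₐ[l] L) L := .of fun i σ ↦ σ (b i)
  let D : Matrix (L ≃ₐ[l] L) ι L := .of fun σ i ↦ σ (b.traceDual i)
  have h : B * D = 1 := by
    ext i j
    simp_rw [Matrix.mul_apply, B, D, Matrix.of_apply, ← map_mul]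
    rw [← trace_eq_sum_automorphisms, Module.Basis.trace_mul_traceDual, Matrix.one_apply]
    split_ifs <;> simp
  have e : ι ≃ (L ≃ₐ[l] L) := Fintype.equivOfCardEq (by
    rw [← Module.finrank_eq_card_basis b, ← Nat.card_eq_fintype_card,
      IsGalois.card_aut_eq_finrank])
  have h' : D * B = 1 := (Matrix.mul_eq_one_comm_of_equiv e).mp h
  have := congr_fun₂ h' σ 1
  simp_rw [Matrix.mul_apply, B, D, Matrix.of_apply, AlgEquiv.one_apply, Matrix.one_apply] at this
  rw [← this]
  exact Finset.sum_congr rfl fun i _ ↦ mul_comm _ _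

lemma exists_sum_algEquiv_eq_one : ∃ c : L, ∑ σ : L ≃ₐ[l] L, σ c = 1 := by
  obtain ⟨c, hc⟩ := Algebra.trace_surjective l L 1
  exact ⟨c, by rw [← trace_eq_sum_automorphisms, hc, map_one]⟩

variable {l L} {A : Type*} [CommRing A] [Algebra L A] [Algebra l A] [IsScalarTower l L A]

/-- Galois descent: an `L`-algebra with a semilinear action of the Galois group of `L / l` is the
base change of its invariants. -/
theorem isPushout_invariantSubring (ρ : (L ≃ₐ[l] L) →* (A →+* A))
    (hρ : ∀ σ c, ρ σ (algebraMap L A c) = algebraMap L A (σ c)) [Algebra l (invariantSubring ρ)]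
    [IsScalarTower l (invariantSubring ρ) A] : Algebra.IsPushout l L (invariantSubring ρ) A := by
  classical
  let b := Module.finBasis l L
  let B : Fin (Module.finrank l L) → A := fun i ↦ algebraMap L A (b i)
  -- The basis `b` of `L / l` is also a basis of `A` over its invariants. Multiplying a relation by
  -- the dual vector of `b j` and summing over conjugates isolates the coefficient `a j`.
  have hli : LinearIndependent (invariantSubring ρ) B := by
    rw [Fintype.linearIndependent_iff]
    intro a ha j
    have h₁ (i) : (invariantSum ρ (algebraMap L A (b.traceDual j) * B i) : A) =
        if i = j then 1 else 0 := by
      simp_rw [coe_invariantSum, B, ← map_mul, hρ, ← _root_.map_sum]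
      rw [← trace_eq_sum_automorphisms, Module.Basis.trace_traceDual_mul]
      split_ifs <;> simp
    have h₂ : (invariantSum ρ (algebraMap L A (b.traceDual j) * ∑ i, a i • B i) : A) = a j := by
      have h₃ (i) : algebraMap L A (b.traceDual j) * a i • B i =
          algebraMap L A (b.traceDual j) * B i * a i := by
        rw [Subring.smul_def, smul_eq_mul]
        ring
      have h₄ : (invariantSum ρ (algebraMap L A (b.traceDual j) * ∑ i, a i • B i) : A) =
          ∑ i, (invariantSum ρ (algebraMap L A (b.traceDual j) * B i * a i) : A) := by
        simp_rw [Finset.mul_sum, h₃, coe_invariantSum, _root_.map_sum]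
        exact Finset.sum_comm
      simp_rw [h₄, coe_invariantSum_mul, h₁]
      simp
    rw [ha, mul_zero] at h₂
    apply Subtype.ext
    rw [← h₂, coe_invariantSum]
    simp
  have hsp : ⊤ ≤ Submodule.span (invariantSubring ρ) (Set.range B) := by
    intro a _
    -- In this expansion the terms of the conjugates `ρ σ a` with `σ ≠ 1` cancel by
    -- `sum_mul_traceDual`.
    have h : a = ∑ i, invariantSum ρ (algebraMap L A (b.traceDual i) * a) • B i := by
      simp_rw [Subring.smul_def, coe_invariantSum, smul_eq_mul, map_mul, hρ, Finset.sum_mul]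
      rw [Finset.sum_comm]
      have (σ : L ≃ₐ[l] L) : ∑ i, algebraMap L A (σ (b.traceDual i)) * ρ σ a * B i =
          algebraMap L A (∑ i, b i * σ (b.traceDual i)) * ρ σ a := by
        rw [_root_.map_sum, Finset.sum_mul]
        refine Finset.sum_congr rfl fun i _ ↦ ?_
        rw [map_mul]
        ring
      simp_rw [this, sum_mul_traceDual]
      simp
    rw [h]
    exact Submodule.sum_mem _ fun i _ ↦ Submodule.smul_mem _ _ (Submodule.subset_span ⟨i, rfl⟩)
  let B' : Module.Basis _ (invariantSubring ρ) A := .mk hli hsp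
  have hpush : Algebra.IsPushout l (invariantSubring ρ) L A := by
    refine ⟨IsBaseChange.of_equiv ((Algebra.TensorProduct.basis _ b).equiv B' (.refl _)) ?_⟩
    intro x
    let e := ((Algebra.TensorProduct.basis (invariantSubring ρ) b).equiv B' (.refl _))
    let e₁ : L →ₗ[l] A := (e.toLinearMap.restrictScalars l) ∘ₗ
      (TensorProduct.mk l (invariantSubring ρ) L 1)
    have : e₁ = (IsScalarTower.toAlgHom l L A).toLinearMap := by
      refine b.ext fun i ↦ ?_
      have h₁ := (Algebra.TensorProduct.basis (invariantSubring ρ) b).equiv_apply i B' (.refl _)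
      rw [Algebra.TensorProduct.basis_apply] at h₁
      refine h₁.trans ?_
      simp [B', B]
    exact congr($this x)
  exact hpush.symm

end galoisField

/-! ### Galois descent of schemes that are affine over a base -/

/-- An action of a group on a scheme `T` over `P`. -/
structure SchemeAction (G : Type*) [Group G] {T P : Scheme.{u}} (f : T ⟶ P) where
  map : G → (T ⟶ T)
  map_one : map 1 = 𝟙 T
  map_mul (σ τ : G) : map (σ * τ) = map σ ≫ map τ
  map_comp (σ : G) : map σ ≫ f = f

namespace SchemeAction

open Scheme.AffineZariskiSite

variable {G : Type*} [Group G] {T P : Scheme.{u}} {f : T ⟶ P} (s : SchemeAction G f)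

lemma preimage_eq (σ : G) (U : P.Opens) : s.map σ ⁻¹ᵁ f ⁻¹ᵁ U = f ⁻¹ᵁ U := by
  rw [← Scheme.Hom.comp_preimage, s.map_comp]

/-- The action on the sections over the preimage of an open set of the base. -/
def act (U : P.Opens) : G →* (Γ(T, f ⁻¹ᵁ U) →+* Γ(T, f ⁻¹ᵁ U)) where
  toFun σ := ((s.map σ).appLE (f ⁻¹ᵁ U) (f ⁻¹ᵁ U) (s.preimage_eq σ U).ge).hom
  map_one' := by
    have h : (s.map 1).appLE (f ⁻¹ᵁ U) (f ⁻¹ᵁ U) (s.preimage_eq 1 U).ge = 𝟙 _ := by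
      have : ∀ (t : T ⟶ T) (h : f ⁻¹ᵁ U ≤ t ⁻¹ᵁ f ⁻¹ᵁ U), t = 𝟙 T →
          t.appLE (f ⁻¹ᵁ U) (f ⁻¹ᵁ U) h = 𝟙 _ := by
        rintro t h rfl
        rw [Scheme.Hom.appLE, Scheme.Hom.id_app]
        exact (Category.id_comp _).trans (T.presheaf.map_id _)
      exact this _ _ s.map_one
    rw [h]
    rfl
  map_mul' σ τ := by
    -- Pulling back sections reverses the diagrammatic order of composition in `map_mul`, which
    -- gives the usual order for ring endomorphisms.
    have h : (s.map (σ * τ)).appLE (f ⁻¹ᵁ U) (f ⁻¹ᵁ U) (s.preimage_eq _ U).ge =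
        (s.map τ).appLE (f ⁻¹ᵁ U) (f ⁻¹ᵁ U) (s.preimage_eq _ U).ge ≫
          (s.map σ).appLE (f ⁻¹ᵁ U) (f ⁻¹ᵁ U) (s.preimage_eq _ U).ge := by
      rw [Scheme.Hom.appLE_comp_appLE]
      simp_rw [s.map_mul]
    rw [h]
    rfl

lemma act_map {U V : P.Opens} (h : U ≤ V) (σ : G) (a : Γ(T, f ⁻¹ᵁ V)) :
    s.act U σ (T.presheaf.map (homOfLE (f.preimage_mono h)).op a) =
      T.presheaf.map (homOfLE (f.preimage_mono h)).op (s.act V σ a) := by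
  change ((T.presheaf.map (homOfLE (f.preimage_mono h)).op ≫ (s.map σ).appLE _ _ _) a) =
    ((s.map σ).appLE _ _ _ ≫ T.presheaf.map (homOfLE (f.preimage_mono h)).op) a
  rw [Scheme.Hom.map_appLE, Scheme.Hom.appLE_map]

lemma act_app (U : P.Opens) (σ : G) (a : Γ(P, U)) : s.act U σ (f.app U a) = f.app U a := by
  have h : f.appLE U (f ⁻¹ᵁ U) le_rfl ≫ (s.map σ).appLE _ _ (s.preimage_eq σ U).ge =
      f.appLE U (f ⁻¹ᵁ U) le_rfl := by
    rw [Scheme.Hom.appLE_comp_appLE]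
    simp_rw [s.map_comp]
  rw [Scheme.Hom.app_eq_appLE]
  exact congr($h a)

/-- The presheaf of the invariant sections. -/
def invariants : P.Opensᵒᵖ ⥤ CommRingCat.{u} where
  obj U := .of (invariantSubring (s.act U.unop))
  map {V U} i := CommRingCat.ofHom
    ((T.presheaf.map (homOfLE (f.preimage_mono i.unop.le)).op).hom.restrict _ _ fun a ha σ ↦ by
      refine (s.act_map i.unop.le σ a).trans ?_
      rw [ha σ])
  map_id U := by
    ext a
    change T.presheaf.map (𝟙 _) _ = _
    rw [T.presheaf.map_id]
    rfl
  map_comp i j := by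
    ext a
    change T.presheaf.map ((homOfLE (f.preimage_mono i.unop.le)).op ≫
      (homOfLE (f.preimage_mono j.unop.le)).op) _ = _
    rw [T.presheaf.map_comp]
    rfl

/-- The sections of the base are invariant. -/
def toInvariants : P.presheaf ⟶ s.invariants where
  app U := CommRingCat.ofHom ((f.app U.unop).hom.codRestrict _ fun a σ ↦ s.act_app U.unop σ a)
  naturality {U V} i := by
    ext x
    exact Subtype.ext congr($(f.naturality i) x)

/-- Invariant sections are compatible with localization, if there is an element of trace one. -/
lemma coequifibered_toInvariants [Fintype G] [QuasiCompact f] [QuasiSeparated f]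
    (hs : ∀ U : P.Opens, ∃ c, ∑ σ, s.act U σ c = 1) :
    ((toOpensFunctor P).op.whiskerLeft s.toInvariants).Coequifibered := by
  refine coequifibered_iff_forall_isLocalizationAway.mpr fun U r ↦ ?_
  let inst : Algebra Γ(T, f ⁻¹ᵁ U.1) Γ(T, f ⁻¹ᵁ P.basicOpen r) :=
    (T.presheaf.map (homOfLE (f.preimage_mono (P.basicOpen_le r))).op).hom.toAlgebra
  have hloc : IsLocalization.Away (f.app U.1 r) Γ(T, f ⁻¹ᵁ P.basicOpen r) := by
    let : Algebra Γ(T, f ⁻¹ᵁ U.1) Γ(T, T.basicOpen (f.app _ r)) :=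
      (T.presheaf.map (homOfLE (T.basicOpen_le _)).op).hom.toAlgebra
    dsimp +instances [inst]
    rw! (castMode := .all) [f.preimage_basicOpen r]
    exact isLocalization_basicOpen_of_qcqs (f.isCompact_preimage U.2.isCompact)
        (f.isQuasiSeparated_preimage U.2.isQuasiSeparated) (f.app _ r)
  let : Algebra (invariantSubring (s.act U.1)) (invariantSubring (s.act (P.basicOpen r))) :=
    (s.invariants.map (homOfLE (P.basicOpen_le r)).op).hom.toAlgebra
  obtain ⟨c, hc⟩ := hs U.1
  let r' : invariantSubring (s.act U.1) := s.toInvariants.app (.op U.1) r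
  have : IsLocalization.Away (r' : Γ(T, f ⁻¹ᵁ U.1)) Γ(T, f ⁻¹ᵁ P.basicOpen r) := hloc
  exact IsLocalization.Away.invariantSubring (s.act U.1) (s.act (P.basicOpen r))
    (fun σ a ↦ s.act_map (P.basicOpen_le r) σ a) r' c hc (fun a ↦ rfl)

end SchemeAction

/-- Morphisms on the preimages of affine open sets glue, if they are compatible with the inclusions
of basic open sets. -/
lemma exists_glue_of_affineZariskiSite {T P Z : Scheme.{u}} (f : T ⟶ P)
    (g : ∀ U : P.AffineZariskiSite, (f ⁻¹ᵁ U.toOpens).toScheme ⟶ Z)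
    (hg : ∀ {U V : P.AffineZariskiSite} (_ : U ≤ V) (h : U.toOpens ≤ V.toOpens),
      T.homOfLE (f.preimage_mono h) ≫ g V = g U) :
    ∃ g' : T ⟶ Z, ∀ U : P.AffineZariskiSite, (f ⁻¹ᵁ U.toOpens).ι ≫ g' = g U := by
  let 𝒰 := (Scheme.AffineZariskiSite.directedCover P).pullback₁ f
  let e (U : P.AffineZariskiSite) := pullbackRestrictIsoRestrict f U.toOpens
  have he (U : P.AffineZariskiSite) :
      (e U).hom ≫ (f ⁻¹ᵁ U.toOpens).ι = pullback.fst f U.toOpens.ι := by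
    simp [e]
  have h₀ {U V : P.AffineZariskiSite} (h : U.toOpens ≤ V.toOpens) :
      pullback.map f U.toOpens.ι f V.toOpens.ι (𝟙 T) (P.homOfLE h) (𝟙 P) (by simp) (by simp) ≫
        (e V).hom = (e U).hom ≫ T.homOfLE (f.preimage_mono h) := by
    rw [← cancel_mono (f ⁻¹ᵁ V.toOpens).ι, Category.assoc, Category.assoc, he, T.homOfLE_ι, he]
    exact (pullback.lift_fst _ _ _).trans (Category.comp_id _)
  let g₁ : ∀ U : P.AffineZariskiSite, pullback f U.toOpens.ι ⟶ Z := fun U ↦ (e U).hom ≫ g U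
  have h₁ {U V : P.AffineZariskiSite} (h' : U ≤ V) (h : U.toOpens ≤ V.toOpens) :
      pullback.map f U.toOpens.ι f V.toOpens.ι (𝟙 T) (P.homOfLE h) (𝟙 P) (by simp) (by simp) ≫
        g₁ V = g₁ U := by
    rw [← Category.assoc, h₀, Category.assoc, hg h' h]
  have h₂ {U V : P.AffineZariskiSite} (i : U ⟶ V) :=
    h₁ i.le (Scheme.AffineZariskiSite.toOpens_mono i.le)
  refine ⟨Scheme.OpenCover.glueMorphismsOfLocallyDirected 𝒰 g₁ h₂, fun U ↦ ?_⟩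
  rw [← cancel_epi (e U).hom, ← Category.assoc, he]
  exact Scheme.OpenCover.map_glueMorphismsOfLocallyDirected 𝒰 g₁ h₂ U

lemma toSpecΓ_comp_specMap_app_comp_fromSpec {T P : Scheme.{u}} (f : T ⟶ P) {U : P.Opens}
    (hU : IsAffineOpen U) :
    (f ⁻¹ᵁ U).toSpecΓ ≫ Spec.map (f.app U) ≫ hU.fromSpec = (f ⁻¹ᵁ U).ι ≫ f := by
  simp

namespace SchemeAction

open Scheme.AffineZariskiSite

variable {G : Type*} [Group G] {T P : Scheme.{u}} {f : T ⟶ P} (s : SchemeAction G f)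

/-- The spectrum of the invariant sections over an affine open set. -/
abbrev specInvariants (U : P.AffineZariskiSite) : Scheme.{u} :=
  Spec (.of (invariantSubring (s.act U.toOpens)))

/-- The morphism from the preimage of an affine open set to the spectrum of the invariant
sections. -/
def toSpecInvariants (U : P.AffineZariskiSite) :
    (f ⁻¹ᵁ U.toOpens).toScheme ⟶ s.specInvariants U :=
  (f ⁻¹ᵁ U.toOpens).toSpecΓ ≫
    Spec.map (CommRingCat.ofHom (invariantSubring (s.act U.toOpens)).subtype)

/-- The quotient of `T` by the action is glued from the spectra of invariant sections. -/
lemma exists_quotient (H : ((toOpensFunctor P).op.whiskerLeft s.toInvariants).Coequifibered) :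
    ∃ (T₀ : Scheme.{u}) (g : T ⟶ T₀) (q : T₀ ⟶ P) (ι : ∀ U, s.specInvariants U ⟶ T₀), g ≫ q = f ∧
      (∀ U, IsOpenImmersion (ι U)) ∧ (∀ U, Set.range (ι U) = q ⁻¹' (U.toOpens : Set P)) ∧
      ∀ U, (f ⁻¹ᵁ U.toOpens).ι ≫ g = s.toSpecInvariants U ≫ ι U := by
  -- By `H`, the spectrum of invariants over a basic open set is the restriction of the one over the
  -- larger affine open set. This is what gluing over `P` requires.
  let d : (directedCover P).RelativeGluingData := relativeGluingData H
  have : (d.functor ⋙ Scheme.forget).IsLocallyDirected :=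
    Scheme.Cover.RelativeGluingData.instIsLocallyDirectedI₀CompFunctorForgetOfIsThin ..
  let ι (U : P.AffineZariskiSite) : s.specInvariants U ⟶ d.glued := colimit.ι d.functor U
  have hι (U : P.AffineZariskiSite) : IsOpenImmersion (ι U) := d.cover.map_prop U
  have hw {U V : P.AffineZariskiSite} (h' : U ≤ V) (h : U.toOpens ≤ V.toOpens) :
      Spec.map (s.invariants.map (homOfLE h).op) ≫ ι V = ι U :=
    colimit.w d.functor (homOfLE h')
  have hq (U : P.AffineZariskiSite) :
      ι U ≫ d.toBase = Spec.map (s.toInvariants.app (.op U.toOpens)) ≫ U.2.fromSpec :=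
    colimit.ι_desc _ _
  obtain ⟨g, hg⟩ := exists_glue_of_affineZariskiSite f (fun U ↦ s.toSpecInvariants U ≫ ι U) (by
    intro U V h' h
    let i (W : P.AffineZariskiSite) : Spec Γ(T, f ⁻¹ᵁ W.toOpens) ⟶ s.specInvariants W :=
      Spec.map (CommRingCat.ofHom (invariantSubring (s.act W.toOpens)).subtype)
    let r : s.specInvariants U ⟶ s.specInvariants V := Spec.map (s.invariants.map (homOfLE h).op)
    have h₁ : Spec.map (T.presheaf.map (homOfLE (f.preimage_mono h)).op) ≫ i V = i U ≫ r :=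
      (Spec.map_comp _ _).symm.trans (Spec.map_comp (s.invariants.map (homOfLE h).op)
        (CommRingCat.ofHom (invariantSubring (s.act U.toOpens)).subtype))
    have h₂ : r ≫ ι V = ι U := hw h' h
    change T.homOfLE _ ≫ ((f ⁻¹ᵁ V.toOpens).toSpecΓ ≫ i V) ≫ ι V =
      ((f ⁻¹ᵁ U.toOpens).toSpecΓ ≫ i U) ≫ ι U
    rw [← h₂, Category.assoc, Category.assoc, ← Scheme.Opens.toSpecΓ_SpecMap_presheaf_map_assoc,
      reassoc_of% h₁])
  refine ⟨d.glued, g, d.toBase, ι, ?_, hι, fun U ↦ ?_, hg⟩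
  · refine Scheme.Cover.hom_ext (T.openCoverOfIsOpenCover _
      (.comap (iSup_affineOpens_eq_top P) f.base.1)) _ _ fun (U : P.AffineZariskiSite) ↦ ?_
    have h₁ : s.toSpecInvariants U ≫ ι U ≫ d.toBase =
        (f ⁻¹ᵁ U.toOpens).toSpecΓ ≫ Spec.map (f.app U.toOpens) ≫ U.2.fromSpec := by
      rw [hq]
      exact (Category.assoc _ _ _).trans (congrArg (_ ≫ ·) (Spec.map_comp_assoc _ _ _).symm)
    have h₂ : (f ⁻¹ᵁ U.toOpens).ι ≫ g ≫ d.toBase = (f ⁻¹ᵁ U.toOpens).ι ≫ f := by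
      rw [← Category.assoc, hg, Category.assoc, h₁]
      exact toSpecΓ_comp_specMap_app_comp_fromSpec f U.2
    exact h₂
  · have := d.preimage_toBase_eq_range_ι U
    refine this.symm.trans ?_
    congr 1
    exact Scheme.Opens.range_ι _

end SchemeAction

/-! ### Semilinear actions of a Galois group -/

lemma le_preimage_top {T S : Scheme.{u}} (π : T ⟶ S) (U : T.Opens) : U ≤ π ⁻¹ᵁ ⊤ := le_top

/-- The constants in the sections of a scheme over an affine scheme. -/
def constHom {T : Scheme.{u}} {R : CommRingCat.{u}} (π : T ⟶ Spec R) (U : T.Opens) : R ⟶ Γ(T, U) :=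
  (Scheme.ΓSpecIso R).inv ≫ π.appLE ⊤ U (le_preimage_top π U)

lemma toSpecΓ_comp_specMap_constHom {T : Scheme.{u}} {R : CommRingCat.{u}} (π : T ⟶ Spec R)
    {U : T.Opens} (hU : IsAffineOpen U) :
    U.toSpecΓ ≫ Spec.map (constHom π U) = U.ι ≫ π := by
  have h := IsAffineOpen.SpecMap_appLE_fromSpec π (isAffineOpen_top (Spec R)) hU
    (le_preimage_top π U)
  rw [IsAffineOpen.fromSpec_top, Scheme.isoSpec_Spec_inv] at h
  rw [constHom, Spec.map_comp, h, ← Category.assoc, hU.toSpecΓ_fromSpec]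

namespace SchemeAction

variable {l L : Type u} [Field l] [Field L] [Algebra l L] {T P : Scheme.{u}} {f : T ⟶ P}
  (s : SchemeAction (L ≃ₐ[l] L) f) (π : T ⟶ Spec (.of L))

lemma act_constHom (hπ : ∀ σ, s.map σ ≫ π = π ≫ Spec.map (CommRingCat.ofHom (σ : L →+* L)))
    (U : P.Opens) (σ : L ≃ₐ[l] L) (c : L) :
    s.act U σ (constHom π (f ⁻¹ᵁ U) c) = constHom π (f ⁻¹ᵁ U) (σ c) := by
  have h : constHom π (f ⁻¹ᵁ U) ≫ (s.map σ).appLE _ _ (s.preimage_eq σ U).ge =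
      CommRingCat.ofHom (σ : L →+* L) ≫ constHom π (f ⁻¹ᵁ U) := by
    rw [constHom, Category.assoc, Scheme.Hom.appLE_comp_appLE, Scheme.ΓSpecIso_inv_naturality_assoc]
    simp_rw [hπ]
    rw [Scheme.Hom.comp_appLE]
    rfl
  exact congr($h c)

variable [FiniteDimensional l L] [IsGalois l L]

/-- Galois descent for a scheme that is affine over a scheme defined over the smaller field. -/
theorem exists_isPullback (hπ : ∀ σ, s.map σ ≫ π = π ≫ Spec.map (CommRingCat.ofHom (σ : L →+* L)))
    [IsAffineHom f] (p : P ⟶ Spec (.of l))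
    (hw : f ≫ p = π ≫ Spec.map (CommRingCat.ofHom (algebraMap l L))) :
    ∃ (T₀ : Scheme.{u}) (g : T ⟶ T₀) (q : T₀ ⟶ P), g ≫ q = f ∧
      IsPullback g π (q ≫ p) (Spec.map (CommRingCat.ofHom (algebraMap l L))) := by
  obtain ⟨c, hc⟩ := exists_sum_algEquiv_eq_one l L
  -- A constant of trace one in `L` provides a section of trace one over every open set.
  have H := s.coequifibered_toInvariants fun U ↦ ⟨constHom π (f ⁻¹ᵁ U) c, by
    simp_rw [s.act_constHom π hπ, ← _root_.map_sum, hc, _root_.map_one]⟩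
  obtain ⟨T₀, g, q, ι, hgq, hι, hr, hg⟩ := s.exists_quotient H
  refine ⟨T₀, g, q, hgq, ?_⟩
  let 𝒰 : T₀.OpenCover := Scheme.Cover.mkOfCovers P.AffineZariskiSite s.specInvariants ι
    (fun x ↦ by
      obtain ⟨U, hU, hxU, -⟩ := exists_isAffineOpen_mem_and_subset (x := q x) (U := ⊤) trivial
      obtain ⟨y, hy⟩ := (hr ⟨U, hU⟩).ge hxU
      exact ⟨⟨U, hU⟩, y, hy⟩) hι
  have hgp : g ≫ q ≫ p = f ≫ p := by rw [← Category.assoc, hgq]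
  have h₁ (U : P.AffineZariskiSite) :
      IsPullback (f ⁻¹ᵁ U.toOpens).ι (s.toSpecInvariants U) g (ι U) := by
    have := hι U
    refine (IsOpenImmersion.isPullback (s.toSpecInvariants U) (f ⁻¹ᵁ U.toOpens).ι (ι U) g
      (hg U) ?_).flip
    apply TopologicalSpace.Opens.ext
    rw [Scheme.Opens.opensRange_ι]
    change g ⁻¹' (Set.range (ι U)) = _
    rw [hr, ← hgq]
    rfl
  -- Since `f` is affine, over an affine open set the square is the spectrum of the pushout
  -- `isPushout_invariantSubring`.
  have h₂ (U : P.AffineZariskiSite) : IsPullback (s.toSpecInvariants U)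
      ((f ⁻¹ᵁ U.toOpens).ι ≫ π) (ι U ≫ q ≫ p)
      (Spec.map (CommRingCat.ofHom (algebraMap l L))) := by
    have hU : IsAffineOpen (f ⁻¹ᵁ U.toOpens) := U.2.preimage f
    have hiso : IsIso (f ⁻¹ᵁ U.toOpens).toSpecΓ := inferInstanceAs (IsIso hU.isoSpec.hom)
    obtain ⟨γ, hγ⟩ := Spec.map_surjective (ι U ≫ q ≫ p)
    have hγ' : γ ≫ CommRingCat.ofHom (invariantSubring (s.act U.toOpens)).subtype =
        CommRingCat.ofHom (algebraMap l L) ≫ constHom π (f ⁻¹ᵁ U.toOpens) := by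
      apply Spec.map_injective
      rw [← cancel_epi (f ⁻¹ᵁ U.toOpens).toSpecΓ, Spec.map_comp, Spec.map_comp, hγ,
        ← Category.assoc _ (Spec.map (constHom _ _)), toSpecΓ_comp_specMap_constHom π hU,
        Category.assoc, ← hw, ← hgp, ← Category.assoc, ← Category.assoc _ g, hg]
      exact (Category.assoc _ _ _).symm
    rw [← hγ, ← toSpecΓ_comp_specMap_constHom π hU]
    let := (constHom π (f ⁻¹ᵁ U.toOpens)).hom.toAlgebra
    let := γ.hom.toAlgebra
    let := (CommRingCat.ofHom (algebraMap l L) ≫ constHom π (f ⁻¹ᵁ U.toOpens)).hom.toAlgebra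
    have t₁ : IsScalarTower l L Γ(T, f ⁻¹ᵁ U.toOpens) := .of_algebraMap_eq' rfl
    have t₂ : IsScalarTower l (invariantSubring (s.act U.toOpens)) Γ(T, f ⁻¹ᵁ U.toOpens) :=
      .of_algebraMap_eq' congr($(hγ').hom).symm
    have := isPushout_invariantSubring (s.act U.toOpens) (s.act_constHom π hπ U.toOpens)
    have h₃ := isPullback_SpecMap_of_isPushout _ _ _ _ (CommRingCat.isPushout_of_isPushout l L
      (invariantSubring (s.act U.toOpens)) Γ(T, f ⁻¹ᵁ U.toOpens))
    exact h₃.flip.of_iso (asIso (f ⁻¹ᵁ U.toOpens).toSpecΓ).symm (Iso.refl _) (Iso.refl _)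
      (Iso.refl _) (by simp [toSpecInvariants]; rfl) (by simp; rfl) (by simp; rfl) (by simp)
  exact isPullback_of_openCover_of_isPullback 𝒰
    (fun U : P.AffineZariskiSite ↦ (f ⁻¹ᵁ U.toOpens).ι) s.toSpecInvariants h₁ h₂

end SchemeAction

/-! ### Covers of curves are finite -/

namespace AlgebraicGeometry

/-- A proper closed subset of a one-dimensional noetherian irreducible scheme is finite. -/
lemma finite_of_isClosed_of_genericPoint_notMem {T : Scheme.{u}} [IrreducibleSpace T]
    [TopologicalSpace.NoetherianSpace T] (hT : topologicalKrullDim T = 1) {Z : Set T}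
    (hZ : IsClosed Z) (hη : genericPoint T ∉ Z) : Z.Finite := by
  obtain ⟨S, hirr, hsup⟩ := TopologicalSpace.NoetherianSpace.exists_finset_irreducible
    (⟨Z, hZ⟩ : TopologicalSpace.Closeds T)
  have hZS : Z ⊆ ⋃ W ∈ S, (W : Set T) := by
    have h := TopologicalSpace.Closeds.coe_finset_sup id S
    rw [← hsup, Finset.sup_set_eq_biUnion] at h
    exact h.le
  refine (S.finite_toSet.biUnion fun W hW ↦ ?_).subset hZS
  have hWZ : (W : Set T) ⊆ Z := by
    have : W ≤ (⟨Z, hZ⟩ : TopologicalSpace.Closeds T) := by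
      rw [hsup]
      exact Finset.le_sup (f := id) hW
    exact this
  -- The generic point of an irreducible piece of `Z` is not that of `T`, so it has no proper
  -- specializations and the piece is a single point.
  obtain ⟨z, hz⟩ := QuasiSober.sober (hirr ⟨W, hW⟩) W.isClosed
  refine (Set.finite_singleton z).subset fun y hy ↦ ?_
  have hzy : z ⤳ y := hz.specializes hy
  rcases ((topologicalKrullDim_eq_one_iff T).mp hT).2 z y hzy with h | h
  · exact (hη (h ▸ hWZ hz.mem)).elim
  · exact h.symm

/-- A non-constant proper morphism from a curve is finite. -/
lemma isFinite_of_not_subsingleton_range {T P : Scheme.{u}} (f : T ⟶ P) [IsProper f]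
    [IrreducibleSpace T] [TopologicalSpace.NoetherianSpace T] (hT : topologicalKrullDim T = 1)
    (hf : ¬ (Set.range f).Subsingleton) : IsFinite f := by
  -- A proper morphism is finite once its fibers are finite.
  suffices LocallyQuasiFinite f from .of_isProper_of_locallyQuasiFinite f
  rw [locallyQuasiFinite_iff_finite_preimage_singleton]
  intro y
  have hspec := ((topologicalKrullDim_eq_one_iff T).mp hT).2
  -- If the fiber of the image of the generic point contained another point, that point would be
  -- closed, hence so would `y`, and `f` would be constant. Any other fiber lies in a closed set
  -- that misses the generic point, and is therefore finite.
  by_cases hy : f (genericPoint T) = y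
  · refine (Set.finite_singleton (genericPoint T)).subset fun t ht ↦ ?_
    by_contra hne
    have hcl : IsClosed {t} := by
      rw [← closure_subset_iff_isClosed]
      intro x hx
      exact ((hspec t x (specializes_iff_mem_closure.mpr hx)).resolve_left hne).symm
    have hcl' : IsClosed {y} := by
      have := f.isClosedMap _ hcl
      rwa [Set.image_singleton, ht] at this
    have hall (x : T) : f x = y :=
      (genericPoint_specializes x).mem_closed (hcl'.preimage f.continuous) hy
    refine hf ?_
    rintro _ ⟨a, rfl⟩ _ ⟨b, rfl⟩
    rw [hall, hall]
  · by_cases hne : (f ⁻¹' {y}).Nonempty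
    · obtain ⟨t, rfl⟩ := hne
      refine (finite_of_isClosed_of_genericPoint_notMem hT
        (isClosed_closure.preimage f.continuous) fun h ↦ hy ?_).subset
          (Set.preimage_mono subset_closure)
      exact ((genericPoint_specializes t).map f.continuous).antisymm
        (specializes_iff_mem_closure.mpr h) |>.eq
    · rw [Set.not_nonempty_iff_eq_empty.mp hne]
      exact Set.finite_empty

end AlgebraicGeometry

/-- The morphism `T ⟶ C ×_k S` of a cover of curves is finite. -/
lemma Family.IsAdmissible.isFinite_toProd {k l : Type u} [Field k] [Field l] [Algebra k l]
    {κ : Kind k} (hκ : κ ≠ .variety) {T : Family κ (specOver k l)} (hT : T.IsAdmissible) :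
    IsFinite T.toProd := by
  cases κ with
  | variety => exact (hκ rfl).elim
  | cover C hC =>
    obtain ⟨h₁, h₂⟩ := hT
    let π : T.T ⟶ Spec (.of l) := T.π
    obtain ⟨_, hp, hi, hd⟩ := (IsSmoothProjectiveCurve.iff_topologicalKrullDim (π := π)).mp h₁
    have := irreducibleSpace_of_geometricallyIntegral π hi
    have : IsLocallyNoetherian T.T := LocallyOfFiniteType.isLocallyNoetherian π
    have : CompactSpace T.T := (quasiCompact_iff_compactSpace π).mp inferInstance
    have : IsNoetherian T.T := {}
    have hsep : IsSeparated (pullback.snd (Kind.cover C hC).base.hom (specOver k l).hom) :=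
      have : IsSeparated C.hom := hC.proper.toIsSeparated
      inferInstanceAs (IsSeparated (pullback.snd C.hom (specOver k l).hom))
    have hcomp : IsProper (T.toProd ≫ pullback.snd _ _) := T.toProd_snd ▸ hp
    have : IsProper T.toProd := IsProper.of_comp _ (pullback.snd _ _)
    exact isFinite_of_not_subsingleton_range T.toProd hd
      ((forall_not_subsingleton_image_iff (π := π) T.toProd).mp h₂)

/-! ### Galois descent of covers of curves -/

namespace Family

variable {k l L : Type u} [Field k] [Field l] [Field L] [Algebra k l] [Algebra k L] [Algebra l L]
  [IsScalarTower k l L] {κ : Kind k}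

/-- The morphism `T ⟶ C ×_k Spec l` of a family over an extension of `l`. -/
def toProdBase (l : Type u) [Field l] [Algebra k l] [Algebra l L] [IsScalarTower k l L]
    (T : Family κ (specOver k L)) :
    T.T ⟶ pullback κ.base.hom (specOver k l).hom :=
  pullback.lift T.φ (T.π ≫ (specOverMap (IsScalarTower.toAlgHom k l L)).left)
    (by rw [T.w, Category.assoc, Over.w])

/-- The morphism is the finite `T.toProd` followed by a base change of `Spec L ⟶ Spec l`. Affineness
over a scheme defined over `l` is what makes Galois descent effective for covers. -/
lemma isAffineHom_toProdBase (T : Family κ (specOver k L)) [IsFinite T.toProd] :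
    IsAffineHom (T.toProdBase l) := by
  let v : specOver k L ⟶ specOver k l := specOverMap (IsScalarTower.toAlgHom k l L)
  have hv : IsAffineHom v.left :=
    inferInstanceAs (IsAffineHom (Spec.map (CommRingCat.ofHom (algebraMap l L))))
  let m : pullback κ.base.hom (specOver k L).hom ⟶ pullback κ.base.hom (specOver k l).hom :=
    pullback.lift (pullback.fst _ _) (pullback.snd _ _ ≫ v.left)
      (by rw [Category.assoc, Over.w v, pullback.condition])
  have hm : IsPullback m (pullback.snd κ.base.hom (specOver k L).hom)
      (pullback.snd κ.base.hom (specOver k l).hom) v.left := by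
    refine IsPullback.of_right (h₁₂ := pullback.fst _ _) ?_ ?_
      (IsPullback.of_hasPullback κ.base.hom (specOver k l).hom)
    · rw [pullback.lift_fst, Over.w v]
      exact IsPullback.of_hasPullback κ.base.hom (specOver k L).hom
    · rw [pullback.lift_snd]
  have : IsAffineHom m := MorphismProperty.of_isPullback hm.flip hv
  have h : T.toProdBase l = T.toProd ≫ m := by
    apply pullback.hom_ext
    · refine (pullback.lift_fst _ _ _).trans ?_
      rw [Category.assoc]
      exact (T.toProd_fst.symm.trans (congrArg (T.toProd ≫ ·) (pullback.lift_fst _ _ _).symm))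
    · refine (pullback.lift_snd _ _ _).trans ?_
      rw [Category.assoc, ← T.toProd_snd, Category.assoc]
      exact congrArg (T.toProd ≫ ·) (pullback.lift_snd _ _ _).symm
  rw [h]
  infer_instance

/-- Galois descent for covers of curves. -/
theorem exists_cartHom_of_isGalois [FiniteDimensional l L] [IsGalois l L] (hκ : κ ≠ .variety)
    {T : Family κ (specOver k L)} (hT : T.IsAdmissible)
    (s : ∀ σ : L ≃ₐ[l] L, T.CartHom T (specOverMap (σ.restrictScalars k : L →ₐ[k] L)))
    (h_one : (s 1).top = 𝟙 _) (h_mul : ∀ σ τ, (s (σ * τ)).top = (s σ).top ≫ (s τ).top) :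
    ∃ T₀ : Family κ (specOver k l),
      Nonempty (T.CartHom T₀ (specOverMap (IsScalarTower.toAlgHom k l L))) := by
  have := hT.isFinite_toProd hκ
  have := T.isAffineHom_toProdBase (l := l)
  have hv (σ : L ≃ₐ[l] L) : specOverMap (σ.restrictScalars k : L →ₐ[k] L) ≫
      specOverMap (IsScalarTower.toAlgHom k l L) = specOverMap (IsScalarTower.toAlgHom k l L) := by
    rw [specOverMap_comp]
    congr 1
    ext x
    exact σ.commutes x
  let A : SchemeAction (L ≃ₐ[l] L) (T.toProdBase l) :=
    { map := fun σ ↦ (s σ).top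
      map_one := h_one
      map_mul := h_mul
      map_comp := fun σ ↦ by
        apply pullback.hom_ext
        · rw [Category.assoc]
          exact (congrArg ((s σ).top ≫ ·) (pullback.lift_fst _ _ _)).trans
            ((s σ).top_φ.trans (pullback.lift_fst _ _ _).symm)
        · rw [Category.assoc]
          refine (congrArg ((s σ).top ≫ ·) (pullback.lift_snd _ _ _)).trans
            (Eq.trans ?_ (pullback.lift_snd _ _ _).symm)
          rw [← Category.assoc, (s σ).isPullback.w, Category.assoc, ← Over.comp_left, hv] }
  obtain ⟨T₀, g, q, hgq, hg⟩ := A.exists_isPullback T.π (fun σ ↦ (s σ).isPullback.w)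
    (pullback.snd κ.base.hom (specOver k l).hom) (pullback.lift_snd _ _ _)
  refine ⟨⟨T₀, q ≫ pullback.snd _ _, q ≫ pullback.fst _ _, ?_⟩, ⟨g, hg, ?_⟩⟩
  · rw [Category.assoc, Category.assoc, pullback.condition]
  · change g ≫ q ≫ pullback.fst _ _ = _
    rw [← Category.assoc, hgq]
    exact pullback.lift_fst _ _ _

end Family

/-! ### Descent of models along fully faithful functors -/

namespace DescentObject

variable {k K : Type u} [Field k] [Field K] [Algebra k K]

/-- A cartesian square gives a morphism of "models". -/
lemma Model.exists_hom_of_cartHom {X : DescentObject k K} {M N : X.Model} {U V : FEt k}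
    (hM : M.U = U) (hN : N.U = V) (g : U ⟶ V)
    (a : (M.familyOn hM).CartHom (N.familyOn hN) (FEt.homToOver g)) :
    ∃ f : M ⟶ N, X.proj.IsHomLift g f := by
  subst hM hN
  let f : M ⟶ N := ⟨g, a.top, a.isPullback, a.top_φ⟩
  exact ⟨f, Functor.IsHomLift.map (p := X.proj) f⟩

/-- All morphisms of "models" are cartesian. -/
lemma isStronglyCartesian_proj {X : DescentObject k K} {M N : X.Model} {U V : FEt k} (g : U ⟶ V)
    (f : M ⟶ N) [hf : X.proj.IsHomLift g f] : X.proj.IsStronglyCartesian g f := by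
  obtain rfl : M.U = U := CategoryTheory.IsHomLift.domain_eq X.proj g f
  obtain rfl : N.U = V := CategoryTheory.IsHomLift.codomain_eq X.proj g f
  obtain rfl : g = X.proj.map f :=
    @CategoryTheory.IsHomLift.eq_of_isHomLift _ _ _ _ X.proj M N g f hf
  refine ⟨fun {M'} h φ' hφ' ↦ ?_⟩
  have hb : h ≫ f.base = φ'.base :=
    @CategoryTheory.IsHomLift.eq_of_isHomLift _ _ _ _ X.proj M' N (h ≫ f.base) φ' hφ'
  let a : M'.family.CartHom N.family (FEt.homToOver φ'.base) := ⟨φ'.top, φ'.isPullback, φ'.top_φ⟩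
  let b : M.family.CartHom N.family (FEt.homToOver f.base) := ⟨f.top, f.isPullback, f.top_φ⟩
  let c : M'.family.CartHom M.family (FEt.homToOver h) :=
    a.lift b (congrArg FEt.homToOver hb)
  have hc : c.top ≫ f.top = φ'.top := a.lift_top_comp_top b (congrArg FEt.homToOver hb)
  let χ : M' ⟶ M := ⟨h, c.top, c.isPullback, c.top_φ⟩
  refine ⟨χ, ⟨Functor.IsHomLift.map (p := X.proj) χ, Model.Hom.ext hb hc⟩, ?_⟩
  rintro χ' ⟨hχ', e⟩
  have hb' : h = χ'.base :=
    @CategoryTheory.IsHomLift.eq_of_isHomLift _ _ _ _ X.proj M' M h χ' hχ'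
  refine Model.Hom.ext hb'.symm ?_
  apply f.isPullback.hom_ext
  · exact congr(Model.Hom.top $e).trans hc.symm
  · rw [χ'.isPullback.w, c.isPullback.w, hb']

variable [CharZero k] [IsAlgClosure k K] {X Y : DescentObject k K}
  (F : BasedFunctor X.models Y.models)

/-- Every model of `Y` becomes, over a finite normal extension, isomorphic to the image of a model
of `X`. -/
lemma exists_cartHom_mapFamily_of_normal {l : Type u} [Field l] [Algebra k l]
    [FiniteDimensional k l] {y : Family Y.kind (specOver k l)} {e : l →ₐ[k] K}
    (a : Y.toFamily.CartHom y (specOverMap e)) :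
    ∃ (L : IntermediateField k K) (_ : FiniteDimensional k L) (_ : Normal k L) (i : l →ₐ[k] L)
      (T : Family X.kind (specOver k L))
      (hT : ∃ e' : L →ₐ[k] K, Nonempty (X.toFamily.CartHom T (specOverMap e'))),
      Nonempty ((mapFamily F T hT).CartHom y (specOverMap i)) := by
  have := IsAlgClosure.isAlgClosed k (K := K)
  have := IsAlgClosure.isAlgebraic (R := k) (K := K)
  obtain ⟨E, M, ⟨aM⟩⟩ := X.exists_cartHom_finSub
  have := E.2
  have hM : ∃ e' : E.1 →ₐ[k] K, Nonempty (X.toFamily.CartHom M (specOverMap e')) := ⟨_, ⟨aM⟩⟩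
  obtain ⟨g, ⟨b⟩⟩ := exists_cartHom_mapFamily F M hM
  obtain ⟨G, N, f, f', -, -, -, ⟨n⟩, ⟨n'⟩⟩ := Y.exists_common_model a b
  have := G.2
  -- The given model and `F M` have the common model `N` over `G`. Passing to the normal closure `L`
  -- and base changing `M` there gives `T`, and `F T ⟶ F M` factors through `N`.
  let L : IntermediateField k K := IntermediateField.normalClosure k G.1 K
  have hLn : Normal k K := IsAlgClosure.normal k K
  have hL : FiniteDimensional k L := normalClosure.is_finiteDimensional k G.1 K
  have hN : Normal k L := normalClosure.normal k G.1 K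
  let ι : G.1 →ₐ[k] L := IntermediateField.inclusion G.1.le_normalClosure
  obtain ⟨e', he'⟩ := exists_algHom_comp_eq (ι.comp f') E.1.val
  let T : Family X.kind (specOver k L) := M.baseChange (specOverMap (ι.comp f'))
  have hT : ∃ e' : L →ₐ[k] K, Nonempty (X.toFamily.CartHom T (specOverMap e')) :=
    ⟨e', ⟨aM.lift (M.baseChangeHom _) ((specOverMap_comp _ _).trans (congrArg _ he'))⟩⟩
  obtain ⟨m⟩ := nonempty_cartHom_mapFamily F (M.baseChangeHom (specOverMap (ι.comp f'))) hT hM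
  let d : (mapFamily F T hT).CartHom N (specOverMap ι) := m.lift n' (specOverMap_comp _ _)
  exact ⟨L, hL, hN, ι.comp f, T, hT, ⟨(d.comp n).cast (specOverMap_comp _ _)⟩⟩

end DescentObject

namespace DescentObject

variable {k K : Type u} [Field k] [CharZero k] [Field K] [Algebra k K] {X Y : DescentObject k K}
  (F : BasedFunctor X.models Y.models)

section

variable {l L : Type u} [Field l] [Algebra k l] [FiniteDimensional k l] [Field L] [Algebra k L]
  [FiniteDimensional k L] [F.toFunctor.Full] [F.toFunctor.Faithful]

/-- If the models of `X` form a stack, models of `X` descend when their images do. -/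
lemma exists_cartHom_of_isStack (hX : FibStack.IsStack (FEt.topology k) X.models) (i : l →ₐ[k] L)
    {m : X.Model} (hm : m.U = FEt.ofField k L) {y : Y.Model} (j : F.obj m ⟶ y)
    (hj : Y.proj.IsHomLift (R := FEt.ofField k L) (S := FEt.ofField k l) (specOverMap i) j) :
    ∃ (T : Family X.kind (specOver k l)) (e : l →ₐ[k] K),
      Nonempty (X.toFamily.CartHom T (specOverMap e)) := by
  let q : FEt.ofField k L ⟶ FEt.ofField k l := specOverMap i
  let R : Sieve (FEt.ofField k l) :=
    { arrows := fun V f ↦ ∃ g : V ⟶ FEt.ofField k L, g ≫ q = f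
      downward_closed := fun ⟨g, hg⟩ h ↦ ⟨h ≫ g, by rw [Category.assoc, hg]⟩ }
  have hR : R ∈ FEt.topology k (FEt.ofField k l) := fun x ↦
    ⟨FEt.ofField k L, q, Classical.arbitrary (PrimeSpectrum L),
      ⟨𝟙 _, Category.id_comp q⟩, Subsingleton.elim (α := PrimeSpectrum l) _ _⟩
  have := hX.isFibered
  obtain ⟨D, -, -, -⟩ := FibStack.exists_descentDatum F R y (by
    rintro V _ ⟨g, rfl⟩
    obtain ⟨x, c, hc⟩ := IsPreFibered.exists_isCartesian X.proj hm g
    have : Y.proj.IsHomLift g (F.map c) := F.preserves_isHomLift g c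
    have : Y.proj.IsHomLift (g ≫ q) (F.map c ≫ j) := inferInstance
    exact ⟨x, F.map c ≫ j, isStronglyCartesian_proj _ _⟩)
  -- Any object over `Spec l` is a "model" of `X`, so the glued object need not be compared with
  -- `y`.
  obtain ⟨x, -, hx, -⟩ := hX.isEffective R hR D
  obtain ⟨g, hg⟩ := Model.exists_cartHom_familyOn x (U := FEt.ofField k l) hx
    (Classical.arbitrary (PrimeSpectrum l))
  obtain ⟨e, rfl⟩ := exists_eq_specOverMap g
  exact ⟨_, e, hg⟩

variable [IsAlgClosure k K]

/-- If `X` is a cover of curves, models of `X` descend along Galois extensions when their images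
do. -/
lemma exists_cartHom_of_isGalois (hX : X.kind ≠ .variety) [Algebra l L] [IsScalarTower k l L]
    [IsGalois l L] {T : Family X.kind (specOver k L)}
    (hT : ∃ e : L →ₐ[k] K, Nonempty (X.toFamily.CartHom T (specOverMap e)))
    {y : Y.Model} (j : F.obj (X.modelOfFamily T hT) ⟶ y)
    (hj : Y.proj.IsHomLift (R := FEt.ofField k L) (S := FEt.ofField k l)
      (specOverMap (IsScalarTower.toAlgHom k l L)) j) :
    ∃ (T : Family X.kind (specOver k l)) (e : l →ₐ[k] K),
      Nonempty (X.toFamily.CartHom T (specOverMap e)) := by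
  have := FiniteDimensional.right k l L
  let m := X.modelOfFamily T hT
  let q : FEt.ofField k L ⟶ FEt.ofField k l := specOverMap (IsScalarTower.toAlgHom k l L)
  have hq : Y.proj.IsStronglyCartesian q j := isStronglyCartesian_proj _ _
  let b (σ : L ≃ₐ[l] L) : FEt.ofField k L ⟶ FEt.ofField k L :=
    specOverMap (σ.restrictScalars k : L →ₐ[k] L)
  have hb (σ) : b σ ≫ q = q := by
    refine (specOverMap_comp _ _).trans ?_
    congr 1
    ext x
    exact σ.commutes x
  have hb_one : b 1 = 𝟙 _ := by
    apply Over.OverMorphism.ext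
    exact Spec.map_id _
  have hb_mul (σ τ) : b (σ * τ) = b σ ≫ b τ := by
    apply Over.OverMorphism.ext
    exact Spec.map_comp (CommRingCat.ofHom (τ : L →+* L)) (CommRingCat.ofHom (σ : L →+* L))
  -- The source of the cartesian arrow `j` inherits the action of the Galois group on `Spec L` over
  -- `Spec l`, and fullness carries it to `m`. Faithfulness and the uniqueness of lifts along `j`
  -- (`huniq`) give the group law.
  have hex (σ) : ∃ s : m ⟶ m, X.proj.IsHomLift (b σ) s ∧ F.map s ≫ j = j := by
    refine ⟨F.toFunctor.preimage (IsStronglyCartesian.map Y.proj q j (hb σ).symm j), ?_, ?_⟩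
    · have : Y.proj.IsHomLift (b σ) (F.map (F.toFunctor.preimage
          (IsStronglyCartesian.map Y.proj q j (hb σ).symm j))) := by
        rw [F.toFunctor.map_preimage]
        infer_instance
      exact F.isHomLift_map (b σ) _
    · rw [F.toFunctor.map_preimage, IsStronglyCartesian.fac]
  choose s hs hsj using hex
  have huniq {g : FEt.ofField k L ⟶ FEt.ofField k L} {t t' : m ⟶ m} (ht : X.proj.IsHomLift g t)
      (ht' : X.proj.IsHomLift g t') (e : F.map t ≫ j = j) (e' : F.map t' ≫ j = j) : t = t' := by
    have := F.preserves_isHomLift g t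
    have := F.preserves_isHomLift g t'
    exact F.toFunctor.map_injective (IsStronglyCartesian.ext Y.proj q j g (e.trans e'.symm))
  have h_one : s 1 = 𝟙 m := by
    have h₁ : X.proj.IsHomLift (𝟙 (FEt.ofField k L)) (s 1) := hb_one ▸ hs 1
    refine huniq h₁ (Functor.IsHomLift.map (p := X.proj) (𝟙 m)) (hsj 1) ?_
    rw [F.toFunctor.map_id, Category.id_comp]
  have h_mul (σ τ) : s (σ * τ) = s σ ≫ s τ := by
    have h₁ : X.proj.IsHomLift (b σ ≫ b τ) (s (σ * τ)) := hb_mul σ τ ▸ hs (σ * τ)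
    have := hs σ
    have := hs τ
    refine huniq h₁ inferInstance (hsj _) ?_
    rw [F.toFunctor.map_comp, Category.assoc, hsj, hsj]
  have hbase (σ) : b σ = (s σ).base :=
    @CategoryTheory.IsHomLift.eq_of_isHomLift _ _ _ _ X.proj m m (b σ) (s σ) (hs σ)
  have hpb (σ) : IsPullback (s σ).top m.family.π m.family.π (FEt.homToOver (b σ)).left := by
    rw [hbase σ]
    exact (s σ).isPullback
  let c (σ : L ≃ₐ[l] L) : T.CartHom T (specOverMap (σ.restrictScalars k : L →ₐ[k] L)) :=
    ⟨(s σ).top, hpb σ, (s σ).top_φ⟩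
  obtain ⟨T₀, ⟨d⟩⟩ := Family.exists_cartHom_of_isGalois hX m.isAdmissible c
    congr(Model.Hom.top $h_one) (fun σ τ ↦ congr(Model.Hom.top $(h_mul σ τ)))
  obtain ⟨e, ⟨a⟩⟩ := hT
  exact ⟨T₀, e.comp (IsScalarTower.toAlgHom k l L), ⟨(a.comp d).cast (specOverMap_comp _ _)⟩⟩

end

/-- A fully faithful functor between categories of "models" reflects the existence of "models". -/
lemma HasModelOver.of_map [IsAlgClosure k K]
    (hX : X.kind = .variety → FibStack.IsStack (FEt.topology k) X.models)
    [F.toFunctor.Full] [F.toFunctor.Faithful] {l : IntermediateField k K}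
    (h : Y.HasModelOver l) : X.HasModelOver l := by
  obtain ⟨E, y, e, ⟨a⟩⟩ := h.exists_finSub
  have := E.2
  obtain ⟨L, _, _, i, T, hT, ⟨d⟩⟩ := exists_cartHom_mapFamily_of_normal F a
  obtain ⟨j, hj⟩ := Model.exists_hom_of_cartHom (M := F.obj (X.modelOfFamily T hT))
    (N := Y.modelOfFamily y ⟨e, ⟨a⟩⟩) (U := FEt.ofField k L) (V := FEt.ofField k E.1)
    (F.w_obj (X.modelOfFamily T hT)) rfl (specOverMap i) d
  obtain ⟨x, e', ⟨b⟩⟩ : ∃ (T : Family X.kind (specOver k E.1)) (e : E.1 →ₐ[k] K),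
      Nonempty (X.toFamily.CartHom T (specOverMap e)) := by
    by_cases hv : X.kind = .variety
    · exact exists_cartHom_of_isStack F (hX hv) i rfl j hj
    · let := i.toRingHom.toAlgebra
      have : IsScalarTower k E.1 L := .of_algebraMap_eq' i.comp_algebraMap.symm
      have : IsGalois k L := {}
      have : IsGalois E.1 L := IsGalois.tower_top_of_isGalois k E.1 L
      exact exists_cartHom_of_isGalois F hv hT j hj
  exact .of_finSub b

end DescentObject

end

/-! ### The proposition and the lemma on gerbes -/

theorem mainTheorem8 {k K : Type u} [Field k] [CharZero k] [Field K] [Algebra k K]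
    [IsAlgClosure k K] :
    (∀ (X Y : DescentObject k K) (F : BasedFunctor X.models Y.models),
      FibStack.IsCartesianFunctor F →
      (X.HasFieldOfModuli → Y.HasFieldOfModuli) ∧
      (∀ l : IntermediateField k K, X.HasModelOver l → Y.HasModelOver l) ∧
      (X.HasFieldOfModuli →
        ∀ l : IntermediateField k K, X.IsFieldOfDefinition l → Y.IsFieldOfDefinition l) ∧
      (X.HasFieldOfModuli →
        (X.kind = .variety → FibStack.IsStack (FEt.topology k) X.models) →
        (Y.kind = .variety → FibStack.IsStack (FEt.topology k) Y.models) →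
        F.toFunctor.Full → F.toFunctor.Faithful →
        (∀ l : IntermediateField k K, X.IsFieldOfDefinition l ↔ Y.IsFieldOfDefinition l) ∧
        (X.HasDescentObstruction ↔ Y.HasDescentObstruction))) ∧
    (∀ {𝒮 : Type u₁} [Category.{v₁} 𝒮] (J : GrothendieckTopology 𝒮)
      (𝒳 : BasedCategory.{v₂, u₂} 𝒮) (𝒴 : BasedCategory.{v₃, u₃} 𝒮) (F : BasedFunctor 𝒳 𝒴),
      FibStack.IsGerbe J 𝒳 → FibStack.IsGerbe J 𝒴 → FibStack.IsCartesianFunctor F →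
      F.toFunctor.Full → F.toFunctor.Faithful → FibStack.IsFiberwiseEssSurj F) := by
  refine ⟨fun X Y F _ ↦ ?_, fun J 𝒳 𝒴 F h𝒳 h𝒴 hF hfull hfaith ↦
    FibStack.isFiberwiseEssSurj_of_isGerbe J F h𝒳 h𝒴 hF hfull hfaith⟩
  have hdef (hX : X.HasFieldOfModuli) (l : IntermediateField k K) (h : X.IsFieldOfDefinition l) :
      Y.IsFieldOfDefinition l :=
    (hX.map F).isFieldOfDefinition (DescentObject.HasModelOver.map F ⟨_, h⟩)
  refine ⟨fun hX ↦ hX.map F, fun l h ↦ h.map F, hdef, fun hX hXs _ _ _ ↦ ?_⟩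
  have hiff (l : IntermediateField k K) : X.IsFieldOfDefinition l ↔ Y.IsFieldOfDefinition l :=
    ⟨hdef hX l, fun h ↦ hX.isFieldOfDefinition (DescentObject.HasModelOver.of_map F hXs ⟨_, h⟩)⟩
  exact ⟨hiff, ⟨fun h ↦ ⟨hX.map F, fun h' ↦ h.2 ((hiff ⊥).mpr h')⟩,
    fun h ↦ ⟨hX, fun h' ↦ h.2 ((hiff ⊥).mp h')⟩⟩⟩
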